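/- Let $d=2$, $\mathcal E=\{\pm e_1,\pm e_2\}\subset\mathbb Z^2$, and let $\Omega=\mathcal E^{\mathbb Z^2\cup\{\star\}}$ be the set of arrow environments seen from a walker, $\omega(\star)$ being the arrow in the walker's hand. For $e\in\mathcal E$ define $\tau_e\omega(x)=\omega(x+e)$ for $x\in\mathbb Z^2$ and $\tau_e\omega(\star)=\omega(\star)$; put $\tau_\star\omega=\tau_{\omega(\star)}\omega$; and let $\sigma\omega$ be $\omega$ with the values at $0$ and at $\star$ exchanged. For a step map $\tau$ set $$T[\tau]f(\omega)=f(\sigma\tau\omega)-f(\omega),\qquad \widetilde T[\tau]f(\omega)=\tfrac14\big(f(\tau\omega)+f(\sigma\tau\omega)+f(\tau\sigma\omega)+f(\sigma\tau\sigma\omega)\big)-f(\omega),$$ and $U=\frac14\sum_{e\in\mathcal E}\widetilde T[\tau_e]$. For fixed $\varepsilon>0$, the environment process $(\eta_t)_{t\ge0}$ of the model $\mathrm{M1}_\varepsilon$ (respectively $\mathrm{M2}_\varepsilon$) is the continuous-time Markov jump process on $\Omega$ with generator $T[\tau_\star]+\varepsilon U$ (respectively $\widetilde T[\tau_\star]+\varepsilon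 U$). The walker's position $X_t\in\mathbb Z^2$ starts at $X_0=0$ and is increased, at each jump, by the step made at that jump: by $e$ when the jump uses $\tau_e$, and by the arrow that is in the hand when the step is made (that is, after any swap preceding the step) when the jump uses $\tau_\star$. For $p=(p_1,p_2)\in[0,1]^2$ with $p_1+p_2=1$ let $\mu_p(\pm e_i)=\tfrac12p_i$, and let $\pi_p$ be the product measure on $\Omega$ with all marginals, including the one at $\star$, equal to $\mu_p$. Start the process from $\eta_0\sim\pi_p$, and put $E(t)=\mathbb E[|X_t|^2]$ and $\widehat E(\lambda)=\int_0^\infty E(t)e^{-\lambda t}\,dt\in[0,\infty]$. (i) For every $\varepsilon>0$ and every such $p$ there is a constant $D>0$ (depending on $\varepsilon$ and $p$) such that, for both $\mathrm{M1}_\varepsilon$ and $\mathrm{M2}_\varepsilon$ and all sufficiently small $\lambda>0$, $$\widehat E(\lambda)\le D\,\lambda^{-2}\log(\lambda^{-1}).$$ (ii) If $p=(1,0)$ or $p=(0,1)$, then for every $\varepsilon>0$ there is a constant $C>0$ (depending on $\varepsilon$ and $p$) such that, for both $\mathrm{M1}_\varepsilon$ and $\mathrm{M2}_\varepsilon$ and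 all sufficiently small $\lambda>0$, $$\widehat E(\lambda)\ge C\,\lambda^{-2}\sqrt{\log(\lambda^{-1})}.$$ -/

import Mathlib

open scoped ENNReal Topology

namespace StoredMomentum

noncomputable section

/-! ### Arrows, environments and the elementary maps -/

/-- The `2d` canonical unit vectors: `(i, true)` stands for `+e_i` and `(i, false)` for `-e_i`. -/
abbrev Dir (d : ℕ) := Fin d × Bool

/-- The lattice `ℤ^d`. -/
abbrev Site (d : ℕ) := Fin d → ℤ

/-- The unit vector of `ℤ^d` named by an element of `Dir d`. -/
def Dir.vec {d : ℕ} (a : Dir d) : Site d :=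
  if a.2 then Pi.single a.1 1 else -Pi.single a.1 1

/-- Environments seen from the walker, with the arrow in its hand: arrows at the points of
`ℤ^d ∪ {⋆}`. Here `some x` is the site `x` and `none` is the hand `⋆`. -/
abbrev Env (d : ℕ) := Option (Site d) → Dir d

/-- The shift `τ_e`. -/
def shift {d : ℕ} (e : Dir d) (ω : Env d) : Env d
  | none => ω none
  | some x => ω (some (x + e.vec))

/-- The shift `τ_⋆` in the direction of the hand arrow. -/
def shiftHand {d : ℕ} (ω : Env d) : Env d := shift (ω none) ω

/-- The swap `σ` of the hand arrow and the arrow at the walker's site. -/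
def swap {d : ℕ} (ω : Env d) : Env d := fun x =>
  if x = none then ω (some 0) else if x = some 0 then ω none else ω x

/-! ### Generators -/

/-- `T[τ]`: step, then swap, at rate one. -/
def T {d : ℕ} (τ : Env d → Env d) (f : Env d → ℝ) (ω : Env d) : ℝ :=
  f (swap (τ ω)) - f ω

/-- `T̃[τ]`: at rate one, step, with a swap with probability `1/2` before and after the step. -/
def Ttilde {d : ℕ} (τ : Env d → Env d) (f : Env d → ℝ) (ω : Env d) : ℝ :=
  1 / 4 * f (τ ω) + 1 / 4 * f (swap (τ ω)) + 1 / 4 * f (τ (swap ω))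
    + 1 / 4 * f (swap (τ (swap ω))) - f ω

/-- The elliptic part `U`. -/
def U {d : ℕ} (f : Env d → ℝ) (ω : Env d) : ℝ :=
  1 / (2 * (d : ℝ)) * ∑ e : Dir d, Ttilde (shift e) f ω

/-- The two models. -/
inductive Model
  | M1
  | M2

/-- The generator of the environment process: `T[τ_⋆] + ε U` for `M1_ε` and `T̃[τ_⋆] + ε U`
for `M2_ε`. -/
def generator {d : ℕ} (M : Model) (ε : ℝ) (f : Env d → ℝ) (ω : Env d) : ℝ :=
  match M with
  | .M1 => T shiftHand f ω + ε * U f ω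
  | .M2 => Ttilde shiftHand f ω + ε * U f ω

/-! ### Jumps -/

/-- The possible jumps `(s, b, b')`. The walker swaps before the step iff `b`, and after the step
iff `b'`. The step is in the direction of the hand arrow if `s = none`, and in the direction `e`
if `s = some e`. -/
abbrev Jump (d : ℕ) := Option (Dir d) × Bool × Bool

/-- The finite set of steps carries the discrete `σ`-algebra. -/
instance {d : ℕ} : MeasurableSpace (Option (Dir d)) := ⊤

instance {d : ℕ} : DiscreteMeasurableSpace (Option (Dir d)) := ⟨fun _ => trivial⟩

/-- Swap or do nothing. -/
def swapIf {d : ℕ} (b : Bool) (ω : Env d) : Env d := if b then swap ω else ω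

/-- The direction of the step made by the jump `m` in the environment `ω`. -/
def stepDir {d : ℕ} (m : Jump d) (ω : Env d) : Dir d :=
  match m.1 with
  | none => swapIf m.2.1 ω none
  | some e => e

/-- The environment seen by the walker after the jump `m`. -/
def jumpEnv {d : ℕ} (m : Jump d) (ω : Env d) : Env d :=
  swapIf m.2.2 (shift (stepDir m ω) (swapIf m.2.1 ω))

/-- The rates at which the jumps occur. -/
def rate {d : ℕ} (M : Model) (ε : ℝ) (m : Jump d) : ℝ :=
  match m.1 with
  | none =>
    match M with
    | .M1 => if m.2 = (false, true) then 1 else 0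
    | .M2 => 1 / 4
  | some _ => ε / (8 * (d : ℝ))

/-- The jumps and their rates are those encoded in the generator. -/
theorem sum_rate_mul_eq_generator {d : ℕ} (M : Model) (ε : ℝ) (f : Env d → ℝ) (ω : Env d) :
    ∑ m : Jump d, rate M ε m * (f (jumpEnv m ω) - f ω) = generator M ε f ω := by
  have key : ∀ e : Dir d, ∑ b : Bool × Bool,
      rate M ε (some e, b) * (f (jumpEnv (some e, b) ω) - f ω)
        = ε * (1 / (2 * (d : ℝ)) * Ttilde (shift e) f ω) := by
    intro e
    simp only [Fintype.sum_prod_type, Fintype.sum_bool, rate, jumpEnv, stepDir, swapIf, Ttilde,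
      if_true, Bool.false_eq_true, if_false]
    have h : ε / (8 * (d : ℝ)) = ε * (1 / (2 * (d : ℝ))) * (1 / 4) := by
      rw [one_div, one_div, div_eq_mul_inv, mul_inv, mul_inv]; ring
    rw [h]; ring
  rw [Fintype.sum_prod_type, Fintype.sum_option]
  simp only [key]
  rw [← Finset.mul_sum, ← Finset.mul_sum]
  cases M
  · simp [rate, jumpEnv, stepDir, swapIf, generator, T, U, shiftHand]
  · simp [Fintype.sum_prod_type, rate, jumpEnv, stepDir, swapIf, generator, Ttilde, U,
      shiftHand]
    ring

/-- For `d ≥ 1` jumps occur at total rate `1 + ε`. -/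
theorem sum_rate {d : ℕ} (hd : d ≠ 0) (M : Model) (ε : ℝ) :
    ∑ m : Jump d, rate M ε m = 1 + ε := by
  have hd' : (d : ℝ) ≠ 0 := by exact_mod_cast hd
  rw [Fintype.sum_prod_type, Fintype.sum_option]
  cases M <;> simp [Fintype.sum_prod_type, rate] <;> field_simp <;> ring

/-! ### Randomness -/

open MeasureTheory

/-- The distribution `μ_p` of one arrow: `μ_p(±e_i) = p_i / 2`. -/
def arrowLaw {d : ℕ} (p : Fin d → ℝ) : Measure (Dir d) :=
  ∑ a : Dir d, ENNReal.ofReal (p a.1 / 2) • Measure.dirac a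

/-- The product measure `π_p`, the law of the initial environment and hand arrow. -/
def envLaw {d : ℕ} (p : Fin d → ℝ) : Measure (Env d) :=
  Measure.infinitePi fun _ => arrowLaw p

/-- The law of a single jump: each jump is chosen with probability proportional to its rate. -/
def jumpLaw {d : ℕ} (M : Model) (ε : ℝ) : Measure (Jump d) :=
  ∑ m : Jump d, ENNReal.ofReal (rate M ε m / (1 + ε)) • Measure.dirac m

/-- The sample space: the initial environment, the sequence of jumps, and the sequence of waiting
times between successive jumps. -/
abbrev Sample (d : ℕ) := Env d × (ℕ → Jump d) × (ℕ → ℝ)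

/-- Under this probability measure the initial environment has law `π_p`, the jumps are i.i.d. with
law `jumpLaw`, the waiting times are i.i.d. exponential with parameter `1 + ε`, and the three are
independent. -/
def sampleLaw {d : ℕ} (M : Model) (ε : ℝ) (p : Fin d → ℝ) : Measure (Sample d) :=
  (envLaw p).prod ((Measure.infinitePi fun _ => jumpLaw M ε).prod
    (Measure.infinitePi fun _ => ProbabilityTheory.expMeasure (1 + ε)))

theorem isProbabilityMeasure_arrowLaw {d : ℕ} {p : Fin d → ℝ} (hp : p ∈ stdSimplex ℝ (Fin d)) :
    IsProbabilityMeasure (arrowLaw p) := by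
  constructor
  have h0 : ∀ a ∈ (Finset.univ : Finset (Dir d)), 0 ≤ p a.1 / 2 :=
    fun a _ => div_nonneg (hp.1 _) (by norm_num)
  have h1 : ∑ a : Dir d, p a.1 / 2 = 1 := by
    rw [Fintype.sum_prod_type]
    simpa [← Finset.mul_sum, ← Finset.sum_div, mul_div_cancel₀] using hp.2
  simp only [arrowLaw, Measure.coe_finsetSum, Finset.sum_apply, Measure.smul_apply, measure_univ,
    smul_eq_mul, mul_one]
  rw [← ENNReal.ofReal_sum_of_nonneg h0, h1, ENNReal.ofReal_one]

theorem isProbabilityMeasure_jumpLaw {d : ℕ} (hd : d ≠ 0) (M : Model) {ε : ℝ} (hε : 0 < ε) :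
    IsProbabilityMeasure (jumpLaw (d := d) M ε) := by
  constructor
  have h0 : ∀ m ∈ (Finset.univ : Finset (Jump d)), 0 ≤ rate M ε m / (1 + ε) := by
    rintro ⟨_ | e, b⟩ _
    · cases M
      · simp only [rate]; split_ifs <;> positivity
      · simp only [rate]; positivity
    · simp only [rate]; positivity
  have h1 : ∑ m : Jump d, rate M ε m / (1 + ε) = 1 := by
    rw [← Finset.sum_div, sum_rate hd, div_self (by positivity)]
  simp only [jumpLaw, Measure.coe_finsetSum, Finset.sum_apply, Measure.smul_apply, measure_univ,
    smul_eq_mul, mul_one]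
  rw [← ENNReal.ofReal_sum_of_nonneg h0, h1, ENNReal.ofReal_one]

theorem isProbabilityMeasure_sampleLaw {d : ℕ} (hd : d ≠ 0) (M : Model) {ε : ℝ} (hε : 0 < ε)
    {p : Fin d → ℝ} (hp : p ∈ stdSimplex ℝ (Fin d)) :
    IsProbabilityMeasure (sampleLaw M ε p) := by
  have := isProbabilityMeasure_arrowLaw hp
  have := isProbabilityMeasure_jumpLaw hd M hε
  have := ProbabilityTheory.isProbabilityMeasure_expMeasure (r := 1 + ε) (by positivity)
  unfold sampleLaw envLaw
  infer_instance

/-! ### The process -/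

/-- The environment seen by the walker after `n` jumps. -/
def chainEnv {d : ℕ} (s : Sample d) : ℕ → Env d
  | 0 => s.1
  | n + 1 => jumpEnv (s.2.1 n) (chainEnv s n)

/-- The position of the walker after `n` jumps. It starts at the origin. -/
def chainPos {d : ℕ} (s : Sample d) : ℕ → Site d
  | 0 => 0
  | n + 1 => chainPos s n + (stepDir (s.2.1 n) (chainEnv s n)).vec

/-- The time of the `n`-th jump, counting from `n = 0`. -/
def jumpTime {d : ℕ} (s : Sample d) (n : ℕ) : ℝ := ∑ k ∈ Finset.range (n + 1), s.2.2 k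

/-- The number of jumps up to time `t` (almost surely finite). -/
def jumpCount {d : ℕ} (s : Sample d) (t : ℝ) : ℕ := {n : ℕ | jumpTime s n ≤ t}.ncard

/-- The environment `η_t` seen by the walker at time `t`: the continuous-time Markov jump process
with generator `generator M ε` and initial law `π_p`. -/
def envAt {d : ℕ} (s : Sample d) (t : ℝ) : Env d := chainEnv s (jumpCount s t)

/-- The position `X_t` of the walker at time `t`. -/
def posAt {d : ℕ} (s : Sample d) (t : ℝ) : Site d := chainPos s (jumpCount s t)

/-- The squared Euclidean norm on `ℤ^d`. -/
def sqNorm {d : ℕ} (x : Site d) : ℝ := ∑ i, (x i : ℝ) ^ 2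

/-- The mean-square displacement `E(t) = 𝔼[|X_t|²]`, as an element of `[0, ∞]`. -/
def meanSq {d : ℕ} (M : Model) (ε : ℝ) (p : Fin d → ℝ) (t : ℝ) : ℝ≥0∞ :=
  ∫⁻ s, ENNReal.ofReal (sqNorm (posAt s t)) ∂(sampleLaw M ε p)

/-- The Laplace transform `Ê(l) = ∫₀^∞ E(t) e^{-lt} dt`, as an element of `[0, ∞]`. -/
def laplaceMeanSq {d : ℕ} (M : Model) (ε : ℝ) (p : Fin d → ℝ) (l : ℝ) : ℝ≥0∞ :=
  ∫⁻ t in Set.Ioi (0 : ℝ), meanSq M ε p t * ENNReal.ofReal (Real.exp (-(l * t)))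

end

end StoredMomentum

/-! Let G be the generator on L²(π_p). Every jump map preserves π_p. Summing the second moments of
the embedded chain with the geometric weights that the independent exponential clock produces gives
Ê(λ) = λ⁻² Σ_i ((1+ε) m_i + 2⟨ψ_i, (λ-G)⁻¹ φ_i⟩), where m_i is the mean square of the i-th
coordinate of a jump, φ_i the local drift and ψ_i the drift of the reversed process
(`exists_laplaceMeanSq_eq`). Both drifts are the hand arrow up to a swap, so only the inner product
has to be estimated.

The symmetric part of λ-G dominates the form λ‖u‖² + ‖u-Qu‖² + Σ_k ‖Qu-τ_k Qu‖², where Q averages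
over a swap (`form_le_inner`). The hand step is a contraction and is discarded. The elliptic part
supplies the rest.

Upper bound. After projection by Q the hand arrow pairs like the arrow at the origin. The function x
↦ ⟨arrow at x, Qu⟩ lives on ℤ². Its gradient energy and ℓ² norm are controlled by the form through
Bessel's inequality, so its square at the origin is at most log(1/λ) times the form, as for the
Green function in dimension two (`sq_apply_zero_le`, `sum_sq_inner_zero_le_log`). Testing the
resolvent equation against its solution u then bounds ⟨ψ, u⟩ by a multiple of L = log(1/λ).

Lower bound. Let all arrows be ±e_i. The resolvent equation is tested against a linear function f =
Σ a(x)·(arrow at x), the hand sharing the coefficient of the origin, which makes f invariant under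
the swap. The left side is a(0). On the right, the adjoint of the hand step maps f to a linear part,
handled by summation by parts, and a quadratic part whose coefficients are centred differences of a
in direction i only. Modulo a swap the quadratic part is a combination of products of the arrows at
0 and y, and the two-dimensional logarithmic bound applies to the whole family at once: it costs a
factor L times the energy of a in direction i (`abs_inner_quad_le`). Take for a a logarithm
stretched by m in direction i, of height h of order L: the energies are of order h/m and mh in the
two directions, so h² ≤ C(Lh/m + mh)·form(u). The choice m ≈ √L gives form(u) ≥ c√L
(`IsPairFamily.le_form`), and ⟨ψ, u⟩ dominates a multiple of the form once the latter is large. -/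

namespace StoredMomentum

/-! ### Logarithmic resistance of a wedge of the lattice. -/

theorem sum_succ_mul_sub_succ (B : ℕ → ℝ) (n : ℕ) :
    ∑ y ∈ Finset.range n, ((y : ℝ) + 1) * (B y - B (y + 1))
      = ∑ y ∈ Finset.range n, B y - n * B n := by
  induction n with
  | zero => simp
  | succ n ih => rw [Finset.sum_range_succ, ih, Finset.sum_range_succ]; push_cast; ring

/-- The mean of `b` over the `r`-th column of the wedge `{(r, y) : y ≤ r}`. -/
noncomputable def colMean (b : ℕ → ℕ → ℝ) (r : ℕ) : ℝ :=
  (∑ y ∈ Finset.range (r + 1), b r y) / (r + 1)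

/-- The energy of `b` on the edges leading from the `r`-th column of the wedge to the next one, and
on the edges within the latter. -/
noncomputable def colEnergy (b : ℕ → ℕ → ℝ) (r : ℕ) : ℝ :=
  ∑ y ∈ Finset.range (r + 1), ((b r y - b (r + 1) y) ^ 2 + (b (r + 1) y - b (r + 1) (y + 1)) ^ 2)

/-- Consecutive columns have `r + 1` and `r + 2` points. The first sum compares them point by point.
The second, from Abel summation, corrects for the extra point by vertical differences with weights
at most `1 / (r + 1)`. -/
theorem colMean_sub_succ (b : ℕ → ℕ → ℝ) (r : ℕ) :
    colMean b r - colMean b (r + 1)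
      = ∑ y ∈ Finset.range (r + 1), (b r y - b (r + 1) y) / (r + 1)
        + ∑ y ∈ Finset.range (r + 1),
          (((y : ℝ) + 1) / (r + 2)) * (b (r + 1) y - b (r + 1) (y + 1)) / (r + 1) := by
  have h := sum_succ_mul_sub_succ (b (r + 1)) (r + 1)
  have e : ∑ y ∈ Finset.range (r + 1),
      (((y : ℝ) + 1) / (r + 2)) * (b (r + 1) y - b (r + 1) (y + 1)) / (r + 1)
      = (∑ y ∈ Finset.range (r + 1), ((y : ℝ) + 1) * (b (r + 1) y - b (r + 1) (y + 1)))
        / ((r + 2) * (r + 1)) := by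
    rw [Finset.sum_div]
    refine Finset.sum_congr rfl fun y _ => ?_
    field_simp
  rw [e, h, ← Finset.sum_div, Finset.sum_sub_distrib, colMean, colMean,
    Finset.sum_range_succ (fun y => b (r + 1) y) (r + 1)]
  push_cast
  have h1 : (r : ℝ) + 1 ≠ 0 := by positivity
  have h2 : (r : ℝ) + 2 ≠ 0 := by positivity
  have h3 : (r : ℝ) + 1 + 1 ≠ 0 := by positivity
  field_simp
  ring

theorem sq_sum_div_le {n : ℕ} (c : ℕ → ℝ) :
    (∑ y ∈ Finset.range (n + 1), c y / (n + 1)) ^ 2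
      ≤ (∑ y ∈ Finset.range (n + 1), c y ^ 2) / (n + 1) := by
  rw [← Finset.sum_div, div_pow]
  have h := sq_sum_le_card_mul_sum_sq (s := Finset.range (n + 1)) (f := c)
  rw [Finset.card_range] at h
  push_cast at h
  rw [div_le_div_iff₀ (by positivity) (by positivity)]
  calc _ ≤ ((n + 1 : ℝ) * ∑ y ∈ Finset.range (n + 1), c y ^ 2) * (n + 1) := by gcongr
    _ = _ := by ring

/-- Averaging over `r + 1` parallel edges gains the factor `1 / (r + 1)`, whose sum over `r` is only
logarithmic. -/
theorem sq_colMean_sub_succ_le (b : ℕ → ℕ → ℝ) (r : ℕ) :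
    (colMean b r - colMean b (r + 1)) ^ 2 ≤ 2 / (r + 1) * colEnergy b r := by
  rw [colMean_sub_succ]
  refine (add_sq_le).trans ?_
  have h1 := sq_sum_div_le (n := r) fun y => b r y - b (r + 1) y
  have h2 := sq_sum_div_le (n := r)
    fun y => (((y : ℝ) + 1) / (r + 2)) * (b (r + 1) y - b (r + 1) (y + 1))
  have h3 : ∑ y ∈ Finset.range (r + 1),
      ((((y : ℝ) + 1) / (r + 2)) * (b (r + 1) y - b (r + 1) (y + 1))) ^ 2
      ≤ ∑ y ∈ Finset.range (r + 1), (b (r + 1) y - b (r + 1) (y + 1)) ^ 2 := by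
    refine Finset.sum_le_sum fun y hy => ?_
    have hy' : (y : ℝ) ≤ r := by exact_mod_cast Nat.lt_succ_iff.1 (Finset.mem_range.1 hy)
    rw [mul_pow]
    refine mul_le_of_le_one_left (sq_nonneg _) (pow_le_one₀ (by positivity) ?_)
    rw [div_le_one (by positivity)]
    linarith
  have h4 := h2.trans (div_le_div_of_nonneg_right h3 (by positivity))
  calc _ ≤ 2 * ((∑ y ∈ Finset.range (r + 1), (b r y - b (r + 1) y) ^ 2) / (r + 1)
        + (∑ y ∈ Finset.range (r + 1), (b (r + 1) y - b (r + 1) (y + 1)) ^ 2) / (r + 1)) := by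
        gcongr
    _ = _ := by rw [colEnergy, Finset.sum_add_distrib]; ring

theorem colEnergy_nonneg (b : ℕ → ℕ → ℝ) (r : ℕ) : 0 ≤ colEnergy b r :=
  Finset.sum_nonneg fun _ _ => by positivity

/-- Cauchy–Schwarz along the columns, which act as resistors `2 / (r + 1)` in series. -/
theorem sq_colMean_zero_sub_le (b : ℕ → ℕ → ℝ) (R : ℕ) :
    (colMean b 0 - colMean b R) ^ 2
      ≤ (∑ r ∈ Finset.range R, 2 / ((r : ℝ) + 1)) * ∑ r ∈ Finset.range R, colEnergy b r := by
  have h : colMean b 0 - colMean b R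
      = ∑ r ∈ Finset.range R, (colMean b r - colMean b (r + 1)) := by
    rw [Finset.sum_range_sub']
  rw [h]
  refine Finset.sum_sq_le_sum_mul_sum_of_sq_le_mul _ (fun _ _ => by positivity)
    (fun _ _ => colEnergy_nonneg _ _) fun r _ => sq_colMean_sub_succ_le b r

/-- A logarithmic bound, in dimension two, of the value at a point in terms of the Dirichlet form
and the `ℓ²` norm. -/
theorem sq_apply_zero_le (b : ℕ → ℕ → ℝ) {N : ℕ} (hN : 0 < N) :
    b 0 0 ^ 2 ≤ 4 * (1 + Real.log (2 * N)) * ∑ r ∈ Finset.range (2 * N), colEnergy b r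
      + 2 / (N : ℝ) ^ 2 * ∑ r ∈ Finset.range (2 * N), ∑ y ∈ Finset.range (r + 1), b r y ^ 2 := by
  set E := ∑ r ∈ Finset.range (2 * N), colEnergy b r with hE
  set F := ∑ r ∈ Finset.range (2 * N), ∑ y ∈ Finset.range (r + 1), b r y ^ 2 with hF
  have hN' : (0 : ℝ) < N := by exact_mod_cast hN
  have hE0 : 0 ≤ E := Finset.sum_nonneg fun _ _ => colEnergy_nonneg _ _
  have hb : colMean b 0 = b 0 0 := by simp [colMean]
  have harm : ∑ r ∈ Finset.range (2 * N), 2 / ((r : ℝ) + 1) ≤ 2 * (1 + Real.log (2 * N)) := by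
    have := harmonic_le_one_add_log (2 * N)
    rw [harmonic] at this
    push_cast at this
    calc _ = 2 * ∑ r ∈ Finset.range (2 * N), ((r : ℝ) + 1)⁻¹ := by
          rw [Finset.mul_sum]; simp only [div_eq_mul_inv]
      _ ≤ _ := by gcongr
  -- Column 0 is the single point `(0, 0)`, so its mean is the value to be bounded. It is compared
  -- with the mean over a column `R` of length at least `N`.
  have hR : ∀ R ∈ Finset.Ico N (2 * N), b 0 0 ^ 2
      ≤ 4 * (1 + Real.log (2 * N)) * E
        + 2 / N * ∑ y ∈ Finset.range (R + 1), b R y ^ 2 := by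
    intro R hR
    rw [Finset.mem_Ico] at hR
    have h1 := sq_colMean_zero_sub_le b R
    have h2 : (∑ r ∈ Finset.range R, 2 / ((r : ℝ) + 1)) * ∑ r ∈ Finset.range R, colEnergy b r
        ≤ 2 * (1 + Real.log (2 * N)) * E := by
      have hs : Finset.range R ⊆ Finset.range (2 * N) := Finset.range_subset_range.2 hR.2.le
      refine mul_le_mul ((Finset.sum_le_sum_of_subset_of_nonneg hs
        fun _ _ _ => by positivity).trans harm)
        (Finset.sum_le_sum_of_subset_of_nonneg hs fun _ _ _ => colEnergy_nonneg _ _)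
        (Finset.sum_nonneg fun _ _ => colEnergy_nonneg _ _) ?_
      exact (Finset.sum_nonneg fun _ _ => by positivity).trans harm
    have h3 : colMean b R ^ 2 ≤ (∑ y ∈ Finset.range (R + 1), b R y ^ 2) / N := by
      have := sq_sum_div_le (n := R) (b R)
      rw [← Finset.sum_div] at this
      refine this.trans ?_
      have : (N : ℝ) ≤ R + 1 := by exact_mod_cast hR.1.trans (Nat.le_succ _)
      gcongr
    rw [← hb]
    calc colMean b 0 ^ 2 = (colMean b 0 - colMean b R + colMean b R) ^ 2 := by ring
      _ ≤ 2 * ((colMean b 0 - colMean b R) ^ 2 + colMean b R ^ 2) := add_sq_le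
      _ ≤ 2 * (2 * (1 + Real.log (2 * N)) * E
          + (∑ y ∈ Finset.range (R + 1), b R y ^ 2) / N) := by
          gcongr; exact h1.trans h2
      _ = _ := by ring
  -- Averaging over the `N` columns `R` in `[N, 2N)` turns the column norms into the full `ℓ²` norm
  -- with the factor `2 / N ^ 2`.
  have hsum := Finset.sum_le_sum hR
  rw [Finset.sum_const, Finset.sum_add_distrib, Finset.sum_const, ← Finset.mul_sum,
    Nat.card_Ico, show 2 * N - N = N by omega, nsmul_eq_mul, nsmul_eq_mul] at hsum
  have hF' : ∑ R ∈ Finset.Ico N (2 * N), ∑ y ∈ Finset.range (R + 1), b R y ^ 2 ≤ F := by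
    refine Finset.sum_le_sum_of_subset_of_nonneg (fun x hx => ?_)
      fun _ _ _ => Finset.sum_nonneg fun _ _ => sq_nonneg _
    exact Finset.mem_range.2 (Finset.mem_Ico.1 hx).2
  have h5 : (N : ℝ) * b 0 0 ^ 2 ≤ N * (4 * (1 + Real.log (2 * N)) * E + 2 / (N : ℝ) ^ 2 * F) := by
    calc _ ≤ _ := hsum
      _ ≤ N * (4 * (1 + Real.log (2 * N)) * E) + 2 / N * F := by gcongr
      _ = _ := by field_simp
  exact le_of_mul_le_mul_left h5 hN'

/-! ### A logarithmic profile -/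

/-- The anisotropic discrete logarithm `∑_{m ≤ k < R, ρ(x, y) ≤ k} 1 / k`, where
`ρ(x, y) = max |x| (m |y|)`. -/
noncomputable def logProfile (m R : ℕ) (x y : ℤ) : ℝ :=
  ∑ k ∈ Finset.Ico m R, if x.natAbs ≤ k ∧ m * y.natAbs ≤ k then (1 : ℝ) / k else 0

/-- The value of the profile at the origin. -/
noncomputable def logHeight (m R : ℕ) : ℝ := ∑ k ∈ Finset.Ico m R, (1 : ℝ) / k

theorem logProfile_zero (m R : ℕ) : logProfile m R 0 0 = logHeight m R := by
  simp [logProfile, logHeight]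

theorem logProfile_neg (m R : ℕ) (x y : ℤ) : logProfile m R (-x) y = logProfile m R x y := by
  simp [logProfile]

theorem logProfile_nonneg (m R : ℕ) (x y : ℤ) : 0 ≤ logProfile m R x y :=
  Finset.sum_nonneg fun _ _ => by positivity

theorem logProfile_le (m R : ℕ) (x y : ℤ) : logProfile m R x y ≤ logHeight m R :=
  Finset.sum_le_sum fun _ _ => by split_ifs <;> first | exact le_rfl | positivity

theorem bounds_of_logProfile_ne_zero {m R : ℕ} {x y : ℤ} (h : logProfile m R x y ≠ 0) :
    x.natAbs < R ∧ m * y.natAbs < R := by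
  obtain ⟨k, hk, hk'⟩ := Finset.exists_ne_zero_of_sum_ne_zero h
  rw [Finset.mem_Ico] at hk
  split_ifs at hk' with hc
  · exact ⟨hc.1.trans_lt hk.2, hc.2.trans_lt hk.2⟩
  · exact absurd rfl hk'

open Classical in
/-- If, for every `k`, at most `c k` of the points are such that the two sublevel predicates differ,
and if, for every point, the two predicates differ for at most `n` values of `k`, then the energy
is at most `n ∑ c k / k²`. -/
theorem sum_sq_sum_sub_le {ι : Type*} (B : Finset ι) (I : Finset ℕ) (p q : ι → ℕ → Prop) (n : ℕ)
    (c : ℕ → ℝ)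
    (hn : ∀ x ∈ B, (I.filter fun k => ¬ (p x k ↔ q x k)).card ≤ n)
    (hc : ∀ k ∈ I, ((B.filter fun x => ¬ (p x k ↔ q x k)).card : ℝ) ≤ c k) :
    ∑ x ∈ B, (∑ k ∈ I, (if p x k then (1 : ℝ) / k else 0)
        - ∑ k ∈ I, (if q x k then (1 : ℝ) / k else 0)) ^ 2
      ≤ n * ∑ k ∈ I, c k * (1 / (k : ℝ) ^ 2) := by
  have h1 : ∀ x ∈ B, (∑ k ∈ I, (if p x k then (1 : ℝ) / k else 0)
        - ∑ k ∈ I, (if q x k then (1 : ℝ) / k else 0)) ^ 2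
      ≤ n * ∑ k ∈ I, if ¬ (p x k ↔ q x k) then 1 / (k : ℝ) ^ 2 else 0 := by
    intro x hx
    rw [← Finset.sum_sub_distrib, ← Finset.sum_filter]
    -- Only the levels at which the two predicates differ contribute. There are at most `n` of them,
    -- which Cauchy–Schwarz turns into the factor `n`.
    have h2 : ∑ k ∈ I, ((if p x k then (1 : ℝ) / k else 0) - (if q x k then (1 : ℝ) / k else 0))
        = ∑ k ∈ I.filter fun k => ¬ (p x k ↔ q x k),
          ((if p x k then (1 : ℝ) / k else 0) - (if q x k then (1 : ℝ) / k else 0)) := by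
      rw [Finset.sum_filter]
      refine Finset.sum_congr rfl fun k _ => ?_
      by_cases hp : p x k <;> by_cases hq : q x k <;> simp [hp, hq]
    rw [h2]
    refine sq_sum_le_card_mul_sum_sq.trans ?_
    refine mul_le_mul (by exact_mod_cast hn x hx) (Finset.sum_le_sum fun k _ => ?_)
      (Finset.sum_nonneg fun _ _ => sq_nonneg _) (by positivity)
    split_ifs <;> simp
  calc _ ≤ ∑ x ∈ B, (n : ℝ) * ∑ k ∈ I, if ¬ (p x k ↔ q x k) then 1 / (k : ℝ) ^ 2 else 0 :=
        Finset.sum_le_sum h1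
    _ = n * ∑ k ∈ I, ((B.filter fun x => ¬ (p x k ↔ q x k)).card : ℝ) * (1 / (k : ℝ) ^ 2) := by
        rw [← Finset.mul_sum, Finset.sum_comm]
        congr 1
        refine Finset.sum_congr rfl fun k _ => ?_
        rw [← Finset.sum_filter, Finset.sum_const, nsmul_eq_mul]
    _ ≤ _ := by
        gcongr with k hk
        exact hc k hk

theorem sum_six_mul_div_sq {m R : ℕ} (hm : 0 < m) (a : ℝ) :
    ∑ k ∈ Finset.Ico m R, a * k * (1 / (k : ℝ) ^ 2) = a * logHeight m R := by
  rw [logHeight, Finset.mul_sum]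
  refine Finset.sum_congr rfl fun k hk => ?_
  have : (k : ℝ) ≠ 0 := by
    have := (Finset.mem_Ico.1 hk).1
    exact_mod_cast (by omega : k ≠ 0)
  field_simp

/-- The `k`-th level set is a rectangle with half-sides `k` and `⌊k / m⌋`. A horizontal step changes
at most one level, and at most `2 (2 ⌊k / m⌋ + 1)` horizontal edges cross the boundary of level `k`.
-/
theorem sum_sq_logProfile_sub_fst_le {m R : ℕ} (hm : 0 < m) (B : Finset (ℤ × ℤ)) :
    ∑ z ∈ B, (logProfile m R (z.1 + 1) z.2 - logProfile m R z.1 z.2) ^ 2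
      ≤ 6 / m * logHeight m R := by
  classical
  have hm' : (0 : ℝ) < m := by exact_mod_cast hm
  rw [← sum_six_mul_div_sq hm]
  have := sum_sq_sum_sub_le B (Finset.Ico m R)
    (fun z k => (z.1 + 1).natAbs ≤ k ∧ m * z.2.natAbs ≤ k)
    (fun z k => z.1.natAbs ≤ k ∧ m * z.2.natAbs ≤ k) 1 (fun k => 6 / m * k) ?_ ?_
  · simpa [logProfile] using this
  · intro z _
    refine Finset.card_le_one.2 fun k hk k' hk' => ?_
    simp only [Finset.mem_filter] at hk hk'
    have h1 := hk.2
    have h2 := hk'.2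
    by_cases c1 : m * z.2.natAbs ≤ k <;> by_cases c2 : m * z.2.natAbs ≤ k' <;>
      simp only [c1, c2, and_true, and_false, not_true, iff_self] at h1 h2
    omega
  · intro k hk
    rw [Finset.mem_Ico] at hk
    have hsub : (B.filter fun z => ¬ (((z.1 + 1).natAbs ≤ k ∧ m * z.2.natAbs ≤ k)
        ↔ (z.1.natAbs ≤ k ∧ m * z.2.natAbs ≤ k)))
        ⊆ ({(k : ℤ), -(k : ℤ) - 1} : Finset ℤ)
          ×ˢ Finset.Icc (-((k / m : ℕ) : ℤ)) ((k / m : ℕ) : ℤ) := by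
      intro z hz
      have h1 := (Finset.mem_filter.1 hz).2
      by_cases c1 : m * z.2.natAbs ≤ k
      · simp only [c1, and_true] at h1
        have : z.2.natAbs ≤ k / m := (Nat.le_div_iff_mul_le hm).2 (by rwa [mul_comm])
        simp only [Finset.mem_product, Finset.mem_insert, Finset.mem_singleton, Finset.mem_Icc]
        omega
      · simp [c1] at h1
    have hcard := Finset.card_le_card hsub
    rw [Finset.card_product, Int.card_Icc] at hcard
    have h2 : ({(k : ℤ), -(k : ℤ) - 1} : Finset ℤ).card ≤ 2 := Finset.card_le_two
    have h3 : (((k / m : ℕ) : ℤ) + 1 - -((k / m : ℕ) : ℤ)).toNat = 2 * (k / m) + 1 := by omega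
    rw [h3] at hcard
    -- Starting the levels at `m` rather than at 1 lets the `+ 1` be absorbed into `⌊k / m⌋`.
    have h4 : 1 ≤ k / m := (Nat.one_le_div_iff hm).2 hk.1
    have h5 : (B.filter fun z => ¬ (((z.1 + 1).natAbs ≤ k ∧ m * z.2.natAbs ≤ k)
        ↔ (z.1.natAbs ≤ k ∧ m * z.2.natAbs ≤ k))).card ≤ 6 * (k / m) := by
      calc _ ≤ _ := hcard
        _ ≤ 2 * (2 * (k / m) + 1) := Nat.mul_le_mul_right _ h2
        _ ≤ _ := by omega
    calc _ ≤ ((6 * (k / m) : ℕ) : ℝ) := by exact_mod_cast h5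
      _ = 6 * ((k / m : ℕ) : ℝ) := by push_cast; rfl
      _ ≤ 6 * ((k : ℝ) / m) := by gcongr; exact Nat.cast_div_le
      _ = _ := by ring

/-- A vertical step changes at most `m` consecutive levels, and at most `2 (2 k + 1) ≤ 6 k` vertical
edges cross the boundary of level `k`. The ratio to the horizontal energy is thus `m ^ 2`. -/
theorem sum_sq_logProfile_sub_snd_le {m R : ℕ} (hm : 0 < m) (B : Finset (ℤ × ℤ)) :
    ∑ z ∈ B, (logProfile m R z.1 (z.2 + 1) - logProfile m R z.1 z.2) ^ 2
      ≤ 6 * m * logHeight m R := by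
  classical
  rw [show 6 * (m : ℝ) * logHeight m R = m * (6 * logHeight m R) by ring, ← sum_six_mul_div_sq hm]
  have := sum_sq_sum_sub_le B (Finset.Ico m R)
    (fun z k => z.1.natAbs ≤ k ∧ m * (z.2 + 1).natAbs ≤ k)
    (fun z k => z.1.natAbs ≤ k ∧ m * z.2.natAbs ≤ k) m (fun k => 6 * k) ?_ ?_
  · simpa [logProfile] using this
  · intro z _
    have hsub : ((Finset.Ico m R).filter fun k => ¬ ((z.1.natAbs ≤ k ∧ m * (z.2 + 1).natAbs ≤ k)
        ↔ (z.1.natAbs ≤ k ∧ m * z.2.natAbs ≤ k)))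
        ⊆ Finset.Ico (m * min (z.2 + 1).natAbs z.2.natAbs)
          (m * min (z.2 + 1).natAbs z.2.natAbs + m) := by
      intro k hk
      have h1 := (Finset.mem_filter.1 hk).2
      rw [Finset.mem_Ico]
      rcases (by omega : (z.2 + 1).natAbs = z.2.natAbs + 1 ∨ z.2.natAbs = (z.2 + 1).natAbs + 1)
        with h | h
      · rw [h] at h1 ⊢
        rw [min_eq_right (by omega)]
        rw [mul_add, mul_one] at h1
        omega
      · rw [h] at h1 ⊢
        rw [min_eq_left (by omega)]
        rw [mul_add, mul_one] at h1
        omega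
    simpa using Finset.card_le_card hsub
  · intro k hk
    rw [Finset.mem_Ico] at hk
    have hsub : (B.filter fun z => ¬ ((z.1.natAbs ≤ k ∧ m * (z.2 + 1).natAbs ≤ k)
        ↔ (z.1.natAbs ≤ k ∧ m * z.2.natAbs ≤ k)))
        ⊆ Finset.Icc (-(k : ℤ)) k ×ˢ ({((k / m : ℕ) : ℤ), -((k / m : ℕ) : ℤ) - 1} : Finset ℤ) := by
      intro z hz
      have h1 := (Finset.mem_filter.1 hz).2
      have e1 : m * (z.2 + 1).natAbs ≤ k ↔ (z.2 + 1).natAbs ≤ k / m := by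
        rw [Nat.le_div_iff_mul_le hm, mul_comm]
      have e2 : m * z.2.natAbs ≤ k ↔ z.2.natAbs ≤ k / m := by
        rw [Nat.le_div_iff_mul_le hm, mul_comm]
      rw [e1, e2] at h1
      simp only [Finset.mem_product, Finset.mem_insert, Finset.mem_singleton, Finset.mem_Icc]
      generalize k / m = t at *
      omega
    have hcard := Finset.card_le_card hsub
    rw [Finset.card_product, Int.card_Icc] at hcard
    have h2 : ({((k / m : ℕ) : ℤ), -((k / m : ℕ) : ℤ) - 1} : Finset ℤ).card ≤ 2 :=
      Finset.card_le_two
    have h3 : ((k : ℤ) + 1 - -(k : ℤ)).toNat = 2 * k + 1 := by omega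
    rw [h3] at hcard
    have h5 : (B.filter fun z => ¬ ((z.1.natAbs ≤ k ∧ m * (z.2 + 1).natAbs ≤ k)
        ↔ (z.1.natAbs ≤ k ∧ m * z.2.natAbs ≤ k))).card ≤ 6 * k := by
      calc _ ≤ _ := hcard
        _ ≤ (2 * k + 1) * 2 := Nat.mul_le_mul_left _ h2
        _ ≤ _ := by omega
    exact_mod_cast h5

/-- The support lies in a rectangle of at most `9 R ⌊R / m⌋` sites, and the profile is largest at
the origin. -/
theorem sum_sq_logProfile_le {m R : ℕ} (hm : 0 < m) (hmR : m ≤ R) (B : Finset (ℤ × ℤ)) :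
    ∑ z ∈ B, logProfile m R z.1 z.2 ^ 2 ≤ 9 * (R : ℝ) ^ 2 / m * logHeight m R ^ 2 := by
  classical
  have hm' : (0 : ℝ) < m := by exact_mod_cast hm
  set A : Finset (ℤ × ℤ) := Finset.Icc (-(R : ℤ)) R ×ˢ
    Finset.Icc (-((R / m : ℕ) : ℤ)) ((R / m : ℕ) : ℤ) with hA
  have h1 : ∑ z ∈ B, logProfile m R z.1 z.2 ^ 2 ≤ ∑ z ∈ A, logProfile m R z.1 z.2 ^ 2 := by
    rw [← Finset.sum_filter_ne_zero B]
    refine Finset.sum_le_sum_of_subset_of_nonneg (fun z hz => ?_) fun _ _ _ => sq_nonneg _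
    replace hz := (Finset.mem_filter.1 hz).2
    have h := bounds_of_logProfile_ne_zero (pow_ne_zero_iff two_ne_zero |>.1 hz)
    have h2 : z.2.natAbs ≤ R / m := (Nat.le_div_iff_mul_le hm).2 (by rw [mul_comm]; exact h.2.le)
    rw [hA, Finset.mem_product, Finset.mem_Icc, Finset.mem_Icc]
    omega
  have hcard : A.card ≤ 9 * (R * (R / m)) := by
    rw [hA, Finset.card_product, Int.card_Icc, Int.card_Icc]
    have h4 : 1 ≤ R / m := (Nat.one_le_div_iff hm).2 hmR
    have e1 : ((R : ℤ) + 1 - -(R : ℤ)).toNat ≤ 3 * R := by omega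
    have e2 : (((R / m : ℕ) : ℤ) + 1 - -((R / m : ℕ) : ℤ)).toNat ≤ 3 * (R / m) := by omega
    calc _ ≤ (3 * R) * (3 * (R / m)) := Nat.mul_le_mul e1 e2
      _ = _ := by ring
  calc _ ≤ _ := h1
    _ ≤ ∑ z ∈ A, logHeight m R ^ 2 := Finset.sum_le_sum fun z _ =>
        pow_le_pow_left₀ (logProfile_nonneg _ _ _ _) (logProfile_le _ _ _ _) 2
    _ = (A.card : ℝ) * logHeight m R ^ 2 := by rw [Finset.sum_const, nsmul_eq_mul]
    _ ≤ ((9 * (R * (R / m)) : ℕ) : ℝ) * logHeight m R ^ 2 := by gcongr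
    _ ≤ (9 * (R * ((R : ℝ) / m))) * logHeight m R ^ 2 := by
        push_cast
        gcongr
        exact Nat.cast_div_le
    _ = _ := by ring

end StoredMomentum

namespace StoredMomentum

/-! ### Bessel families -/

section Bessel

variable {H : Type*} [NormedAddCommGroup H] [InnerProductSpace ℝ H]

/-- The family `v` satisfies Bessel's inequality with constant `K`. -/
def BesselWith {κ : Type*} (v : κ → H) (K : ℝ) : Prop :=
  ∀ (F : Finset κ) (h : H), ∑ p ∈ F, inner ℝ (v p) h ^ 2 ≤ K * ‖h‖ ^ 2

/-- Schur's test. -/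
theorem BesselWith.of_schur {κ : Type*} {v : κ → H} {K : ℝ} (hK : 0 ≤ K)
    (hv : ∀ (F : Finset κ), ∀ i ∈ F, ∑ j ∈ F, |inner ℝ (v i) (v j)| ≤ K) : BesselWith v K := by
  intro F h
  set c : κ → ℝ := fun p => inner ℝ (v p) h
  set w : H := ∑ p ∈ F, c p • v p
  have h1 : ∑ p ∈ F, c p ^ 2 = inner ℝ w h := by
    simp only [w, sum_inner, real_inner_smul_left, c, sq]
  have h2 : ‖w‖ ^ 2 ≤ K * ∑ p ∈ F, c p ^ 2 := by
    rw [← real_inner_self_eq_norm_sq]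
    simp only [w, sum_inner, inner_sum, real_inner_smul_left, real_inner_smul_right]
    calc _ ≤ ∑ i ∈ F, ∑ j ∈ F, (c i ^ 2 / 2 * |inner ℝ (v i) (v j)|
            + c j ^ 2 / 2 * |inner ℝ (v j) (v i)|) := by
          refine Finset.sum_le_sum fun i _ => Finset.sum_le_sum fun j _ => ?_
          rw [real_inner_comm (v i) (v j)]
          calc c i * (c j * inner ℝ (v i) (v j)) ≤ |c i * c j| * |inner ℝ (v i) (v j)| := by
                rw [← mul_assoc, ← abs_mul]; exact le_abs_self _
            _ ≤ ((c i ^ 2 + c j ^ 2) / 2) * |inner ℝ (v i) (v j)| := by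
                gcongr
                rw [abs_mul]
                nlinarith [sq_nonneg (|c i| - |c j|), sq_abs (c i), sq_abs (c j)]
            _ = _ := by ring
      _ = 2 * ∑ i ∈ F, c i ^ 2 / 2 * ∑ j ∈ F, |inner ℝ (v i) (v j)| := by
          simp only [Finset.sum_add_distrib]
          rw [Finset.sum_comm (f := fun i j => c j ^ 2 / 2 * |inner ℝ (v j) (v i)|)]
          simp only [← Finset.mul_sum]
          ring
      _ ≤ 2 * ∑ i ∈ F, c i ^ 2 / 2 * K := by
          gcongr with i hi
          exact hv F i hi
      _ = K * ∑ p ∈ F, c p ^ 2 := by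
          rw [← Finset.sum_mul, ← Finset.sum_div]; ring
  have h0 : 0 ≤ ∑ p ∈ F, c p ^ 2 := Finset.sum_nonneg fun _ _ => sq_nonneg _
  have h3 : (∑ p ∈ F, c p ^ 2) ^ 2 ≤ (∑ p ∈ F, c p ^ 2) * (K * ‖h‖ ^ 2) := by
    calc (∑ p ∈ F, c p ^ 2) ^ 2 = inner ℝ w h ^ 2 := by rw [h1]
      _ ≤ (‖w‖ * ‖h‖) ^ 2 := sq_le_sq.2 (by
          rw [abs_of_nonneg (by positivity : 0 ≤ ‖w‖ * ‖h‖)]; exact abs_real_inner_le_norm _ _)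
      _ = ‖w‖ ^ 2 * ‖h‖ ^ 2 := by ring
      _ ≤ (K * ∑ p ∈ F, c p ^ 2) * ‖h‖ ^ 2 := by gcongr
      _ = _ := by ring
  rcases h0.eq_or_lt with h4 | h4
  · rw [← h4]; positivity
  · rw [sq] at h3
    exact le_of_mul_le_mul_left h3 h4

/-- The dual form of Bessel's inequality: the synthesis map is adjoint to the analysis map and has
the same norm. -/
theorem BesselWith.norm_sq_linearCombination_le {κ : Type*} {v : κ → H} {K : ℝ} (hK : 0 ≤ K)
    (hv : BesselWith v K) (a : κ →₀ ℝ) :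
    ‖Finsupp.linearCombination ℝ v a‖ ^ 2 ≤ K * ∑ x ∈ a.support, a x ^ 2 := by
  set w := Finsupp.linearCombination ℝ v a with hw
  have h1 : ‖w‖ ^ 2 = ∑ x ∈ a.support, a x * inner ℝ (v x) w := by
    rw [← real_inner_self_eq_norm_sq]
    nth_rw 1 [hw]
    simp only [Finsupp.linearCombination_apply, Finsupp.sum, sum_inner, real_inner_smul_left]
  have h2 : (‖w‖ ^ 2) ^ 2 ≤ (∑ x ∈ a.support, a x ^ 2) * (K * ‖w‖ ^ 2) := by
    nth_rw 1 [h1]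
    refine (Finset.sum_mul_sq_le_sq_mul_sq _ _ _).trans ?_
    gcongr
    exact hv _ _
  rcases (sq_nonneg ‖w‖).eq_or_lt with h3 | h3
  · rw [← h3]; positivity
  · nlinarith

theorem BesselWith.comp {κ κ' : Type*} {v : κ → H} {K : ℝ} (hv : BesselWith v K) {g : κ' → κ}
    (hg : Function.Injective g) : BesselWith (v ∘ g) K := by
  intro F h
  have := hv (F.map ⟨g, hg⟩) h
  simpa [Finset.sum_map] using this

end Bessel

/-! ### The logarithmic bound for families indexed by the lattice -/

section Green

variable {H : Type*} [NormedAddCommGroup H] [InnerProductSpace ℝ H]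

/-- The point of the wedge with coordinates `r` and `y`. -/
def wedgePt (z : ℕ × ℕ) : Site 2 := ![(z.1 : ℤ), (z.2 : ℤ)]

theorem wedgePt_injective : Function.Injective wedgePt := by
  rintro ⟨a, b⟩ ⟨c, d⟩ h
  have h0 := congrFun h 0
  have h1 := congrFun h 1
  simp [wedgePt] at h0 h1
  simp [h0, h1]

theorem wedgePt_succ_fst (r y : ℕ) :
    wedgePt (r + 1, y) = wedgePt (r, y) + Dir.vec ((0, true) : Dir 2) := by
  ext k; fin_cases k <;> simp [wedgePt, Dir.vec]

theorem wedgePt_succ_snd (r y : ℕ) :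
    wedgePt (r, y + 1) = wedgePt (r, y) + Dir.vec ((1, true) : Dir 2) := by
  ext k; fin_cases k <;> simp [wedgePt, Dir.vec]

/-- As `τ k` is an isometry moving `S i x` to the neighbouring site, the gradient of `x ↦ ⟨S i x,
v⟩` is a pairing with `v - τ k v`. Bessel's inequality over all `(i, x)` then sums the energies, so
a whole family costs no more than one function. -/
theorem sum_sq_inner_zero_le {ι : Type*} {S : ι → Site 2 → H} {K : ℝ}
    (hS : BesselWith (fun p : ι × Site 2 => S p.1 p.2) K) (τ : Fin 2 → H →ₗᵢ[ℝ] H)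
    (hτ : ∀ k i x, τ k (S i x) = S i (x + Dir.vec (k, true))) (Y : Finset ι) (v : H)
    {N : ℕ} (hN : 0 < N) :
    ∑ i ∈ Y, inner ℝ (S i 0) v ^ 2
      ≤ K * (4 * (1 + Real.log (2 * N)) * ∑ k, ‖v - τ k v‖ ^ 2 + 2 / (N : ℝ) ^ 2 * ‖v‖ ^ 2) := by
  set b : ι → ℕ → ℕ → ℝ := fun i r y => inner ℝ (S i (wedgePt (r, y))) v with hb
  have h0 : ∀ i, b i 0 0 = inner ℝ (S i 0) v := by
    intro i
    have : wedgePt (0, 0) = 0 := by ext k; fin_cases k <;> simp [wedgePt]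
    simp [hb, this]
  have hlog : 0 ≤ Real.log (2 * N) := Real.log_nonneg (by
    have : (1 : ℝ) ≤ N := by exact_mod_cast hN
    linarith)
  have hdiff : ∀ k i x, inner ℝ (S i x) v - inner ℝ (S i (x + Dir.vec (k, true))) v
      = - inner ℝ (S i (x + Dir.vec (k, true))) (v - τ k v) := by
    intro k i x
    rw [inner_sub_right, ← hτ, (τ k).inner_map_map]
    ring
  set W : Finset (ℕ × ℕ) :=
    (Finset.range (2 * N)).sigma (fun r => Finset.range (r + 1)) |>.map
      (Equiv.sigmaEquivProd ℕ ℕ).toEmbedding with hW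
  have hsum : ∀ f : ℕ → ℕ → ℝ,
      ∑ r ∈ Finset.range (2 * N), ∑ y ∈ Finset.range (r + 1), f r y = ∑ z ∈ W, f z.1 z.2 := by
    intro f
    rw [hW, Finset.sum_map, Finset.sum_sigma]
    rfl
  -- The edges of the wedge are labelled by their endpoints; an injective labelling uses each vector
  -- of the family at most once.
  have key : ∀ (g : ℕ × ℕ → ℕ × ℕ), Function.Injective g → ∀ w : H,
      ∑ i ∈ Y, ∑ z ∈ W, inner ℝ (S i (wedgePt (g z))) w ^ 2 ≤ K * ‖w‖ ^ 2 := by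
    intro g hg w
    have hinj : Function.Injective (fun p : ι × (ℕ × ℕ) => (p.1, wedgePt (g p.2))) := by
      rintro ⟨i, z⟩ ⟨i', z'⟩ h
      simp only [Prod.mk.injEq] at h
      rw [h.1, hg (wedgePt_injective h.2)]
    have := hS.comp hinj (Y ×ˢ W) w
    rwa [Finset.sum_product] at this
  have hE : ∑ i ∈ Y, ∑ r ∈ Finset.range (2 * N), colEnergy (b i) r
      ≤ K * ∑ k, ‖v - τ k v‖ ^ 2 := by
    have e1 : ∀ i r y, (b i r y - b i (r + 1) y) ^ 2
        = inner ℝ (S i (wedgePt (r + 1, y))) (v - τ 0 v) ^ 2 := by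
      intro i r y
      simp only [hb]
      rw [wedgePt_succ_fst, hdiff, neg_sq]
    have e2 : ∀ i r y, (b i (r + 1) y - b i (r + 1) (y + 1)) ^ 2
        = inner ℝ (S i (wedgePt (r + 1, y + 1))) (v - τ 1 v) ^ 2 := by
      intro i r y
      simp only [hb]
      rw [wedgePt_succ_snd, hdiff, neg_sq]
    simp only [colEnergy, e1, e2, Finset.sum_add_distrib]
    rw [Fin.sum_univ_two, mul_add]
    refine add_le_add ?_ ?_
    · simp only [hsum fun r y => inner ℝ (S _ (wedgePt (r + 1, y))) (v - τ 0 v) ^ 2]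
      refine key (fun z => (z.1 + 1, z.2)) ?_ _
      rintro ⟨a, b⟩ ⟨c, d⟩ h
      simpa using h
    · simp only [hsum fun r y => inner ℝ (S _ (wedgePt (r + 1, y + 1))) (v - τ 1 v) ^ 2]
      refine key (fun z => (z.1 + 1, z.2 + 1)) ?_ _
      rintro ⟨a, b⟩ ⟨c, d⟩ h
      simpa using h
  have hF : ∑ i ∈ Y, ∑ r ∈ Finset.range (2 * N), ∑ y ∈ Finset.range (r + 1), b i r y ^ 2
      ≤ K * ‖v‖ ^ 2 := by
    simp only [hsum fun r y => b _ r y ^ 2]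
    exact key id Function.injective_id v
  calc ∑ i ∈ Y, inner ℝ (S i 0) v ^ 2 = ∑ i ∈ Y, b i 0 0 ^ 2 := by simp only [h0]
    _ ≤ ∑ i ∈ Y, (4 * (1 + Real.log (2 * N)) * ∑ r ∈ Finset.range (2 * N), colEnergy (b i) r
      + 2 / (N : ℝ) ^ 2
        * ∑ r ∈ Finset.range (2 * N), ∑ y ∈ Finset.range (r + 1), b i r y ^ 2) :=
        Finset.sum_le_sum fun i _ => sq_apply_zero_le (b i) hN
    _ = 4 * (1 + Real.log (2 * N)) * (∑ i ∈ Y, ∑ r ∈ Finset.range (2 * N), colEnergy (b i) r)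
      + 2 / (N : ℝ) ^ 2
        * ∑ i ∈ Y, ∑ r ∈ Finset.range (2 * N), ∑ y ∈ Finset.range (r + 1), b i r y ^ 2 := by
        rw [Finset.sum_add_distrib, Finset.mul_sum, Finset.mul_sum]
    _ ≤ 4 * (1 + Real.log (2 * N)) * (K * ∑ k, ‖v - τ k v‖ ^ 2)
      + 2 / (N : ℝ) ^ 2 * (K * ‖v‖ ^ 2) := by gcongr
    _ = _ := by ring

/-- The wedge is cut at the diffusive scale `N = ⌈l ^ (-1 / 2)⌉`, where the mass term `2 / N ^ 2`
becomes comparable to `l`. -/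
theorem sum_sq_inner_zero_le_log {ι : Type*} {S : ι → Site 2 → H} {K : ℝ} (hK : 0 ≤ K)
    (hS : BesselWith (fun p : ι × Site 2 => S p.1 p.2) K) (τ : Fin 2 → H →ₗᵢ[ℝ] H)
    (hτ : ∀ k i x, τ k (S i x) = S i (x + Dir.vec (k, true))) (Y : Finset ι) (v : H)
    {l : ℝ} (hl : 0 < l) (hl1 : l ≤ 1 / 16) :
    ∑ i ∈ Y, inner ℝ (S i 0) v ^ 2
      ≤ K * (8 * Real.log l⁻¹ * (l * ‖v‖ ^ 2 + ∑ k, ‖v - τ k v‖ ^ 2)) := by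
  set s := (√l)⁻¹ with hs
  have hsl : 0 < √l := Real.sqrt_pos.2 hl
  have hs2 : s ^ 2 = l⁻¹ := by rw [hs, inv_pow, Real.sq_sqrt hl.le]
  have hs0 : 0 < s := inv_pos.2 hsl
  have hl16 : 16 ≤ l⁻¹ := by rw [le_inv_comm₀ (by norm_num) hl]; linarith
  have hs4 : 4 ≤ s := by nlinarith
  have hN : 0 < ⌈s⌉₊ := Nat.ceil_pos.2 hs0
  have hN1 : s ≤ (⌈s⌉₊ : ℝ) := Nat.le_ceil s
  have hN2 : (⌈s⌉₊ : ℝ) < s + 1 := Nat.ceil_lt_add_one hs0.le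
  have hNpos : (0 : ℝ) < (⌈s⌉₊ : ℝ) := by exact_mod_cast hN
  -- `2 N ≤ 2 (s + 1) ≤ s ^ 2` holds because `s ≥ 4`, that is `l ≤ 1 / 16`.
  have hlog : Real.log (2 * (⌈s⌉₊ : ℝ)) ≤ Real.log l⁻¹ :=
    Real.log_le_log (by positivity) (by rw [← hs2]; nlinarith)
  have hL1 : 1 ≤ Real.log l⁻¹ := by
    rw [Real.le_log_iff_exp_le (by positivity)]
    exact (Real.exp_one_lt_d9.le.trans (by norm_num)).trans hl16
  refine (sum_sq_inner_zero_le hS τ hτ Y v hN).trans ?_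
  have h2 : 2 / ((⌈s⌉₊ : ℝ)) ^ 2 ≤ 2 * l := by
    have : l = 1 / s ^ 2 := by rw [hs2]; simp
    rw [this, ← mul_div_assoc, mul_one]
    gcongr
  have hE : 0 ≤ ∑ k, ‖v - τ k v‖ ^ 2 := Finset.sum_nonneg fun _ _ => sq_nonneg _
  have hv := sq_nonneg ‖v‖
  gcongr
  calc _ ≤ 4 * (1 + Real.log l⁻¹) * ∑ k, ‖v - τ k v‖ ^ 2 + 2 * l * ‖v‖ ^ 2 := by gcongr
    _ ≤ 8 * Real.log l⁻¹ * ∑ k, ‖v - τ k v‖ ^ 2 + 8 * Real.log l⁻¹ * l * ‖v‖ ^ 2 := by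
        have e1 : 4 * (1 + Real.log l⁻¹) ≤ 8 * Real.log l⁻¹ := by linarith
        have e2 : 2 * l ≤ 8 * Real.log l⁻¹ * l := by gcongr; linarith
        exact add_le_add (mul_le_mul_of_nonneg_right e1 hE) (mul_le_mul_of_nonneg_right e2 hv)
    _ = _ := by ring

end Green
end StoredMomentum

namespace StoredMomentum

/-! ### The generator on a Hilbert space -/

/-- The action on a Hilbert space of functions of the swap, the shifts and the shift in the
direction of the hand arrow. -/
structure WalkOps (H : Type*) [NormedAddCommGroup H] [InnerProductSpace ℝ H] where
  σ : H →ₗᵢ[ℝ] H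
  τ : Dir 2 → H →ₗᵢ[ℝ] H
  ρ : H →ₗᵢ[ℝ] H
  σ_σ : ∀ h, σ (σ h) = h
  τ_not : ∀ k b h, τ (k, !b) (τ (k, b) h) = h

namespace WalkOps

variable {H : Type*} [NormedAddCommGroup H] [InnerProductSpace ℝ H] (W : WalkOps H)

/-- Averaging over a swap. -/
noncomputable def Q : H →ₗ[ℝ] H := (1 / 2 : ℝ) • (LinearMap.id + W.σ.toLinearMap)

theorem Q_apply (u : H) : W.Q u = (1 / 2 : ℝ) • (u + W.σ u) := rfl

/-- The step of the walk in the direction of the hand arrow, with its swaps. -/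
noncomputable def handStep (M : Model) (u : H) : H :=
  match M with
  | .M1 => W.ρ (W.σ u)
  | .M2 => W.Q (W.ρ (W.Q u))

/-- `l - G`, where `G` is the generator of the environment process. -/
noncomputable def resolventOp (M : Model) (ε l : ℝ) (u : H) : H :=
  l • u + (u - W.handStep M u) + ε • (u - (1 / 4 : ℝ) • ∑ e, W.Q (W.τ e (W.Q u)))

/-- The quadratic form which controls the symmetric part of `l - G`. -/
noncomputable def form (l : ℝ) (u : H) : ℝ :=
  l * ‖u‖ ^ 2 + ‖u - W.Q u‖ ^ 2 + ∑ k, ‖W.Q u - W.τ (k, true) (W.Q u)‖ ^ 2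

/-- The local drift, in terms of the hand arrow `φ`. -/
noncomputable def drift (M : Model) (φ : H) : H :=
  match M with
  | .M1 => φ
  | .M2 => W.Q φ

/-- The local drift of the reversed process, in terms of the hand arrow `φ`. -/
noncomputable def revDrift (M : Model) (φ : H) : H :=
  match M with
  | .M1 => W.σ φ
  | .M2 => W.Q φ

theorem inner_σ_left (u v : H) : inner ℝ (W.σ u) v = inner ℝ u (W.σ v) := by
  rw [← W.σ.inner_map_map (W.σ u) v, W.σ_σ]

/-- Together with `Q_Q` this makes `Q` the orthogonal projection onto the swap-invariant vectors. -/
theorem inner_Q_left (u v : H) : inner ℝ (W.Q u) v = inner ℝ u (W.Q v) := by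
  simp only [Q_apply, real_inner_smul_left, real_inner_smul_right, inner_add_left, inner_add_right,
    inner_σ_left]

theorem σ_Q (u : H) : W.σ (W.Q u) = W.Q u := by
  simp only [Q_apply, map_smul, map_add, W.σ_σ, add_comm]

theorem Q_σ (u : H) : W.Q (W.σ u) = W.Q u := by
  simp only [Q_apply, W.σ_σ, add_comm]

theorem Q_of_σ_eq {u : H} (h : W.σ u = u) : W.Q u = u := by
  rw [Q_apply, h, ← two_smul ℝ, smul_smul]; norm_num

theorem Q_Q (u : H) : W.Q (W.Q u) = W.Q u := W.Q_of_σ_eq (W.σ_Q u)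

theorem inner_sub_Q_Q (u v : H) : inner ℝ (u - W.Q u) (W.Q v) = 0 := by
  rw [← inner_Q_left, map_sub, Q_Q, sub_self, inner_zero_left]

theorem norm_sq_eq (u : H) : ‖u‖ ^ 2 = ‖u - W.Q u‖ ^ 2 + ‖W.Q u‖ ^ 2 := by
  have := norm_add_sq_real (u - W.Q u) (W.Q u)
  rw [inner_sub_Q_Q, sub_add_cancel] at this
  linarith

theorem norm_Q_le (u : H) : ‖W.Q u‖ ≤ ‖u‖ := by
  have := W.norm_sq_eq u
  exact le_of_sq_le_sq (by nlinarith [sq_nonneg ‖u - W.Q u‖]) (norm_nonneg _)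

theorem τ_false_true (k : Fin 2) (h : H) : W.τ (k, false) (W.τ (k, true) h) = h := W.τ_not k true h

theorem τ_true_false (k : Fin 2) (h : H) : W.τ (k, true) (W.τ (k, false) h) = h :=
  W.τ_not k false h

theorem inner_τ_false (k : Fin 2) (u v : H) :
    inner ℝ (W.τ (k, false) u) v = inner ℝ u (W.τ (k, true) v) := by
  rw [← (W.τ (k, true)).inner_map_map, τ_true_false]

/-- Summation by parts. -/
theorem inner_sub_τ (k : Fin 2) (u v : H) :
    inner ℝ (u - W.τ (k, true) u) (v - W.τ (k, true) v)
      = 2 * inner ℝ u v - inner ℝ (W.τ (k, true) u) v - inner ℝ (W.τ (k, false) u) v := by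
  rw [inner_τ_false]
  simp only [inner_sub_left, inner_sub_right, LinearIsometry.inner_map_map]
  ring

/-- Both orientations of every direction occur, so the shifts give a symmetric Dirichlet form on the
range of `Q`. The swaps give the part orthogonal to that range. -/
theorem inner_sub_sum_Q_τ_Q (u v : H) :
    inner ℝ (u - (1 / 4 : ℝ) • ∑ e, W.Q (W.τ e (W.Q u))) v
      = inner ℝ u v - inner ℝ (W.Q u) (W.Q v) + 1 / 4 * ∑ k, inner ℝ
        (W.Q u - W.τ (k, true) (W.Q u)) (W.Q v - W.τ (k, true) (W.Q v)) := by
  simp only [inner_sub_τ, inner_sub_left (𝕜 := ℝ) u, real_inner_smul_left, inner_add_left,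
    inner_Q_left, Fintype.sum_prod_type, Fintype.sum_bool, Fin.sum_univ_two]
  rw [Q_Q]
  ring

theorem norm_handStep_le (M : Model) (u : H) : ‖W.handStep M u‖ ≤ ‖u‖ := by
  cases M
  · simp [handStep]
  · exact (W.norm_Q_le _).trans ((W.ρ.norm_map _).le.trans (W.norm_Q_le _))

theorem form_nonneg {l : ℝ} (hl : 0 ≤ l) (u : H) : 0 ≤ W.form l u := by
  unfold form; positivity

theorem norm_sub_Q_sq_le {l : ℝ} (hl : 0 ≤ l) (u : H) : ‖u - W.Q u‖ ^ 2 ≤ W.form l u := by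
  have : 0 ≤ ∑ k, ‖W.Q u - W.τ (k, true) (W.Q u)‖ ^ 2 := Finset.sum_nonneg fun _ _ => sq_nonneg _
  have : 0 ≤ l * ‖u‖ ^ 2 := by positivity
  unfold form; linarith

theorem norm_Q_sub_τ_sq_le {l : ℝ} (hl : 0 ≤ l) (u : H) (k : Fin 2) :
    ‖W.Q u - W.τ (k, true) (W.Q u)‖ ^ 2 ≤ W.form l u := by
  have : ‖W.Q u - W.τ (k, true) (W.Q u)‖ ^ 2 ≤ ∑ k, ‖W.Q u - W.τ (k, true) (W.Q u)‖ ^ 2 :=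
    Finset.single_le_sum (f := fun k => ‖W.Q u - W.τ (k, true) (W.Q u)‖ ^ 2)
      (fun _ _ => sq_nonneg _) (Finset.mem_univ k)
  have : 0 ≤ l * ‖u‖ ^ 2 := by positivity
  unfold form; nlinarith [sq_nonneg ‖u - W.Q u‖]

theorem mul_norm_sq_le {l : ℝ} (u : H) : l * ‖u‖ ^ 2 ≤ W.form l u := by
  have : 0 ≤ ∑ k, ‖W.Q u - W.τ (k, true) (W.Q u)‖ ^ 2 := Finset.sum_nonneg fun _ _ => sq_nonneg _
  unfold form; nlinarith [sq_nonneg ‖u - W.Q u‖]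

/-- The resolvent operator dominates the form. -/
theorem form_le_inner {ε l : ℝ} (hε : 0 < ε) (hl : 0 < l) (M : Model) (u : H) :
    min 1 (ε / 4) * W.form l u ≤ inner ℝ (W.resolventOp M ε l u) u := by
  -- The hand step is not symmetric, but as a contraction it contributes nonnegatively and can be
  -- dropped.
  have h1 : 0 ≤ inner ℝ (u - W.handStep M u) u := by
    rw [inner_sub_left, real_inner_self_eq_norm_sq]
    have := real_inner_le_norm (W.handStep M u) u
    nlinarith [W.norm_handStep_le M u, norm_nonneg u]
  have hs : 0 ≤ ∑ k, ‖W.Q u - W.τ (k, true) (W.Q u)‖ ^ 2 :=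
    Finset.sum_nonneg fun _ _ => sq_nonneg _
  have hm1 : min 1 (ε / 4) ≤ 1 := min_le_left _ _
  have hm2 : min 1 (ε / 4) ≤ ε / 4 := min_le_right _ _
  have hq := sq_nonneg ‖u - W.Q u‖
  have hu : 0 ≤ l * ‖u‖ ^ 2 := by positivity
  rw [resolventOp, inner_add_left, inner_add_left, real_inner_smul_left, real_inner_smul_left,
    inner_sub_sum_Q_τ_Q, real_inner_self_eq_norm_sq, real_inner_self_eq_norm_sq, form]
  simp only [real_inner_self_eq_norm_sq]
  have h2 := W.norm_sq_eq u
  -- The three terms of the form appear with the coefficients `1`, `ε` and `ε / 4`; `min 1 (ε / 4)`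
  -- is the smallest.
  calc _ = min 1 (ε / 4) * (l * ‖u‖ ^ 2) + min 1 (ε / 4) * ‖u - W.Q u‖ ^ 2
        + min 1 (ε / 4) * ∑ k, ‖W.Q u - W.τ (k, true) (W.Q u)‖ ^ 2 := by ring
    _ ≤ 1 * (l * ‖u‖ ^ 2) + ε * ‖u - W.Q u‖ ^ 2
        + ε / 4 * ∑ k, ‖W.Q u - W.τ (k, true) (W.Q u)‖ ^ 2 := by
        have h3 : min 1 (ε / 4) ≤ ε := by linarith
        gcongr
    _ = l * ‖u‖ ^ 2 + 0 + ε * (‖u‖ ^ 2 - ‖W.Q u‖ ^ 2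
        + 1 / 4 * ∑ k, ‖W.Q u - W.τ (k, true) (W.Q u)‖ ^ 2) := by rw [h2]; ring
    _ ≤ _ := by gcongr

/-! ### The upper bound -/

/-- The family of the arrows at the hand and at the sites, in the Hilbert space. -/
structure IsArrowFamily (S : Option (Site 2) → H) : Prop where
  bessel : BesselWith S 1
  σ_none : W.σ (S none) = S (some 0)
  τ_some : ∀ k x, W.τ (k, true) (S (some x)) = S (some (x + Dir.vec (k, true)))

variable {W} {S : Option (Site 2) → H}

theorem IsArrowFamily.norm_le_one (hS : W.IsArrowFamily S) (x : Option (Site 2)) : ‖S x‖ ≤ 1 := by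
  have := hS.bessel {x} (S x)
  rw [Finset.sum_singleton, real_inner_self_eq_norm_sq] at this
  by_contra h
  push Not at h
  have h2 : 1 < ‖S x‖ ^ 2 := one_lt_pow₀ h two_ne_zero
  nlinarith

/-- The arrow at the origin is bounded, up to a logarithm, with respect to the form. -/
theorem IsArrowFamily.inner_zero_sq_le (hS : W.IsArrowFamily S) {l : ℝ} (hl : 0 < l)
    (hl1 : l ≤ 1 / 16) (u : H) :
    inner ℝ (S (some 0)) (W.Q u) ^ 2 ≤ 8 * Real.log l⁻¹ * W.form l u := by
  -- A single orbit of translations: the index set of the family is reduced to a point.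
  have hB : BesselWith (fun p : Unit × Site 2 => S (some p.2)) 1 :=
    hS.bessel.comp (g := fun p : Unit × Site 2 => some p.2) (by
      rintro ⟨⟨⟩, a⟩ ⟨⟨⟩, b⟩ h
      simpa using h)
  have := sum_sq_inner_zero_le_log (S := fun (_ : Unit) x => S (some x)) zero_le_one hB
    (fun k => W.τ (k, true)) (fun k _ x => hS.τ_some k x) {()} (W.Q u) hl hl1
  rw [Finset.sum_singleton, one_mul] at this
  refine this.trans ?_
  have hL : 0 ≤ Real.log l⁻¹ := Real.log_nonneg (by rw [one_le_inv₀ hl]; linarith)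
  gcongr
  unfold form
  have h1 : l * ‖W.Q u‖ ^ 2 ≤ l * ‖u‖ ^ 2 := by gcongr; exact W.norm_Q_le u
  nlinarith [sq_nonneg ‖u - W.Q u‖]

theorem inner_sub_σ (φ u : H) : inner ℝ (φ - W.σ φ) u = 2 * inner ℝ φ (u - W.Q u) := by
  rw [inner_sub_left, inner_σ_left, Q_apply, inner_sub_right, real_inner_smul_right,
    inner_add_right]
  ring

/-- The drifts of the two models, and of the reversed processes, differ little from each other
with respect to the form. -/
theorem abs_inner_sub_Q_le {φ : H} (hφ : ‖φ‖ ≤ 1) {l : ℝ} (hl : 0 ≤ l) (u : H) :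
    |inner ℝ φ (u - W.Q u)| ≤ √(W.form l u) := by
  refine (abs_real_inner_le_norm _ _).trans ?_
  refine (mul_le_of_le_one_left (norm_nonneg _) hφ).trans ?_
  exact Real.le_sqrt_of_sq_le (W.norm_sub_Q_sq_le hl u)

/-- A swap exchanges the hand and the origin, so against `W.Q u` both arrows pair as the arrow at
the origin, which is bounded logarithmically. The remainder `u - W.Q u` costs one further square
root of the form. -/
theorem IsArrowFamily.abs_inner_drift_le (hS : W.IsArrowFamily S) {l : ℝ} (hl : 0 < l)
    (hl1 : l ≤ 1 / 16) (M : Model) (u : H) :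
    |inner ℝ (W.drift M (S none)) u| ≤ 4 * √(Real.log l⁻¹) * √(W.form l u)
      ∧ |inner ℝ (W.revDrift M (S none)) u| ≤ 4 * √(Real.log l⁻¹) * √(W.form l u) := by
  have hL1 : 1 ≤ Real.log l⁻¹ := by
    rw [Real.le_log_iff_exp_le (by positivity), le_inv_comm₀ (Real.exp_pos _) hl]
    refine hl1.trans ?_
    rw [one_div]
    exact inv_anti₀ (Real.exp_pos _) (Real.exp_one_lt_d9.le.trans (by norm_num))
  have hs1 : 1 ≤ √(Real.log l⁻¹) := Real.one_le_sqrt.2 hL1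
  have hf := Real.sqrt_nonneg (W.form l u)
  -- The constant 3 bounds `√8`; the remainder raises it to 4.
  have h0 : |inner ℝ (S (some 0)) (W.Q u)| ≤ 3 * √(Real.log l⁻¹) * √(W.form l u) := by
    refine Real.abs_le_sqrt (hS.inner_zero_sq_le hl hl1 u) |>.trans ?_
    rw [Real.sqrt_mul (by positivity), Real.sqrt_mul (by norm_num)]
    gcongr
    rw [Real.sqrt_le_left (by norm_num)]
    norm_num
  have hQ : inner ℝ (W.Q (S none)) u = inner ℝ (S (some 0)) (W.Q u) := by
    rw [← hS.σ_none, inner_σ_left, σ_Q, inner_Q_left]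
  have hQ' : ∀ x, inner ℝ (S x) u = inner ℝ (S x) (W.Q u) + inner ℝ (S x) (u - W.Q u) := by
    intro x; rw [← inner_add_right, add_sub_cancel]
  have hN : inner ℝ (S none) (W.Q u) = inner ℝ (S (some 0)) (W.Q u) := by
    rw [← hS.σ_none, inner_σ_left, σ_Q]
  have hmul : √(W.form l u) ≤ √(Real.log l⁻¹) * √(W.form l u) := le_mul_of_one_le_left hf hs1
  have key : ∀ x, inner ℝ (S x) (W.Q u) = inner ℝ (S (some 0)) (W.Q u) →
      |inner ℝ (S x) u| ≤ 4 * √(Real.log l⁻¹) * √(W.form l u) := by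
    intro x hx
    rw [hQ', hx]
    refine (abs_add_le _ _).trans ?_
    have := abs_inner_sub_Q_le (W := W) (hS.norm_le_one x) hl.le u
    nlinarith
  have hQb : |inner ℝ (W.Q (S none)) u| ≤ 4 * √(Real.log l⁻¹) * √(W.form l u) := by
    rw [hQ]; nlinarith
  cases M
  · refine ⟨key _ hN, ?_⟩
    simp only [revDrift]
    rw [hS.σ_none]
    exact key _ rfl
  · exact ⟨hQb, hQb⟩

/-- The logarithmic upper bound for the resolvent. -/
theorem IsArrowFamily.inner_revDrift_le (hS : W.IsArrowFamily S) {ε l : ℝ} (hε : 0 < ε)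
    (hl : 0 < l) (hl1 : l ≤ 1 / 16) (M : Model) {u : H}
    (hu : W.resolventOp M ε l u = W.drift M (S none)) :
    inner ℝ (W.revDrift M (S none)) u ≤ 16 / min 1 (ε / 4) * Real.log l⁻¹ := by
  have hc : 0 < min 1 (ε / 4) := lt_min one_pos (by positivity)
  have h1 := W.form_le_inner hε hl M u
  obtain ⟨h2, h3⟩ := hS.abs_inner_drift_le hl hl1 M u
  rw [hu] at h1
  -- Testing the equation against `u` gives `c N² ≤ 4 √L N`, hence a bound for `N`. The bound for
  -- the reversed drift then brings in a second factor `√L`.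
  have h4 := h1.trans ((le_abs_self _).trans h2)
  have hL : 0 ≤ Real.log l⁻¹ := Real.log_nonneg (by rw [one_le_inv₀ hl]; linarith)
  set N := √(W.form l u) with hN
  have hN2 : W.form l u = N ^ 2 := (Real.sq_sqrt (W.form_nonneg hl.le u)).symm
  have hN0 : 0 ≤ N := Real.sqrt_nonneg _
  rw [hN2] at h4
  have h5 : N ≤ 4 * √(Real.log l⁻¹) / min 1 (ε / 4) := by
    rw [le_div_iff₀ hc]
    rcases hN0.eq_or_lt with h | h
    · rw [← h]; simp
    · nlinarith
  calc _ ≤ 4 * √(Real.log l⁻¹) * N := (le_abs_self _).trans h3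
    _ ≤ 4 * √(Real.log l⁻¹) * (4 * √(Real.log l⁻¹) / min 1 (ε / 4)) := by gcongr
    _ = 16 / min 1 (ε / 4) * (√(Real.log l⁻¹) ^ 2) := by ring
    _ = _ := by rw [Real.sq_sqrt hL]

end WalkOps
end StoredMomentum

/-! ### Linear test vectors and the adjoint of the hand step. -/

namespace StoredMomentum
namespace WalkOps

variable {H : Type*} [NormedAddCommGroup H] [InnerProductSpace ℝ H] {W : WalkOps H}
  {S : Option (Site 2) → H}

/-- The products of the arrow in the hand with the arrow at a site, and of the arrows at two
sites `x` and `x + y`, when all the arrows point in the direction `±e_i`. -/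
structure IsPairFamily (W : WalkOps H) (S : Option (Site 2) → H) (i : Fin 2) (ρ' : H →ₗ[ℝ] H)
    (P : Site 2 → H) (P₂ : Site 2 → Site 2 → H) : Prop where
  inner_none_none : inner ℝ (S none) (S none) = 1
  inner_none_some : ∀ x, inner ℝ (S none) (S (some x)) = 0
  σ_some : ∀ x, x ≠ 0 → W.σ (S (some x)) = S (some x)
  τ_none : ∀ k, W.τ (k, true) (S none) = S none
  adjoint : ∀ u v, inner ℝ (W.ρ u) v = inner ℝ u (ρ' v)
  ρ'_none : ρ' (S none) = S none
  ρ'_some : ∀ x, ρ' (S (some x))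
    = (1 / 2 : ℝ) • (S (some (x + Dir.vec (i, true))) + S (some (x - Dir.vec (i, true))))
      + (1 / 2 : ℝ) • (P (x - Dir.vec (i, true)) - P (x + Dir.vec (i, true)))
  P_bessel : BesselWith P 1
  σ_P : ∀ y, y ≠ 0 → W.σ (P y) = P₂ y 0
  P₂_bessel : BesselWith (fun p : {y : Site 2 // y ≠ 0} × Site 2 => P₂ p.1 p.2) 2
  τ_P₂ : ∀ k y x, W.τ (k, true) (P₂ y x) = P₂ y (x + Dir.vec (k, true))

/-- The translate of a finitely supported function. -/
noncomputable def translate (e : Site 2) (a : Site 2 →₀ ℝ) : Site 2 →₀ ℝ :=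
  a.equivMapDomain (Equiv.addRight e)

theorem translate_apply (e : Site 2) (a : Site 2 →₀ ℝ) (x : Site 2) :
    translate e a x = a (x - e) := by
  simp [translate, sub_eq_add_neg]

theorem linearCombination_translate (V : Site 2 → H) (e : Site 2) (a : Site 2 →₀ ℝ) :
    Finsupp.linearCombination ℝ V (translate e a)
      = Finsupp.linearCombination ℝ (fun x => V (x + e)) a := by
  rw [translate, Finsupp.linearCombination_equivMapDomain]
  rfl

/-- The linear function of the environment with coefficients `a`, where the hand and the origin
carry the same coefficient. -/
noncomputable def testVec (S : Option (Site 2) → H) (a : Site 2 →₀ ℝ) : H :=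
  a 0 • S none + Finsupp.linearCombination ℝ (fun x => S (some x)) a

variable {i : Fin 2} {ρ' : H →ₗ[ℝ] H} {P : Site 2 → H} {P₂ : Site 2 → Site 2 → H}

theorem τ_linearCombination (hS : W.IsArrowFamily S) (k : Fin 2) (a : Site 2 →₀ ℝ) :
    W.τ (k, true) (Finsupp.linearCombination ℝ (fun x => S (some x)) a)
      = Finsupp.linearCombination ℝ (fun x => S (some x)) (translate (Dir.vec (k, true)) a) := by
  rw [linearCombination_translate]
  simp only [Finsupp.linearCombination_apply, Finsupp.sum, map_sum, map_smul, hS.τ_some]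

theorem τ_false_linearCombination (hS : W.IsArrowFamily S) (k : Fin 2) (a : Site 2 →₀ ℝ) :
    W.τ (k, false) (Finsupp.linearCombination ℝ (fun x => S (some x)) a)
      = Finsupp.linearCombination ℝ (fun x => S (some (x - Dir.vec (k, true)))) a := by
  have : ∀ x, W.τ (k, false) (S (some x)) = S (some (x - Dir.vec (k, true))) := fun x => by
    conv_lhs => rw [← sub_add_cancel x (Dir.vec (k, true)), ← hS.τ_some, τ_false_true]
  simp only [Finsupp.linearCombination_apply, Finsupp.sum, map_sum, map_smul, this]

theorem norm_linearCombination_le (hS : W.IsArrowFamily S) {c : Site 2 →₀ ℝ} {A : ℝ}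
    (hc : ∀ B : Finset (Site 2), ∑ x ∈ B, c x ^ 2 ≤ A) :
    ‖Finsupp.linearCombination ℝ (fun x => S (some x)) c‖ ≤ √A := by
  refine Real.le_sqrt_of_sq_le ?_
  have := (hS.bessel.comp (Option.some_injective _)).norm_sq_linearCombination_le zero_le_one c
  rw [one_mul] at this
  exact this.trans (hc _)

/-- Shifts leave the hand arrow fixed, so its term cancels and only the discrete gradient of `a`
remains. -/
theorem IsPairFamily.testVec_sub_τ (hS : W.IsArrowFamily S) (hP : W.IsPairFamily S i ρ' P P₂)
    (a : Site 2 →₀ ℝ) (k : Fin 2) :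
    testVec S a - W.τ (k, true) (testVec S a) = Finsupp.linearCombination ℝ (fun x => S (some x))
      (a - translate (Dir.vec (k, true)) a) := by
  rw [testVec, map_add, map_smul, hP.τ_none, τ_linearCombination hS, map_sub]
  abel

theorem IsPairFamily.norm_testVec_sub_τ_le (hS : W.IsArrowFamily S)
    (hP : W.IsPairFamily S i ρ' P P₂) {a : Site 2 →₀ ℝ} {k : Fin 2} {E : ℝ}
    (hE : ∀ B : Finset (Site 2), ∑ x ∈ B, (a x - a (x - Dir.vec (k, true))) ^ 2 ≤ E) :
    ‖testVec S a - W.τ (k, true) (testVec S a)‖ ≤ √E := by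
  rw [hP.testVec_sub_τ hS]
  refine norm_linearCombination_le hS fun B => ?_
  simpa [translate_apply] using hE B

/-- A swap only exchanges the arrows at the hand and at the origin, and these carry the same
coefficient. -/
theorem IsPairFamily.σ_testVec (hS : W.IsArrowFamily S) (hP : W.IsPairFamily S i ρ' P P₂)
    (a : Site 2 →₀ ℝ) : W.σ (testVec S a) = testVec S a := by
  have h : W.σ (Finsupp.linearCombination ℝ (fun x => S (some x)) a)
      - Finsupp.linearCombination ℝ (fun x => S (some x)) a = a 0 • (S none - S (some 0)) := by
    simp only [Finsupp.linearCombination_apply, Finsupp.sum, map_sum, map_smul]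
    rw [← Finset.sum_sub_distrib]
    simp only [← smul_sub]
    rw [Finset.sum_eq_single (0 : Site 2)]
    · rw [← hS.σ_none, W.σ_σ]
    · intro x _ hx
      rw [hP.σ_some x hx, sub_self, smul_zero]
    · intro hx
      rw [Finsupp.notMem_support_iff.1 hx, zero_smul]
  rw [testVec, map_add, map_smul, hS.σ_none, eq_add_of_sub_eq h, smul_sub]
  abel

theorem IsPairFamily.inner_none_testVec (hP : W.IsPairFamily S i ρ' P P₂)
    (a : Site 2 →₀ ℝ) : inner ℝ (S none) (testVec S a) = a 0 := by
  rw [testVec, inner_add_right, real_inner_smul_right, hP.inner_none_none,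
    Finsupp.linearCombination_apply, Finsupp.sum, inner_sum]
  simp [real_inner_smul_right, hP.inner_none_some]

theorem norm_testVec_le (hS : W.IsArrowFamily S) {a : Site 2 →₀ ℝ} {A : ℝ}
    (hA : ∀ B : Finset (Site 2), ∑ x ∈ B, a x ^ 2 ≤ A) : ‖testVec S a‖ ≤ 2 * √A := by
  have h1 := norm_linearCombination_le hS hA
  have h2 : |a 0| ≤ √A := Real.abs_le_sqrt (by simpa using hA {0})
  refine (norm_add_le _ _).trans ?_
  rw [norm_smul, Real.norm_eq_abs]
  have := hS.norm_le_one none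
  nlinarith [abs_nonneg (a 0)]

/-- The coefficients of the quadratic part of the adjoint of the hand step. -/
noncomputable def quadCoeff (i : Fin 2) (a : Site 2 →₀ ℝ) : Site 2 →₀ ℝ :=
  (1 / 2 : ℝ) • (translate (-Dir.vec (i, true)) a - translate (Dir.vec (i, true)) a)

theorem quadCoeff_apply (i : Fin 2) (a : Site 2 →₀ ℝ) (x : Site 2) :
    quadCoeff i a x = 1 / 2 * (a (x + Dir.vec (i, true)) - a (x - Dir.vec (i, true))) := by
  simp [quadCoeff, translate_apply]

/-- The part of `ρ'` even in the hand arrow averages the two shifts along `i`, giving half a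
one-dimensional Laplacian. The odd part is the hand arrow times a centred difference, which is the
quadratic term. -/
theorem IsPairFamily.testVec_sub_ρ' (hS : W.IsArrowFamily S) (hP : W.IsPairFamily S i ρ' P P₂)
    (a : Site 2 →₀ ℝ) :
    testVec S a - ρ' (testVec S a)
      = (1 / 2 : ℝ) • (testVec S a - W.τ (i, true) (testVec S a))
        + (1 / 2 : ℝ) • (testVec S a - W.τ (i, false) (testVec S a))
        - Finsupp.linearCombination ℝ P (quadCoeff i a) := by
  set e : Site 2 := Dir.vec (i, true) with he
  have hτn : W.τ (i, false) (S none) = S none := by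
    conv_lhs => rw [← hP.τ_none i, τ_false_true]
  have h1 : ρ' (Finsupp.linearCombination ℝ (fun x => S (some x)) a)
      = (1 / 2 : ℝ) • (Finsupp.linearCombination ℝ (fun x => S (some (x + e))) a
          + Finsupp.linearCombination ℝ (fun x => S (some (x - e))) a)
        + (1 / 2 : ℝ) • (Finsupp.linearCombination ℝ (fun x => P (x - e)) a
          - Finsupp.linearCombination ℝ (fun x => P (x + e)) a) := by
    simp only [Finsupp.linearCombination_apply, Finsupp.sum, map_sum, map_smul, hP.ρ'_some,
      ← Finset.sum_add_distrib, ← Finset.sum_sub_distrib, Finset.smul_sum]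
    refine Finset.sum_congr rfl fun x _ => ?_
    module
  have h2 : Finsupp.linearCombination ℝ P (quadCoeff i a)
      = (1 / 2 : ℝ) • (Finsupp.linearCombination ℝ (fun x => P (x - e)) a
          - Finsupp.linearCombination ℝ (fun x => P (x + e)) a) := by
    rw [quadCoeff, map_smul, map_sub, linearCombination_translate, linearCombination_translate]
    rfl
  rw [h2, testVec]
  simp only [map_add, map_smul, hP.ρ'_none, hP.τ_none, hτn, h1, τ_false_linearCombination hS,
    τ_linearCombination hS, linearCombination_translate]
  module

/-- A centred difference is the mean of the forward and the backward difference. -/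
theorem sum_sq_quadCoeff_le {a : Site 2 →₀ ℝ} {E : ℝ}
    (hE : ∀ B : Finset (Site 2), ∑ x ∈ B, (a x - a (x - Dir.vec (i, true))) ^ 2 ≤ E)
    (B : Finset (Site 2)) : ∑ x ∈ B, quadCoeff i a x ^ 2 ≤ E := by
  set e : Site 2 := Dir.vec (i, true) with he
  have h1 := hE (B.map (Equiv.addRight e).toEmbedding)
  rw [Finset.sum_map] at h1
  simp only [Equiv.coe_toEmbedding, Equiv.coe_addRight, add_sub_cancel_right] at h1
  calc ∑ x ∈ B, quadCoeff i a x ^ 2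
      ≤ ∑ x ∈ B, (1 / 2 * (a (x + e) - a x) ^ 2 + 1 / 2 * (a x - a (x - e)) ^ 2) := by
        refine Finset.sum_le_sum fun x _ => ?_
        rw [quadCoeff_apply]
        nlinarith [sq_nonneg ((a (x + e) - a x) - (a x - a (x - e)))]
    _ = 1 / 2 * ∑ x ∈ B, (a (x + e) - a x) ^ 2 + 1 / 2 * ∑ x ∈ B, (a x - a (x - e)) ^ 2 := by
        rw [Finset.sum_add_distrib, Finset.mul_sum, Finset.mul_sum]
    _ ≤ 1 / 2 * E + 1 / 2 * E := by gcongr; exact hE B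
    _ = E := by ring

/-- The quadratic part of the adjoint of the hand step is bounded, up to a logarithm, with respect
to the form. -/
theorem IsPairFamily.abs_inner_quad_le (hP : W.IsPairFamily S i ρ' P P₂) {a : Site 2 →₀ ℝ} {E : ℝ}
    (ha : a (Dir.vec (i, true)) = a (-Dir.vec (i, true)))
    (hE : ∀ B : Finset (Site 2), ∑ x ∈ B, (a x - a (x - Dir.vec (i, true))) ^ 2 ≤ E)
    {l : ℝ} (hl : 0 < l) (hl1 : l ≤ 1 / 16) (u : H) :
    |inner ℝ (W.Q u) (Finsupp.linearCombination ℝ P (quadCoeff i a))|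
      ≤ 4 * √(Real.log l⁻¹) * √E * √(W.form l u) := by
  have hL : 0 ≤ Real.log l⁻¹ := Real.log_nonneg (by rw [one_le_inv₀ hl]; linarith)
  have hE0 : 0 ≤ E := by simpa using hE ∅
  set b := quadCoeff i a with hb
  -- The symmetry of `a` removes the coefficient at the origin, where `σ_P` does not apply.
  have h0 : ∀ y ∈ b.support, y ≠ 0 := by
    rintro y hy rfl
    rw [Finsupp.mem_support_iff, hb, quadCoeff_apply] at hy
    simp [ha] at hy
  -- Since `W.Q u` is swap-invariant, the hand arrow may be replaced by the arrow at the origin. The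
  -- resulting products `P₂ y 0` belong to families stable under translation.
  have h1 : inner ℝ (W.Q u) (Finsupp.linearCombination ℝ P b)
      = ∑ y ∈ b.support, b y * inner ℝ (P₂ y 0) (W.Q u) := by
    rw [Finsupp.linearCombination_apply, Finsupp.sum, inner_sum]
    refine Finset.sum_congr rfl fun y hy => ?_
    rw [real_inner_smul_right, ← hP.σ_P y (h0 y hy), inner_σ_left, σ_Q, real_inner_comm]
  -- One application of the logarithmic bound treats all `y` together; `16 = 2 * 8` with 2 the
  -- Bessel constant of `P₂`.
  have h2 : ∑ y ∈ b.support, inner ℝ (P₂ y 0) (W.Q u) ^ 2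
      ≤ 16 * Real.log l⁻¹ * W.form l u := by
    have := sum_sq_inner_zero_le_log (S := fun (y : {y : Site 2 // y ≠ 0}) x => P₂ y x)
      zero_le_two hP.P₂_bessel (fun k => W.τ (k, true)) (fun k y x => hP.τ_P₂ k y x)
      (b.support.subtype (fun y => y ≠ 0)) (W.Q u) hl hl1
    rw [Finset.sum_subtype_of_mem (fun y => inner ℝ (P₂ y 0) (W.Q u) ^ 2) h0] at this
    refine this.trans ?_
    have h1 : l * ‖W.Q u‖ ^ 2 ≤ l * ‖u‖ ^ 2 := by gcongr; exact W.norm_Q_le u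
    have h2 : l * ‖W.Q u‖ ^ 2 + ∑ k, ‖W.Q u - W.τ (k, true) (W.Q u)‖ ^ 2 ≤ W.form l u := by
      unfold form
      nlinarith [sq_nonneg ‖u - W.Q u‖]
    calc _ = 16 * Real.log l⁻¹ * (l * ‖W.Q u‖ ^ 2
          + ∑ k, ‖W.Q u - W.τ (k, true) (W.Q u)‖ ^ 2) := by ring
      _ ≤ _ := by gcongr
  rw [h1]
  have h3 := Finset.sum_mul_sq_le_sq_mul_sq b.support (fun y => b y)
    fun y => inner ℝ (P₂ y 0) (W.Q u)
  have h4 : (∑ y ∈ b.support, b y * inner ℝ (P₂ y 0) (W.Q u)) ^ 2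
      ≤ E * (16 * Real.log l⁻¹ * W.form l u) :=
    h3.trans (mul_le_mul (sum_sq_quadCoeff_le hE _) h2
      (Finset.sum_nonneg fun _ _ => sq_nonneg _) hE0)
  refine (Real.abs_le_sqrt h4).trans (le_of_eq ?_)
  rw [Real.sqrt_mul hE0, Real.sqrt_mul (by positivity), Real.sqrt_mul (by norm_num),
    show (16 : ℝ) = 4 ^ 2 by norm_num, Real.sqrt_sq (by norm_num)]
  ring

/-- Moves the hand step of either model onto the swap-invariant test vector. The witness is `W.σ u`
for `M1` and `W.Q u` for `M2`, and neither is farther from `W.Q u` than `u`. -/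
theorem IsPairFamily.exists_inner_handStep (hS : W.IsArrowFamily S)
    (hP : W.IsPairFamily S i ρ' P P₂) (M : Model) (u : H) (a : Site 2 →₀ ℝ) :
    ∃ w : H, W.Q w = W.Q u ∧ ‖w - W.Q u‖ ≤ ‖u - W.Q u‖ ∧
      inner ℝ (u - W.handStep M u) (testVec S a)
        = inner ℝ w (testVec S a - ρ' (testVec S a)) := by
  have hσ := hP.σ_testVec hS a
  cases M
  · refine ⟨W.σ u, W.Q_σ u, ?_, ?_⟩
    · refine le_of_eq ?_
      rw [← W.σ.norm_map (u - W.Q u), map_sub, σ_Q]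
    · rw [handStep, inner_sub_left, hP.adjoint, inner_sub_right, W.inner_σ_left u (testVec S a), hσ]
  · refine ⟨W.Q u, W.Q_Q u, by simp, ?_⟩
    have hQ := W.Q_of_σ_eq hσ
    rw [handStep, inner_sub_left, inner_Q_left, hQ, hP.adjoint, inner_sub_right,
      W.inner_Q_left u (testVec S a), hQ]

/-- Split `w` into `W.Q u` and a remainder controlled by the form. The remainder costs `2 √E`.
Against `W.Q u`, the linear part costs `√E / 2` by summation by parts and the quadratic part `4 √L
√E`. -/
theorem IsPairFamily.inner_handStep_le (hS : W.IsArrowFamily S)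
    (hP : W.IsPairFamily S i ρ' P P₂) {a : Site 2 →₀ ℝ} {E : ℝ}
    (ha : a (Dir.vec (i, true)) = a (-Dir.vec (i, true)))
    (hE : ∀ B : Finset (Site 2), ∑ x ∈ B, (a x - a (x - Dir.vec (i, true))) ^ 2 ≤ E)
    {l : ℝ} (hl : 0 < l) (hl1 : l ≤ 1 / 16) (M : Model) (u : H) :
    inner ℝ (u - W.handStep M u) (testVec S a)
      ≤ (4 * √(Real.log l⁻¹) + 3) * √E * √(W.form l u) := by
  obtain ⟨w, hw1, hw2, hw3⟩ := hP.exists_inner_handStep hS M u a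
  set f := testVec S a with hf
  set v := W.Q u with hv
  set r := Finsupp.linearCombination ℝ P (quadCoeff i a) with hr
  have hN : ‖u - W.Q u‖ ≤ √(W.form l u) := Real.le_sqrt_of_sq_le (W.norm_sub_Q_sq_le hl.le u)
  have hE' := hP.norm_testVec_sub_τ_le hS hE
  rw [← hf] at hE'
  have hE'' : ‖f - W.τ (i, false) f‖ ≤ √E := by
    rw [← (W.τ (i, true)).norm_map, map_sub, τ_true_false, norm_sub_rev]
    exact hE'
  have hr' : ‖r‖ ≤ √E := by
    refine Real.le_sqrt_of_sq_le ?_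
    have := hP.P_bessel.norm_sq_linearCombination_le zero_le_one (quadCoeff i a)
    rw [one_mul] at this
    exact this.trans (sum_sq_quadCoeff_le hE _)
  have hv2 : ‖v - W.τ (i, true) v‖ ≤ √(W.form l u) :=
    Real.le_sqrt_of_sq_le (W.norm_Q_sub_τ_sq_le hl.le u i)
  have h1 : inner ℝ v ((1 / 2 : ℝ) • (f - W.τ (i, true) f) + (1 / 2 : ℝ) • (f - W.τ (i, false) f))
      = 1 / 2 * inner ℝ (v - W.τ (i, true) v) (f - W.τ (i, true) f) := by
    have h : inner ℝ v (W.τ (i, false) f) = inner ℝ (W.τ (i, true) v) f := by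
      rw [real_inner_comm, inner_τ_false, real_inner_comm]
    rw [inner_sub_τ, inner_τ_false]
    simp only [inner_add_right, inner_sub_right, real_inner_smul_right, h]
    ring
  have h2 : inner ℝ (w - v) (f - ρ' f) ≤ √(W.form l u) * (2 * √E) := by
    refine (real_inner_le_norm _ _).trans ?_
    gcongr
    · exact hw2.trans hN
    · rw [hf, hP.testVec_sub_ρ' hS, ← hf]
      refine (norm_sub_le _ _).trans ((add_le_add_left (norm_add_le _ _) _).trans ?_)
      rw [norm_smul, norm_smul]
      norm_num
      linarith
  have h3 : inner ℝ w (f - ρ' f) = inner ℝ (w - v) (f - ρ' f)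
      + 1 / 2 * inner ℝ (v - W.τ (i, true) v) (f - W.τ (i, true) f) - inner ℝ v r := by
    rw [inner_sub_left, ← h1, hf, hP.testVec_sub_ρ' hS, ← hf, ← hr, inner_sub_right v]
    ring
  have h4 : inner ℝ (v - W.τ (i, true) v) (f - W.τ (i, true) f) ≤ √(W.form l u) * √E := by
    refine (real_inner_le_norm _ _).trans ?_
    gcongr
  have h5 := hP.abs_inner_quad_le ha hE hl hl1 u
  have h6 := neg_le_of_abs_le h5
  have h7 : 0 ≤ √(W.form l u) * √E := by positivity
  rw [hw3, h3]
  nlinarith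

/-- The pairing of the resolvent equation with a linear function. -/
theorem IsPairFamily.inner_resolventOp_le (hS : W.IsArrowFamily S)
    (hP : W.IsPairFamily S i ρ' P P₂) {a : Site 2 →₀ ℝ} {A E E' : ℝ}
    (ha : a (Dir.vec (i, true)) = a (-Dir.vec (i, true)))
    (hA : ∀ B : Finset (Site 2), ∑ x ∈ B, a x ^ 2 ≤ A)
    (hE : ∀ B : Finset (Site 2), ∑ x ∈ B, (a x - a (x - Dir.vec (i, true))) ^ 2 ≤ E)
    (hE' : ∀ k, ∀ B : Finset (Site 2), ∑ x ∈ B, (a x - a (x - Dir.vec (k, true))) ^ 2 ≤ E')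
    {ε l : ℝ} (hε : 0 < ε) (hl : 0 < l) (hl1 : l ≤ 1 / 16) (M : Model) (u : H) :
    inner ℝ (W.resolventOp M ε l u) (testVec S a)
      ≤ (2 * √(l * A) + (4 * √(Real.log l⁻¹) + 3) * √E + ε * √E') * √(W.form l u) := by
  have hσ := hP.σ_testVec hS a
  have hQ := W.Q_of_σ_eq hσ
  have h1 : l * inner ℝ u (testVec S a) ≤ 2 * √(l * A) * √(W.form l u) := by
    have e1 := real_inner_le_norm u (testVec S a)
    have e2 := norm_testVec_le hS hA
    have e3 : √l * ‖u‖ ≤ √(W.form l u) := by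
      refine Real.le_sqrt_of_sq_le ?_
      rw [mul_pow, Real.sq_sqrt hl.le]
      exact W.mul_norm_sq_le u
    rw [Real.sqrt_mul hl.le]
    calc l * inner ℝ u (testVec S a) ≤ l * (‖u‖ * (2 * √A)) := by
          gcongr; exact e1.trans (by gcongr)
      _ = (√l * ‖u‖) * (2 * (√l * √A)) := by
          nth_rw 1 [← Real.mul_self_sqrt hl.le]; ring
      _ ≤ √(W.form l u) * (2 * (√l * √A)) := by gcongr
      _ = _ := by ring
  have h2 := hP.inner_handStep_le hS ha hE hl hl1 M u
  -- As the test vector is swap-invariant, only the Dirichlet form of the elliptic part survives.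
  have h3 : inner ℝ (u - (1 / 4 : ℝ) • ∑ e, W.Q (W.τ e (W.Q u))) (testVec S a)
      ≤ √E' * √(W.form l u) := by
    rw [inner_sub_sum_Q_τ_Q, inner_Q_left, hQ, hQ, sub_self, zero_add, Fin.sum_univ_two]
    have e : ∀ k, inner ℝ (W.Q u - W.τ (k, true) (W.Q u))
        (testVec S a - W.τ (k, true) (testVec S a)) ≤ √(W.form l u) * √E' := by
      intro k
      refine (real_inner_le_norm _ _).trans ?_
      gcongr
      · exact Real.le_sqrt_of_sq_le (W.norm_Q_sub_τ_sq_le hl.le u k)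
      · exact hP.norm_testVec_sub_τ_le hS (hE' k)
    have : 0 ≤ √(W.form l u) * √E' := by positivity
    have := e 0
    have := e 1
    linarith
  rw [resolventOp, inner_add_left, inner_add_left, real_inner_smul_left, real_inner_smul_left]
  have h4 := mul_le_mul_of_nonneg_left h3 hε.le
  linarith

end WalkOps
end StoredMomentum

/-! ### The profile on the lattice and its parameters. -/

namespace StoredMomentum

theorem log_sub_log_le_logHeight {m R : ℕ} (hm : 0 < m) (hmR : m ≤ R) :
    Real.log R - Real.log m ≤ logHeight m R := by
  induction R, hmR using Nat.le_induction with
  | base => simp [logHeight]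
  | succ R hR ih =>
    have hR0 : (0 : ℝ) < R := by exact_mod_cast hm.trans_le hR
    have h1 : Real.log ((R + 1 : ℕ) : ℝ) - Real.log R ≤ 1 / R := by
      rw [← Real.log_div (by positivity) hR0.ne']
      refine (Real.log_le_sub_one_of_pos (by positivity)).trans (le_of_eq ?_)
      push_cast
      field_simp
      ring
    rw [logHeight, Finset.sum_Ico_succ_top hR, ← logHeight]
    linarith

theorem logHeight_le {m R : ℕ} (hm : 0 < m) : logHeight m R ≤ 1 + Real.log R := by
  refine le_trans ?_ (harmonic_le_one_add_log R)
  rw [harmonic_eq_sum_Icc]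
  push_cast
  simp only [logHeight, one_div]
  refine Finset.sum_le_sum_of_subset_of_nonneg (fun k hk => ?_) fun _ _ _ => by positivity
  rw [Finset.mem_Ico] at hk
  rw [Finset.mem_Icc]
  omega

/-- In `Fin 2`, `i + 1` is the coordinate other than `i`; the profile is read with direction `i`
first. -/
theorem planeCoord_injective (i : Fin 2) :
    Function.Injective (fun x : Site 2 => ((x i, x (i + 1)) : ℤ × ℤ)) := by
  intro x y h
  simp only [Prod.mk.injEq] at h
  ext k
  fin_cases i <;> fin_cases k <;> first | exact h.1 | exact h.2

/-- The logarithmic profile, elongated in the direction `i`. -/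
noncomputable def siteProfile (i : Fin 2) (m R : ℕ) (hm : 0 < m) : Site 2 →₀ ℝ :=
  Finsupp.ofSupportFinite (fun x => logProfile m R (x i) (x (i + 1))) (by
    refine (((Finset.Icc (-(R : ℤ)) R ×ˢ Finset.Icc (-(R : ℤ)) R : Finset (ℤ × ℤ)).finite_toSet
      ).preimage (planeCoord_injective i).injOn).subset fun x hx => ?_
    have h := bounds_of_logProfile_ne_zero hx
    have h2 : (x (i + 1)).natAbs < R := (Nat.le_mul_of_pos_left _ hm).trans_lt h.2
    simp only [Set.mem_preimage, Finset.mem_coe, Finset.mem_product, Finset.mem_Icc]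
    omega)

theorem siteProfile_apply (i : Fin 2) (m R : ℕ) (hm : 0 < m) (x : Site 2) :
    siteProfile i m R hm x = logProfile m R (x i) (x (i + 1)) := rfl

theorem fin_two_succ_ne (i : Fin 2) : i + 1 ≠ i := by fin_cases i <;> decide

theorem sum_sq_siteProfile_sub_le (i : Fin 2) {m R : ℕ} (hm : 0 < m) (B : Finset (Site 2)) :
    ∑ x ∈ B, (siteProfile i m R hm x - siteProfile i m R hm (x - Dir.vec (i, true))) ^ 2
      ≤ 6 / m * logHeight m R := by
  have hinj : Function.Injective (fun x : Site 2 =>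
      (((x - Dir.vec (i, true)) i, (x - Dir.vec (i, true)) (i + 1)) : ℤ × ℤ)) :=
    (planeCoord_injective i).comp (sub_left_injective)
  have := sum_sq_logProfile_sub_fst_le (R := R) hm (B.map ⟨_, hinj⟩)
  rw [Finset.sum_map] at this
  simpa [siteProfile_apply, Dir.vec, Pi.single_apply, fin_two_succ_ne] using this

theorem sum_sq_siteProfile_sub_le' (i : Fin 2) {m R : ℕ} (hm : 0 < m) (B : Finset (Site 2)) :
    ∑ x ∈ B, (siteProfile i m R hm x - siteProfile i m R hm (x - Dir.vec (i + 1, true))) ^ 2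
      ≤ 6 * m * logHeight m R := by
  have hinj : Function.Injective (fun x : Site 2 =>
      (((x - (Dir.vec (i + 1, true) : Site 2)) i,
        (x - (Dir.vec (i + 1, true) : Site 2)) (i + 1)) : ℤ × ℤ)) :=
    (planeCoord_injective i).comp (sub_left_injective)
  have := sum_sq_logProfile_sub_snd_le (R := R) hm (B.map ⟨_, hinj⟩)
  rw [Finset.sum_map] at this
  simpa [siteProfile_apply, Dir.vec, Pi.single_apply, (fin_two_succ_ne i).symm] using this

theorem sum_sq_siteProfile_le (i : Fin 2) {m R : ℕ} (hm : 0 < m) (hmR : m ≤ R)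
    (B : Finset (Site 2)) :
    ∑ x ∈ B, siteProfile i m R hm x ^ 2 ≤ 9 * (R : ℝ) ^ 2 / m * logHeight m R ^ 2 := by
  have := sum_sq_logProfile_le hm hmR (B.map ⟨_, planeCoord_injective i⟩)
  rwa [Finset.sum_map] at this

/-- The evenness which makes the quadratic coefficient vanish at the origin. -/
theorem siteProfile_vec (i : Fin 2) {m R : ℕ} (hm : 0 < m) :
    siteProfile i m R hm (Dir.vec (i, true)) = siteProfile i m R hm (-Dir.vec (i, true)) := by
  simp only [siteProfile_apply, Pi.neg_apply]
  rw [logProfile_neg]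
  simp [Dir.vec]

theorem siteProfile_zero (i : Fin 2) {m R : ℕ} (hm : 0 < m) :
    siteProfile i m R hm 0 = logHeight m R := by
  simp [siteProfile_apply, logProfile_zero]

/-- The choice of the parameters of the profile. -/
theorem exists_profile_params {l : ℝ} (hl : 0 < l) (hL : 64 ≤ Real.log l⁻¹) :
    ∃ m R : ℕ, 0 < m ∧ m ≤ R ∧ √(Real.log l⁻¹) ≤ m ∧ (m : ℝ) ≤ 2 * √(Real.log l⁻¹)
      ∧ l * (R : ℝ) ^ 2 ≤ 1 ∧ Real.log l⁻¹ / 4 ≤ logHeight m R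
      ∧ logHeight m R ≤ Real.log l⁻¹ := by
  set L := Real.log l⁻¹ with hLdef
  -- The witnesses are `m = ⌈√L⌉` and `R = ⌊l ^ (-1 / 2)⌋ = ⌊exp (L / 2)⌋`.
  set s := √L with hs
  have hs2 : s ^ 2 = L := Real.sq_sqrt (by linarith)
  have hs8 : 8 ≤ s := Real.le_sqrt_of_sq_le (by linarith)
  set q := (√l)⁻¹ with hq
  have hsl : 0 < √l := Real.sqrt_pos.2 hl
  have hq0 : 0 < q := inv_pos.2 hsl
  have hq2 : q ^ 2 = l⁻¹ := by rw [hq, inv_pow, Real.sq_sqrt hl.le]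
  have hqL : Real.log q = L / 2 := by
    rw [hLdef, ← hq2, Real.log_pow]; push_cast; ring
  have hqe : q = Real.exp (L / 2) := by rw [← hqL, Real.exp_log hq0]
  -- Ensures `m * exp (L / 4) ≤ R`, so that the height, at least `log (R / m)`, is at least `L / 4`;
  -- `L ≥ 64` leaves ample room.
  have hexp : 4 * s ≤ Real.exp (L / 4) := by
    have := Real.quadratic_le_exp_of_nonneg (show 0 ≤ L / 4 by linarith)
    refine le_trans ?_ this
    rw [← hs2]
    nlinarith [mul_nonneg (by linarith : 0 ≤ s - 8) (by positivity : 0 ≤ s ^ 2)]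
  have hee : q = Real.exp (L / 4) * Real.exp (L / 4) := by
    rw [hqe, ← Real.exp_add]; congr 1; ring
  have hR1 : (⌊q⌋₊ : ℝ) ≤ q := Nat.floor_le hq0.le
  have hR2 : q < (⌊q⌋₊ : ℝ) + 1 := Nat.lt_floor_add_one q
  have hm1 : s ≤ (⌈s⌉₊ : ℝ) := Nat.le_ceil s
  have hm2 : (⌈s⌉₊ : ℝ) < s + 1 := Nat.ceil_lt_add_one (by linarith)
  have hm0 : 0 < ⌈s⌉₊ := Nat.ceil_pos.2 (by linarith)
  have hm0' : (0 : ℝ) < (⌈s⌉₊ : ℝ) := by exact_mod_cast hm0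
  have hmul : (⌈s⌉₊ : ℝ) * Real.exp (L / 4) ≤ (⌊q⌋₊ : ℝ) := by
    have h1 : (⌈s⌉₊ : ℝ) * Real.exp (L / 4) ≤ 2 * s * Real.exp (L / 4) := by
      gcongr; linarith
    have h2 : 2 * s * Real.exp (L / 4) ≤ q / 2 := by
      rw [hee]
      nlinarith [Real.exp_pos (L / 4)]
    have h3 : 2 ≤ q := by nlinarith
    linarith
  have he1 : 1 ≤ Real.exp (L / 4) := Real.one_le_exp (by linarith)
  have hmR : ⌈s⌉₊ ≤ ⌊q⌋₊ := by
    have : (⌈s⌉₊ : ℝ) ≤ (⌊q⌋₊ : ℝ) := by nlinarith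
    exact_mod_cast this
  have hRpos : (0 : ℝ) < (⌊q⌋₊ : ℝ) := lt_of_lt_of_le hm0' (by exact_mod_cast hmR)
  refine ⟨⌈s⌉₊, ⌊q⌋₊, hm0, hmR, hm1, by linarith, ?_, ?_, ?_⟩
  · calc l * (⌊q⌋₊ : ℝ) ^ 2 ≤ l * q ^ 2 := by gcongr
      _ = 1 := by rw [hq2]; field_simp
  · refine le_trans ?_ (log_sub_log_le_logHeight hm0 hmR)
    have := Real.log_le_log (by positivity) hmul
    rw [Real.log_mul hm0'.ne' (Real.exp_pos _).ne', Real.log_exp] at this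
    linarith
  · refine (logHeight_le hm0).trans ?_
    have := Real.log_le_log hRpos hR1
    rw [hqL] at this
    linarith

/-! ### The lower bound for the resolvent. -/

namespace WalkOps

variable {H : Type*} [NormedAddCommGroup H] [InnerProductSpace ℝ H] {W : WalkOps H}
  {S : Option (Site 2) → H} {i : Fin 2} {ρ' : H →ₗ[ℝ] H} {P : Site 2 → H}
  {P₂ : Site 2 → Site 2 → H}

/-- Testing the equation with the profile of height `h` gives `h ≤ C √(m h) √form`: at `m ≈ √L` the
quadratic cost `L h / m` and the elliptic cost `m h` balance. Then `form ≥ h / (C² m)`, and `h ≥ L /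
4` with `m ≤ 2 √L` yields the factor 8. -/
theorem IsPairFamily.le_form (hS : W.IsArrowFamily S) (hP : W.IsPairFamily S i ρ' P P₂)
    {ε l : ℝ} (hε : 0 < ε) (hl : 0 < l) (hL : 64 ≤ Real.log l⁻¹) (M : Model) {u : H}
    (hu : W.resolventOp M ε l u = W.drift M (S none)) :
    √(Real.log l⁻¹) / (8 * (24 + 3 * ε) ^ 2) ≤ W.form l u := by
  obtain ⟨m, R, hm, hmR, hm1, hm2, hlR, hh1, hh2⟩ := exists_profile_params hl hL
  set L := Real.log l⁻¹ with hLdef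
  set h := logHeight m R with hh
  have hl1 : l ≤ 1 / 16 := by
    by_contra hcon
    push Not at hcon
    have : Real.log l⁻¹ ≤ Real.log 16 := Real.log_le_log (by positivity) (by
      rw [inv_le_comm₀ hl (by norm_num)]; linarith)
    have h16 : Real.log 16 ≤ 16 - 1 := Real.log_le_sub_one_of_pos (by norm_num)
    linarith
  have hm' : (0 : ℝ) < m := by exact_mod_cast hm
  have hm1' : (1 : ℝ) ≤ m := by exact_mod_cast hm
  have hh0 : 0 < h := by linarith
  have hsL : 0 < √L := Real.sqrt_pos.2 (by linarith)
  have hLm : L ≤ (m : ℝ) ^ 2 := by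
    rw [← Real.sq_sqrt (show 0 ≤ L by linarith)]; gcongr
  set a := siteProfile i m R hm
  have hE := sum_sq_siteProfile_sub_le i (R := R) hm
  have hE' : ∀ k, ∀ B : Finset (Site 2),
      ∑ x ∈ B, (a x - a (x - Dir.vec (k, true))) ^ 2 ≤ 6 * m * h := by
    intro k B
    rcases eq_or_ne k i with rfl | hk
    · refine (hE B).trans ?_
      have : 6 / (m : ℝ) ≤ 6 * m := by
        rw [div_le_iff₀ hm']; nlinarith
      gcongr
    · have hk' : k = i + 1 := by
        fin_cases k <;> fin_cases i <;> first | rfl | exact absurd rfl hk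
      subst hk'
      exact sum_sq_siteProfile_sub_le' i hm B
  have key := hP.inner_resolventOp_le hS (siteProfile_vec i hm) (sum_sq_siteProfile_le i hm hmR) hE
    hE' hε hl hl1 M u
  have hlhs : inner ℝ (W.resolventOp M ε l u) (testVec S a) = h := by
    have h1 : inner ℝ (S none) (testVec S a) = h := by
      rw [hP.inner_none_testVec, siteProfile_zero]
    rw [hu]
    cases M
    · exact h1
    · rw [drift, inner_Q_left, W.Q_of_σ_eq (hP.σ_testVec hS a), h1]
  rw [hlhs, ← hh, ← hLdef] at key
  set N := W.form l u with hN
  have hN0 : 0 ≤ N := W.form_nonneg hl.le u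
  set t := √((m : ℝ) * h) with ht
  have ht0 : 0 < t := Real.sqrt_pos.2 (by positivity)
  have ht2 : t ^ 2 = m * h := Real.sq_sqrt (by positivity)
  have b1 : √(l * (9 * (R : ℝ) ^ 2 / m * h ^ 2)) ≤ 3 * t := by
    rw [Real.sqrt_le_left (by positivity), mul_pow, ht2]
    calc l * (9 * (R : ℝ) ^ 2 / m * h ^ 2) = (l * (R : ℝ) ^ 2) * (9 * h ^ 2 / m) := by ring
      _ ≤ 1 * (9 * h ^ 2 / m) := by gcongr
      _ = 9 * h * (h / m) := by ring
      _ ≤ 9 * h * m := by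
          gcongr
          rw [div_le_iff₀ hm', ← sq]
          exact hh2.trans hLm
      _ = _ := by ring
  -- `18 / 7` exceeds `√6` and is fitted to `4 √L + 3 ≤ 7 m`.
  have b2 : √(6 / (m : ℝ) * h) ≤ 18 / 7 * t / m := by
    rw [Real.sqrt_le_left (by positivity), div_pow, mul_pow, ht2, le_div_iff₀ (by positivity)]
    calc 6 / (m : ℝ) * h * (m : ℝ) ^ 2 = 6 * (m * h) := by field_simp
      _ ≤ _ := by gcongr; norm_num
  have b3 : √(6 * (m : ℝ) * h) ≤ 3 * t := by
    rw [Real.sqrt_le_left (by positivity), mul_pow, ht2]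
    nlinarith [mul_pos hm' hh0]
  have b4 : (4 * √L + 3) * √(6 / (m : ℝ) * h) ≤ 18 * t := by
    calc (4 * √L + 3) * √(6 / (m : ℝ) * h) ≤ (7 * m) * (18 / 7 * t / m) := by
          gcongr; linarith
      _ = 18 * t := by field_simp
  -- `24 = 2 * 3 + 18` collects the mass term and the hand step; `3 ε` is the elliptic part.
  have b5 : h ≤ (24 + 3 * ε) * t * √N := by
    refine key.trans ?_
    gcongr
    nlinarith
  have b6 : h * h ≤ h * ((24 + 3 * ε) ^ 2 * m * N) := by
    calc h * h ≤ ((24 + 3 * ε) * t * √N) * ((24 + 3 * ε) * t * √N) := by gcongr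
      _ = (24 + 3 * ε) ^ 2 * t ^ 2 * √N ^ 2 := by ring
      _ = _ := by rw [ht2, Real.sq_sqrt hN0]; ring
  have b7 := le_of_mul_le_mul_left b6 hh0
  rw [div_le_iff₀ (by positivity)]
  have b8 : (24 + 3 * ε) ^ 2 * m * N ≤ (24 + 3 * ε) ^ 2 * (2 * √L) * N := by gcongr
  have b9 : √L * √L ≤ √L * (N * (8 * (24 + 3 * ε) ^ 2)) := by
    rw [Real.mul_self_sqrt (by linarith)]
    nlinarith
  exact le_of_mul_le_mul_left b9 hsL

/-- The lower bound for the resolvent. -/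
theorem IsPairFamily.exists_le_inner_revDrift {ε : ℝ} (hε : 0 < ε) :
    ∃ C : ℝ, 0 < C ∧ ∃ L₀ : ℝ, 64 ≤ L₀ ∧ ∀ {H : Type} [NormedAddCommGroup H]
      [InnerProductSpace ℝ H] {W : WalkOps H} {S : Option (Site 2) → H} {i : Fin 2}
      {ρ' : H →ₗ[ℝ] H} {P : Site 2 → H} {P₂ : Site 2 → Site 2 → H}, W.IsArrowFamily S →
      W.IsPairFamily S i ρ' P P₂ → ∀ l : ℝ, 0 < l → L₀ ≤ Real.log l⁻¹ → ∀ (M : Model) (u : H),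
      W.resolventOp M ε l u = W.drift M (S none) →
      C * √(Real.log l⁻¹) ≤ inner ℝ (W.revDrift M (S none)) u := by
  set c := min 1 (ε / 4) with hc
  have hc0 : 0 < c := lt_min one_pos (by positivity)
  set K := 8 * (24 + 3 * ε) ^ 2 with hK
  have hK0 : 0 < K := by positivity
  -- The threshold on the logarithm forces `√N ≥ 4 / c`. Replacing the drift by the reversed drift
  -- loses at most `2 √N`, which is then at most half of the available `c N`.
  refine ⟨c / (2 * K), by positivity, max 64 ((16 / c ^ 2 * K) ^ 2), le_max_left _ _, ?_⟩
  intro H _ _ W S i ρ' P P₂ hS hP l hl hL M u hu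
  have hL64 := (le_max_left _ _).trans hL
  have h1 := hP.le_form hS hε hl hL64 M hu
  have h2 := W.form_le_inner hε hl M u
  rw [hu] at h2
  set N := W.form l u with hN
  have hN0 : 0 ≤ N := W.form_nonneg hl.le u
  have h3 : 16 / c ^ 2 * K ≤ √(Real.log l⁻¹) := Real.le_sqrt_of_sq_le ((le_max_right _ _).trans hL)
  rw [← hK, div_le_iff₀ hK0] at h1
  have h4 : 16 / c ^ 2 ≤ N := le_of_mul_le_mul_right (h3.trans h1) hK0
  have h5 : 4 / c ≤ √N := Real.le_sqrt_of_sq_le (by rw [div_pow]; norm_num; exact h4)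
  have h6 : 2 * √N ≤ c / 2 * N := by
    rw [div_le_iff₀ hc0] at h5
    nth_rw 2 [← Real.mul_self_sqrt hN0]
    nlinarith [Real.sqrt_nonneg N]
  have h7 : inner ℝ (W.drift M (S none)) u - 2 * √N ≤ inner ℝ (W.revDrift M (S none)) u := by
    cases M
    · have e := inner_sub_σ (W := W) (S none) u
      rw [inner_sub_left] at e
      have e2 := (le_abs_self _).trans
        (abs_inner_sub_Q_le (W := W) (hS.norm_le_one none) hl.le u)
      simp only [drift, revDrift]
      linarith
    · simp only [drift, revDrift]
      linarith [Real.sqrt_nonneg N]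
  calc c / (2 * K) * √(Real.log l⁻¹) ≤ c / (2 * K) * (N * K) := by gcongr
    _ = c / 2 * N := by field_simp
    _ ≤ _ := by linarith

end WalkOps
end StoredMomentum

namespace StoredMomentum

open MeasureTheory

/-! ### Square integrable functions of the environment -/

variable {p : Fin 2 → ℝ}

variable (p) in
/-- The Hilbert space of square integrable functions of the environment. -/
abbrev L2 : Type := Lp ℝ 2 (envLaw p)

open Classical in
variable (p) in
/-- The class of a square integrable function. -/
noncomputable def toL2 (f : Env 2 → ℝ) : L2 p :=
  if h : MemLp f 2 (envLaw p) then h.toLp f else 0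

theorem toL2_eq {f : Env 2 → ℝ} (h : MemLp f 2 (envLaw p)) : toL2 p f = h.toLp f := dif_pos h

theorem toL2_add {f g : Env 2 → ℝ} (hf : MemLp f 2 (envLaw p)) (hg : MemLp g 2 (envLaw p)) :
    toL2 p (fun ω => f ω + g ω) = toL2 p f + toL2 p g := by
  rw [toL2_eq hf, toL2_eq hg, ← MemLp.toLp_add]; exact toL2_eq (hf.add hg)

theorem toL2_sub {f g : Env 2 → ℝ} (hf : MemLp f 2 (envLaw p)) (hg : MemLp g 2 (envLaw p)) :
    toL2 p (fun ω => f ω - g ω) = toL2 p f - toL2 p g := by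
  rw [toL2_eq hf, toL2_eq hg, ← MemLp.toLp_sub]; exact toL2_eq (hf.sub hg)

theorem toL2_smul (c : ℝ) {f : Env 2 → ℝ} (hf : MemLp f 2 (envLaw p)) :
    toL2 p (fun ω => c * f ω) = c • toL2 p f := by
  rw [toL2_eq hf, ← MemLp.toLp_const_smul]; exact toL2_eq (hf.const_smul c)

theorem toL2_sum {ι : Type*} (s : Finset ι) {f : ι → Env 2 → ℝ}
    (hf : ∀ i, MemLp (f i) 2 (envLaw p)) :
    toL2 p (fun ω => ∑ i ∈ s, f i ω) = ∑ i ∈ s, toL2 p (f i) := by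
  classical
  induction s using Finset.induction_on with
  | empty =>
    simp only [Finset.sum_empty]
    rw [toL2_eq (f := fun _ => (0 : ℝ)) MemLp.zero']
    rfl
  | insert i s hi ih =>
    simp only [Finset.sum_insert hi]
    rw [toL2_add (hf i) (memLp_finsetSum _ fun j _ => hf j), ih]

theorem toL2_congr {f g : Env 2 → ℝ} (hf : MemLp f 2 (envLaw p)) (hg : MemLp g 2 (envLaw p))
    (h : f =ᵐ[envLaw p] g) : toL2 p f = toL2 p g := by
  rw [toL2_eq hf, toL2_eq hg, MemLp.toLp_eq_toLp_iff]; exact h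

theorem inner_toL2 {f g : Env 2 → ℝ} (hf : MemLp f 2 (envLaw p)) (hg : MemLp g 2 (envLaw p)) :
    inner ℝ (toL2 p f) (toL2 p g) = ∫ ω, f ω * g ω ∂envLaw p := by
  rw [toL2_eq hf, toL2_eq hg, L2.inner_def]
  refine integral_congr_ae ?_
  filter_upwards [hf.coeFn_toLp, hg.coeFn_toLp] with ω h1 h2
  rw [h1, h2]
  simp [mul_comm]

/-- Composition with a map preserving the law of the environment. -/
noncomputable def pull (f : Env 2 → Env 2) (hf : MeasurePreserving f (envLaw p) (envLaw p)) :
    L2 p →ₗᵢ[ℝ] L2 p := Lp.compMeasurePreservingₗᵢ ℝ f hf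

theorem pull_toL2 {f : Env 2 → Env 2} (hf : MeasurePreserving f (envLaw p) (envLaw p))
    {g : Env 2 → ℝ} (hg : MemLp g 2 (envLaw p)) :
    pull f hf (toL2 p g) = toL2 p fun ω => g (f ω) := by
  rw [toL2_eq hg]
  exact (toL2_eq (hg.comp_measurePreserving hf)).symm

/-- Composition acts contravariantly, so the order of the maps is reversed. -/
theorem pull_pull {f g h : Env 2 → Env 2} (hf : MeasurePreserving f (envLaw p) (envLaw p))
    (hg : MeasurePreserving g (envLaw p) (envLaw p))
    (hh : MeasurePreserving h (envLaw p) (envLaw p)) (e : ∀ ω, g (f ω) = h ω) (u : L2 p) :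
    pull f hf (pull g hg u) = pull h hh u := by
  have e' : h = g ∘ f := funext fun ω => (e ω).symm
  subst e'
  exact (Lp.compMeasurePreserving_comp_apply u hg hf).symm

theorem pull_id {f : Env 2 → Env 2} (hf : MeasurePreserving f (envLaw p) (envLaw p))
    (e : ∀ ω, f ω = ω) (u : L2 p) : pull f hf u = u := by
  have e' : f = id := funext e
  subst e'
  exact Lp.compMeasurePreserving_id_apply u

/-! ### Maps preserving the law of the environment -/

theorem measurable_shift (e : Dir 2) : Measurable (shift e) := by
  refine measurable_pi_lambda _ fun x => ?_
  cases x <;> exact measurable_pi_apply _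

theorem measurable_swap : Measurable (swap (d := 2)) := by
  refine measurable_pi_lambda _ fun x => ?_
  unfold swap
  split_ifs <;> exact measurable_pi_apply _

theorem shift_eq_comp (e : Dir 2) (ω : Env 2) :
    shift e ω = fun x => ω (Equiv.optionCongr (Equiv.addRight e.vec) x) := by
  funext x; cases x <;> rfl

theorem swap_eq_comp (ω : Env 2) : swap ω = fun x => ω (Equiv.swap none (some 0) x) := by
  funext x
  unfold swap
  rw [Equiv.swap_apply_def]
  split_ifs <;> rfl

theorem swap_swap (ω : Env 2) : swap (swap ω) = ω := by
  simp only [swap_eq_comp, Equiv.swap_apply_self]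

/-- The direction opposite to `e`. -/
def Dir.opp (e : Dir 2) : Dir 2 := (e.1, !e.2)

theorem Dir.vec_opp (e : Dir 2) : e.opp.vec = -e.vec := by
  obtain ⟨k, _ | _⟩ := e <;> simp [Dir.opp, Dir.vec]

theorem Dir.opp_opp (e : Dir 2) : e.opp.opp = e := by simp [Dir.opp]

theorem shift_shift_opp (e : Dir 2) (ω : Env 2) : shift e (shift e.opp ω) = ω := by
  funext x
  cases x with
  | none => rfl
  | some x => simp [shift, Dir.vec_opp]

/-- The inverse of the shift in the direction of the hand arrow. -/
def shiftHandInv (ω : Env 2) : Env 2 := shift (ω none).opp ω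

theorem shiftHandInv_shiftHand (ω : Env 2) : shiftHandInv (shiftHand ω) = ω := by
  have := shift_shift_opp (ω none).opp ω
  rwa [Dir.opp_opp] at this

/-- The hand arrow takes finitely many values, so each can be treated separately. -/
theorem measurable_of_hand {f : Env 2 → Env 2} (g : Dir 2 → Env 2 → Env 2)
    (hg : ∀ e, Measurable (g e)) (hf : ∀ ω, f ω = g (ω none) ω) : Measurable f := by
  have : Measurable fun q : Dir 2 × Env 2 => g q.1 q.2 := measurable_from_prod_countable_right hg
  have h2 : Measurable fun ω : Env 2 => (ω none, ω) :=
    (measurable_pi_apply none).prodMk measurable_id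
  rw [funext hf]
  exact this.comp h2

/-- The laws `μ_p` give opposite directions equal mass; all orthogonality relations below rest on
this. -/
theorem map_opp_arrowLaw : (arrowLaw p).map Dir.opp = arrowLaw p := by
  have hm : Measurable Dir.opp := measurable_of_countable _
  ext s hs
  rw [Measure.map_apply hm hs]
  simp only [arrowLaw, Measure.coe_finsetSum, Finset.sum_apply, Measure.smul_apply, smul_eq_mul]
  refine Fintype.sum_equiv ⟨Dir.opp, Dir.opp, Dir.opp_opp, Dir.opp_opp⟩ _ _ fun a => ?_
  rw [Measure.dirac_apply' _ (hm hs), Measure.dirac_apply' _ hs]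
  rfl

variable [IsProbabilityMeasure (arrowLaw p)]

instance : IsProbabilityMeasure (envLaw p) := by unfold envLaw; infer_instance

theorem measurePreserving_comp_equiv (g : Option (Site 2) ≃ Option (Site 2)) :
    MeasurePreserving (fun (ω : Env 2) x => ω (g x)) (envLaw p) (envLaw p) :=
  ⟨by fun_prop, Measure.map_infinitePi_infinitePi_of_inj (P := fun _ => arrowLaw p) g.injective⟩

theorem measurePreserving_shift (e : Dir 2) :
    MeasurePreserving (shift e) (envLaw p) (envLaw p) := by
  rw [funext (shift_eq_comp e)]
  exact measurePreserving_comp_equiv _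

theorem measurePreserving_swap : MeasurePreserving swap (envLaw p) (envLaw p) := by
  rw [funext swap_eq_comp]
  exact measurePreserving_comp_equiv _

/-- A map which shifts the environment by an amount depending on the hand arrow only preserves the
law of the environment. -/
theorem measurePreserving_of_hand {f : Env 2 → Env 2} (g : Dir 2 → Dir 2)
    (hf : ∀ ω, f ω = shift (g (ω none)) ω) : MeasurePreserving f (envLaw p) (envLaw p) := by
  have hfm : Measurable f :=
    measurable_of_hand (fun e => shift (g e)) (fun e => measurable_shift _) hf
  refine ⟨hfm, ?_⟩
  ext A hA
  rw [Measure.map_apply hfm hA]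
  -- The environments are partitioned by the hand arrow. Shifts do not change it, and on each piece
  -- `f` is a fixed shift.
  set T : Dir 2 → Set (Env 2) := fun e => {ω | ω none = e} with hT
  have hTm : ∀ e, MeasurableSet (T e) := fun e =>
    (measurable_pi_apply (X := fun _ : Option (Site 2) => Dir 2) none) (measurableSet_singleton e)
  have hdec : ∀ B : Set (Env 2), MeasurableSet B → envLaw p B = ∑ e, envLaw p (B ∩ T e) := by
    intro B hB
    rw [← measure_biUnion_finset]
    · congr 1
      ext ω
      simp [hT]
    · intro e _ e' _ hne
      refine Set.disjoint_left.2 fun ω h1 h2 => hne (h1.2.symm.trans h2.2)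
    · exact fun e _ => hB.inter (hTm e)
  rw [hdec _ (hfm hA), hdec _ hA]
  refine Finset.sum_congr rfl fun e _ => ?_
  rw [← (measurePreserving_shift (p := p) (g e)).measure_preimage
    (hA.inter (hTm e)).nullMeasurableSet]
  congr 1
  ext ω
  simp only [Set.mem_inter_iff, Set.mem_preimage, hT, Set.mem_ofPred_eq]
  have : shift (g e) ω none = ω none := rfl
  rw [this]
  constructor <;> rintro ⟨h1, h2⟩ <;> refine ⟨?_, h2⟩
  · rwa [hf, h2] at h1
  · rwa [hf, h2]

theorem measurePreserving_shiftHand : MeasurePreserving shiftHand (envLaw p) (envLaw p) :=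
  measurePreserving_of_hand id fun _ => rfl

theorem measurePreserving_shiftHandInv : MeasurePreserving shiftHandInv (envLaw p) (envLaw p) :=
  measurePreserving_of_hand Dir.opp fun _ => rfl

theorem measurePreserving_swapIf (b : Bool) :
    MeasurePreserving (swapIf b) (envLaw p) (envLaw p) := by
  cases b
  · exact MeasurePreserving.id _
  · exact measurePreserving_swap

theorem jumpEnv_none (b b' : Bool) :
    jumpEnv (d := 2) (none, b, b') = swapIf b' ∘ shiftHand ∘ swapIf b := rfl

theorem jumpEnv_some (e : Dir 2) (b b' : Bool) :
    jumpEnv (some e, b, b') = swapIf b' ∘ shift e ∘ swapIf b := rfl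

theorem measurePreserving_jumpEnv (m : Jump 2) :
    MeasurePreserving (jumpEnv m) (envLaw p) (envLaw p) := by
  obtain ⟨_ | e, b, b'⟩ := m
  · rw [jumpEnv_none]
    exact (measurePreserving_swapIf b').comp
      (measurePreserving_shiftHand.comp (measurePreserving_swapIf b))
  · rw [jumpEnv_some]
    exact (measurePreserving_swapIf b').comp
      ((measurePreserving_shift e).comp (measurePreserving_swapIf b))

/-- The environment with the arrow at `x` reversed. -/
def flipAt (x : Option (Site 2)) (ω : Env 2) : Env 2 := fun y => if y = x then (ω y).opp else ω y

theorem measurePreserving_flipAt (x : Option (Site 2)) :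
    MeasurePreserving (flipAt x) (envLaw p) (envLaw p) := by
  have hm : Measurable Dir.opp := measurable_of_countable _
  have hf : ∀ y : Option (Site 2), Measurable fun a : Dir 2 => if y = x then a.opp else a := by
    intro y
    split_ifs
    · exact hm
    · exact measurable_id
  refine ⟨measurable_pi_lambda _ fun y => (hf y).comp (measurable_pi_apply y), ?_⟩
  have := Measure.infinitePi_map_pi (μ := fun _ : Option (Site 2) => arrowLaw p) hf
  unfold envLaw
  refine this.trans ?_
  congr 1
  funext y
  split_ifs
  · exact map_opp_arrowLaw
  · exact Measure.map_id

/-- Parity: reversing one arrow preserves the law, so functions odd in that arrow have mean zero. -/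
theorem integral_eq_zero_of_flipAt (x : Option (Site 2)) {f : Env 2 → ℝ} (hm : Measurable f)
    (hf : ∀ ω, f (flipAt x ω) = -f ω) : ∫ ω, f ω ∂envLaw p = 0 := by
  have hp := measurePreserving_flipAt (p := p) x
  have h1 : ∫ ω, f (flipAt x ω) ∂envLaw p = ∫ ω, f ω ∂envLaw p := by
    rw [← integral_map hp.measurable.aemeasurable hm.aestronglyMeasurable, hp.map_eq]
  simp only [hf, integral_neg] at h1
  linarith

/-! ### The generator on square integrable functions -/

variable (p) in
/-- The elementary maps, acting on square integrable functions. -/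
noncomputable def envOps : WalkOps (L2 p) where
  σ := pull swap measurePreserving_swap
  τ e := pull (shift e) (measurePreserving_shift e)
  ρ := pull shiftHand measurePreserving_shiftHand
  σ_σ h := by
    rw [pull_pull _ _ (MeasurePreserving.id _) (h := id) swap_swap]
    exact pull_id _ (fun _ => rfl) h
  τ_not k b h := by
    rw [pull_pull _ _ (MeasurePreserving.id _) (h := id)
      (show ∀ ω, shift (k, b) (shift (k, !b) ω) = ω from shift_shift_opp (k, b))]
    exact pull_id _ (fun _ => rfl) h

theorem pull_swapIf (b : Bool) (u : L2 p) :
    pull (swapIf b) (measurePreserving_swapIf b) u = if b then (envOps p).σ u else u := by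
  cases b
  · exact pull_id _ (fun _ => rfl) u
  · rfl

theorem pull_jumpEnv_none (b b' : Bool) (u : L2 p) :
    pull (jumpEnv (none, b, b')) (measurePreserving_jumpEnv _) u
      = pull (swapIf b) (measurePreserving_swapIf b)
        ((envOps p).ρ (pull (swapIf b') (measurePreserving_swapIf b') u)) := by
  have h2 := (measurePreserving_swapIf (p := p) b').comp measurePreserving_shiftHand
  rw [envOps, pull_pull measurePreserving_shiftHand _ h2 fun _ => rfl]
  rw [pull_pull _ h2 (measurePreserving_jumpEnv _)]
  exact fun _ => rfl

theorem pull_jumpEnv_some (e : Dir 2) (b b' : Bool) (u : L2 p) :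
    pull (jumpEnv (some e, b, b')) (measurePreserving_jumpEnv _) u
      = pull (swapIf b) (measurePreserving_swapIf b)
        ((envOps p).τ e (pull (swapIf b') (measurePreserving_swapIf b') u)) := by
  have h2 := (measurePreserving_swapIf (p := p) b').comp (measurePreserving_shift e)
  simp only [envOps]
  rw [pull_pull (measurePreserving_shift e) _ h2 fun _ => rfl]
  rw [pull_pull _ h2 (measurePreserving_jumpEnv _)]
  exact fun _ => rfl

/-- Identifies the abstract resolvent operator with the one of the jump process of total rate `1 +
ε`. -/
theorem resolventOp_eq (M : Model) (ε l : ℝ) (u : L2 p) :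
    (envOps p).resolventOp M ε l u
      = (l + (1 + ε)) • u
        - ∑ m : Jump 2, rate M ε m • pull (jumpEnv m) (measurePreserving_jumpEnv m) u := by
  -- `Q τ Q` is a quarter of the sum over the four choices of swaps, each of rate `ε / 16`.
  have hQ : ∀ e, ∑ b : Bool × Bool, (ε / (8 * ((2 : ℕ) : ℝ))) •
      pull (jumpEnv (some e, b)) (measurePreserving_jumpEnv (some e, b)) u
        = (ε * (1 / 4)) • (envOps p).Q ((envOps p).τ e ((envOps p).Q u)) := by
    intro e
    simp only [Fintype.sum_prod_type, Fintype.sum_bool, pull_jumpEnv_some, pull_swapIf, if_true,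
      Bool.false_eq_true, if_false, WalkOps.Q_apply, map_smul, map_add]
    push_cast
    module
  have hN : ∑ b : Bool × Bool, rate (d := 2) M ε (none, b) •
      pull (jumpEnv (none, b)) (measurePreserving_jumpEnv (none, b)) u
        = (envOps p).handStep M u := by
    cases M
    · simp [rate, pull_jumpEnv_none, pull_swapIf, WalkOps.handStep]
    · simp only [Fintype.sum_prod_type, Fintype.sum_bool, pull_jumpEnv_none, pull_swapIf, if_true,
        Bool.false_eq_true, if_false, WalkOps.Q_apply, map_smul, map_add, WalkOps.handStep, rate]
      module
  rw [Fintype.sum_prod_type, Fintype.sum_option, hN]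
  simp only [rate, hQ]
  rw [← Finset.smul_sum, WalkOps.resolventOp]
  module

/-! ### The arrows as elements of the Hilbert space -/

/-- The `i`-th coordinate of the arrow at `x`. -/
def arrowFn (i : Fin 2) (x : Option (Site 2)) (ω : Env 2) : ℝ := ((ω x).vec i : ℤ)

theorem measurable_arrowFn (i : Fin 2) (x : Option (Site 2)) : Measurable (arrowFn i x) :=
  (measurable_of_countable fun a : Dir 2 => ((a.vec i : ℤ) : ℝ)).comp (measurable_pi_apply x)

theorem abs_vec_le_one (a : Dir 2) (i : Fin 2) : |((a.vec i : ℤ) : ℝ)| ≤ 1 := by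
  obtain ⟨k, _ | _⟩ := a <;> rcases eq_or_ne i k with rfl | h <;> simp [Dir.vec, *]

theorem abs_arrowFn_le_one (i : Fin 2) (x : Option (Site 2)) (ω : Env 2) : |arrowFn i x ω| ≤ 1 :=
  abs_vec_le_one _ _

theorem arrowFn_flipAt_self (i : Fin 2) (x : Option (Site 2)) (ω : Env 2) :
    arrowFn i x (flipAt x ω) = -arrowFn i x ω := by
  simp [arrowFn, flipAt, Dir.vec_opp]

theorem arrowFn_flipAt_of_ne (i : Fin 2) {x y : Option (Site 2)} (h : y ≠ x) (ω : Env 2) :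
    arrowFn i y (flipAt x ω) = arrowFn i y ω := by
  simp [arrowFn, flipAt, h]

theorem memLp_of_bounded {f : Env 2 → ℝ} (hm : Measurable f) {C : ℝ} (hC : ∀ ω, |f ω| ≤ C) :
    MemLp f 2 (envLaw p) :=
  MemLp.of_bound hm.aestronglyMeasurable C (Filter.Eventually.of_forall hC)

theorem memLp_arrowFn (i : Fin 2) (x : Option (Site 2)) : MemLp (arrowFn i x) 2 (envLaw p) :=
  memLp_of_bounded (measurable_arrowFn i x) (abs_arrowFn_le_one i x)

theorem measurable_arrowFn_mul (i : Fin 2) (x y : Option (Site 2)) :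
    Measurable fun ω => arrowFn i x ω * arrowFn i y ω :=
  (measurable_arrowFn i x).mul (measurable_arrowFn i y)

theorem abs_arrowFn_mul_le_one (i : Fin 2) (x y : Option (Site 2)) (ω : Env 2) :
    |arrowFn i x ω * arrowFn i y ω| ≤ 1 := by
  rw [abs_mul]
  exact mul_le_one₀ (abs_arrowFn_le_one _ _ _) (abs_nonneg _) (abs_arrowFn_le_one _ _ _)

theorem memLp_arrowFn_mul (i : Fin 2) (x y : Option (Site 2)) :
    MemLp (fun ω => arrowFn i x ω * arrowFn i y ω) 2 (envLaw p) :=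
  memLp_of_bounded (measurable_arrowFn_mul i x y) (abs_arrowFn_mul_le_one i x y)

theorem abs_inner_toL2_le_one {f g : Env 2 → ℝ} (hfm : Measurable f) (hgm : Measurable g)
    (hf : ∀ ω, |f ω| ≤ 1) (hg : ∀ ω, |g ω| ≤ 1) :
    |inner ℝ (toL2 p f) (toL2 p g)| ≤ 1 := by
  rw [inner_toL2 (memLp_of_bounded hfm hf) (memLp_of_bounded hgm hg), ← Real.norm_eq_abs]
  have := norm_integral_le_of_norm_le_const (μ := envLaw p) (f := fun ω => f ω * g ω) (C := 1)
    (Filter.Eventually.of_forall fun ω => by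
      rw [Real.norm_eq_abs, abs_mul]; exact mul_le_one₀ (hf ω) (abs_nonneg _) (hg ω))
  simpa using this

/-- A family of functions bounded by one is a Bessel family if each of them is orthogonal to all
but one, or two, of the functions. -/
theorem besselWith_of_card {κ : Type*} [DecidableEq κ] {f : κ → Env 2 → ℝ} {n : ℕ}
    (hm : ∀ k, Measurable (f k)) (hf : ∀ k ω, |f k ω| ≤ 1) (s : κ → Finset κ)
    (hs : ∀ k, (s k).card ≤ n)
    (h0 : ∀ k k', k' ∉ s k → inner ℝ (toL2 p (f k)) (toL2 p (f k')) = 0) :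
    BesselWith (fun k => toL2 p (f k)) n := by
  refine BesselWith.of_schur (by positivity) fun F k _ => ?_
  calc ∑ j ∈ F, |inner ℝ (toL2 p (f k)) (toL2 p (f j))|
      = ∑ j ∈ F.filter (· ∈ s k), |inner ℝ (toL2 p (f k)) (toL2 p (f j))| := by
        rw [Finset.sum_filter]
        refine Finset.sum_congr rfl fun j _ => ?_
        split_ifs with h
        · rfl
        · rw [h0 k j h, abs_zero]
    _ ≤ ∑ j ∈ F.filter (· ∈ s k), (1 : ℝ) := Finset.sum_le_sum fun j _ =>
        abs_inner_toL2_le_one (hm k) (hm j) (hf k) (hf j)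
    _ = ((F.filter (· ∈ s k)).card : ℝ) := by simp
    _ ≤ n := by
        have : F.filter (· ∈ s k) ⊆ s k := fun j hj => (Finset.mem_filter.1 hj).2
        exact_mod_cast (Finset.card_le_card this).trans (hs k)

theorem inner_arrowFn_eq_zero (i : Fin 2) {x y : Option (Site 2)} (h : y ≠ x) :
    inner ℝ (toL2 p (arrowFn i x)) (toL2 p (arrowFn i y)) = 0 := by
  rw [inner_toL2 (memLp_arrowFn i x) (memLp_arrowFn i y)]
  refine integral_eq_zero_of_flipAt x (measurable_arrowFn_mul i x y) fun ω => ?_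
  rw [arrowFn_flipAt_self, arrowFn_flipAt_of_ne i h, neg_mul]

theorem isArrowFamily (i : Fin 2) :
    (envOps p).IsArrowFamily fun x => toL2 p (arrowFn i x) where
  bessel := by
    classical
    have := besselWith_of_card (p := p) (n := 1) (measurable_arrowFn i) (abs_arrowFn_le_one i)
      (fun x => {x}) (fun x => by simp)
      fun x y h => inner_arrowFn_eq_zero i (by simpa using h)
    simpa using this
  σ_none := by
    simp only [envOps]
    rw [pull_toL2 _ (memLp_arrowFn i none)]
    rfl
  τ_some k x := by
    simp only [envOps]
    rw [pull_toL2 _ (memLp_arrowFn i _)]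
    rfl

theorem ae_hand_fst_eq {i : Fin 2} (hi : ∀ k, k ≠ i → p k = 0) :
    ∀ᵐ ω ∂envLaw p, (ω none).1 = i := by
  have h1 := measurePreserving_eval_infinitePi (fun _ : Option (Site 2) => arrowLaw p) none
  have h2 : ∀ᵐ a ∂arrowLaw p, a.1 = i := by
    rw [ae_iff, arrowLaw]
    simp only [Measure.coe_finsetSum, Finset.sum_apply, Measure.smul_apply, smul_eq_mul]
    refine Finset.sum_eq_zero fun a _ => ?_
    by_cases ha : a.1 = i
    · rw [Measure.dirac_apply' _ (Set.to_countable _).measurableSet]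
      simp [ha]
    · simp [hi _ ha]
  exact h1.quasiMeasurePreserving.ae h2

/-- When all the arrows point in the directions `±e_i`, products of two arrows satisfy the relations
of a pair family. -/
theorem isPairFamily {i : Fin 2} (hi : ∀ k, k ≠ i → p k = 0) :
    (envOps p).IsPairFamily (fun x => toL2 p (arrowFn i x)) i
      (pull shiftHandInv measurePreserving_shiftHandInv).toLinearMap
      (fun y => toL2 p fun ω => arrowFn i none ω * arrowFn i (some y) ω)
      (fun y x => toL2 p fun ω => arrowFn i (some x) ω * arrowFn i (some (x + y)) ω) where
  inner_none_none := by
    rw [inner_toL2 (memLp_arrowFn i none) (memLp_arrowFn i none)]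
    have : ∀ᵐ ω ∂envLaw p, arrowFn i none ω * arrowFn i none ω = 1 := by
      filter_upwards [ae_hand_fst_eq hi] with ω hω
      unfold arrowFn
      generalize ω none = a at hω ⊢
      obtain ⟨k, b⟩ := a
      obtain rfl : k = i := hω
      cases b <;> simp [Dir.vec]
    rw [integral_congr_ae this]
    simp
  inner_none_some x := inner_arrowFn_eq_zero i (by simp)
  σ_some x hx := by
    simp only [envOps]
    rw [pull_toL2 _ (memLp_arrowFn i _)]
    congr 1
    funext ω
    simp [arrowFn, swap, hx]
  τ_none k := by
    simp only [envOps]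
    rw [pull_toL2 _ (memLp_arrowFn i _)]
    rfl
  adjoint u v := by
    have : (envOps p).ρ (pull shiftHandInv measurePreserving_shiftHandInv v) = v := by
      simp only [envOps]
      rw [pull_pull _ _ (MeasurePreserving.id _) (h := id) shiftHandInv_shiftHand]
      exact pull_id _ (fun _ => rfl) v
    conv_lhs => rw [← this]
    exact (envOps p).ρ.inner_map_map _ _
  ρ'_none := by
    change pull shiftHandInv _ _ = _
    rw [pull_toL2 _ (memLp_arrowFn i _)]
    rfl
  ρ'_some x := by
    change pull shiftHandInv _ _ = _
    set e : Site 2 := Dir.vec (i, true) with he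
    have m1 : MemLp (fun ω => arrowFn i (some (x + e)) ω + arrowFn i (some (x - e)) ω) 2
        (envLaw p) := (memLp_arrowFn i _).add (memLp_arrowFn i _)
    have m2 : MemLp (fun ω => arrowFn i none ω * arrowFn i (some (x - e)) ω
        - arrowFn i none ω * arrowFn i (some (x + e)) ω) 2 (envLaw p) :=
      (memLp_arrowFn_mul i _ _).sub (memLp_arrowFn_mul i _ _)
    rw [pull_toL2 _ (memLp_arrowFn i _), ← toL2_add (memLp_arrowFn i _) (memLp_arrowFn i _),
      ← toL2_sub (memLp_arrowFn_mul i _ _) (memLp_arrowFn_mul i _ _), ← toL2_smul _ m1,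
      ← toL2_smul _ m2, ← toL2_add (m1.const_mul _) (m2.const_mul _)]
    refine toL2_congr ((memLp_arrowFn i _).comp_measurePreserving measurePreserving_shiftHandInv)
      ((m1.const_mul _).add (m2.const_mul _)) ?_
    -- Almost surely the hand arrow is `η e` with `η = ±1`, and a function of `η` is the sum of its
    -- even part and `η` times its odd part. Applied to the arrow at `x - η e`, this is the
    -- identity.
    filter_upwards [ae_hand_fst_eq hi] with ω hω
    have h1 : arrowFn i (some x) (shiftHandInv ω)
        = arrowFn i (some (x - (ω none).vec)) ω := by
      simp [arrowFn, shiftHandInv, shift, Dir.vec_opp, sub_eq_add_neg]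
    have h2 : arrowFn i none ω = ((ω none).vec i : ℤ) := rfl
    rw [h1, h2]
    generalize ω none = a at hω ⊢
    obtain ⟨k, b⟩ := a
    obtain rfl : k = i := hω
    cases b
    · have : Dir.vec (k, false) = -e := by simp [he, Dir.vec]
      rw [this]
      simp [he, Dir.vec]
      ring
    · rw [← he]
      simp [he, Dir.vec]
      ring
  P_bessel := by
    classical
    have := besselWith_of_card (p := p) (n := 1)
      (f := fun y ω => arrowFn i none ω * arrowFn i (some y) ω)
      (fun y => measurable_arrowFn_mul i _ _) (fun y => abs_arrowFn_mul_le_one i _ _)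
      (fun x => {x}) (fun x => by simp) ?_
    · simpa using this
    intro x y h
    rw [inner_toL2 (memLp_arrowFn_mul i _ _) (memLp_arrowFn_mul i _ _)]
    have hxy : some y ≠ some x := by simpa using h
    refine integral_eq_zero_of_flipAt (some x)
      ((measurable_arrowFn_mul i _ _).mul (measurable_arrowFn_mul i _ _)) fun ω => ?_
    rw [arrowFn_flipAt_self, arrowFn_flipAt_of_ne i hxy, arrowFn_flipAt_of_ne i (by simp)]
    ring
  σ_P y hy := by
    simp only [envOps]
    rw [pull_toL2 _ (memLp_arrowFn_mul i _ _)]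
    congr 1
    funext ω
    simp [arrowFn, swap, hy]
  P₂_bessel := by
    classical
    refine besselWith_of_card (p := p) (n := 2) (κ := {y : Site 2 // y ≠ 0} × Site 2)
      (f := fun q ω => arrowFn i (some q.2) ω * arrowFn i (some (q.2 + q.1)) ω)
      (fun q => measurable_arrowFn_mul i _ _) (fun q => abs_arrowFn_mul_le_one i _ _)
      -- An unordered pair of sites is labelled exactly twice, by `(y, x)` and `(-y, x + y)`, whence
      -- the Bessel constant 2.
      (fun q => {q, (⟨-q.1, neg_ne_zero.2 q.1.2⟩, q.2 + q.1)}) (fun q => Finset.card_le_two) ?_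
    rintro ⟨⟨y, hy⟩, x⟩ ⟨⟨y', hy'⟩, x'⟩ h
    rw [inner_toL2 (memLp_arrowFn_mul i _ _) (memLp_arrowFn_mul i _ _)]
    have hm := (measurable_arrowFn_mul i (some x) (some (x + y))).mul
      (measurable_arrowFn_mul i (some x') (some (x' + y')))
    simp only [Finset.mem_insert, Finset.mem_singleton, Prod.mk.injEq, Subtype.mk.injEq,
      not_or, not_and] at h
    -- If the two pairs of sites differ, `x` or `x + y` is absent from the second pair. The product
    -- is odd in the arrow there.
    by_cases h1 : x = x' ∨ x = x' + y'
    · by_cases h2 : x + y = x' ∨ x + y = x' + y'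
      · exfalso
        rcases h1 with rfl | rfl
        · rcases h2 with h2 | h2
          · exact hy (by simpa using h2)
          · exact h.1 (add_left_cancel h2).symm rfl
        · rcases h2 with h2 | h2
          · refine h.2 ?_ h2.symm
            rw [add_assoc] at h2
            exact eq_neg_of_add_eq_zero_left (by simpa using h2)
          · exact hy (by simpa using h2)
      · push Not at h2
        refine integral_eq_zero_of_flipAt (some (x + y)) hm fun ω => ?_
        rw [arrowFn_flipAt_self, arrowFn_flipAt_of_ne i (y := some x) (by simpa using hy),
          arrowFn_flipAt_of_ne i (y := some x') (by simpa using h2.1.symm),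
          arrowFn_flipAt_of_ne i (y := some (x' + y')) (by simpa using h2.2.symm)]
        ring
    · push Not at h1
      refine integral_eq_zero_of_flipAt (some x) hm fun ω => ?_
      rw [arrowFn_flipAt_self, arrowFn_flipAt_of_ne i (y := some (x + y)) (by simpa using hy),
        arrowFn_flipAt_of_ne i (y := some x') (by simpa using h1.1.symm),
        arrowFn_flipAt_of_ne i (y := some (x' + y')) (by simpa using h1.2.symm)]
      ring
  τ_P₂ k y x := by
    simp only [envOps]
    rw [pull_toL2 _ (memLp_arrowFn_mul i _ _)]
    congr 1
    funext ω
    simp [arrowFn, shift, add_right_comm]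

end StoredMomentum

namespace StoredMomentum

open MeasureTheory ProbabilityTheory

/-! ### The embedded Markov chain -/

/-- The effect of a jump on the environment and the position. -/
def stepState (m : Jump 2) (z : Env 2 × Site 2) : Env 2 × Site 2 :=
  (jumpEnv m z.1, z.2 + (stepDir m z.1).vec)

/-- The environment and the position after `n` jumps. -/
def chainState (z : Env 2 × Site 2) (m : ℕ → Jump 2) : ℕ → Env 2 × Site 2
  | 0 => z
  | n + 1 => stepState (m n) (chainState z m n)

theorem chainState_eq (s : Sample 2) (n : ℕ) :
    chainState (s.1, 0) s.2.1 n = (chainEnv s n, chainPos s n) := by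
  induction n with
  | zero => rfl
  | succ n ih => simp [chainState, ih, stepState, chainEnv, chainPos]

theorem chainState_congr (z : Env 2 × Site 2) {m m' : ℕ → Jump 2} {n : ℕ}
    (h : ∀ k < n, m k = m' k) : chainState z m n = chainState z m' n := by
  induction n with
  | zero => rfl
  | succ n ih =>
    rw [chainState, chainState, ih fun k hk => h k (hk.trans (Nat.lt_succ_self n)),
      h n (Nat.lt_succ_self n)]

theorem measurable_jumpEnv (m : Jump 2) : Measurable (jumpEnv m) := by
  have hs : ∀ b, Measurable (swapIf (d := 2) b) := by
    rintro (_ | _)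
    · exact measurable_id
    · exact measurable_swap
  obtain ⟨_ | e, b, b'⟩ := m
  · rw [jumpEnv_none]
    exact (hs b').comp ((measurable_of_hand shift measurable_shift fun _ => rfl).comp (hs b))
  · rw [jumpEnv_some]
    exact (hs b').comp ((measurable_shift e).comp (hs b))

theorem measurable_stepDir (m : Jump 2) : Measurable (stepDir m) := by
  obtain ⟨_ | e, b, b'⟩ := m
  · cases b
    · exact measurable_pi_apply none
    · exact (measurable_pi_apply none).comp measurable_swap
  · exact measurable_const

theorem measurable_stepState (m : Jump 2) : Measurable (stepState m) := by
  refine ((measurable_jumpEnv m).comp measurable_fst).prodMk ?_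
  exact measurable_snd.add
    ((measurable_of_countable Dir.vec).comp ((measurable_stepDir m).comp measurable_fst))

theorem measurable_chainState (n : ℕ) :
    Measurable fun q : (Env 2 × Site 2) × (ℕ → Jump 2) => chainState q.1 q.2 n := by
  induction n with
  | zero => exact measurable_fst
  | succ n ih =>
    have h : Measurable fun q : Jump 2 × (Env 2 × Site 2) => stepState q.1 q.2 :=
      measurable_from_prod_countable_right measurable_stepState
    exact h.comp (((measurable_pi_apply n).comp measurable_snd).prodMk ih)

theorem abs_chainState_le (z : Env 2 × Site 2) (m : ℕ → Jump 2) (i : Fin 2) (n : ℕ) :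
    |((chainState z m n).2 i : ℝ)| ≤ |(z.2 i : ℝ)| + n := by
  induction n with
  | zero => simp [chainState]
  | succ n ih =>
    simp only [chainState, stepState, Pi.add_apply]
    push_cast
    have := abs_vec_le_one (stepDir (m n) (chainState z m n).1) i
    have := abs_add_le ((chainState z m n).2 i : ℝ)
      (((stepDir (m n) (chainState z m n).1).vec i : ℤ) : ℝ)
    linarith

variable {M : Model} {ε : ℝ}

/-- The probability of a jump. -/
noncomputable def jumpProb (M : Model) (ε : ℝ) (m : Jump 2) : ℝ := rate M ε m / (1 + ε)

theorem jumpProb_nonneg (hε : 0 < ε) (m : Jump 2) : 0 ≤ jumpProb M ε m := by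
  unfold jumpProb
  obtain ⟨_ | e, b⟩ := m
  · cases M
    · simp only [rate]; split_ifs <;> positivity
    · simp only [rate]; positivity
  · simp only [rate]; positivity

theorem sum_jumpProb (hε : 0 < ε) : ∑ m, jumpProb M ε m = 1 := by
  simp only [jumpProb]
  rw [← Finset.sum_div, sum_rate two_ne_zero, div_self (by positivity)]

/-- The transition operator of the embedded chain. -/
noncomputable def transition (M : Model) (ε : ℝ) (F : Env 2 × Site 2 → ℝ)
    (z : Env 2 × Site 2) : ℝ :=
  ∑ m, jumpProb M ε m * F (stepState m z)

theorem jumpLaw_real_singleton (hε : 0 < ε) (m : Jump 2) :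
    (jumpLaw M ε).real {m} = jumpProb M ε m := by
  rw [Measure.real, jumpLaw]
  simp only [Measure.coe_finsetSum, Finset.sum_apply, Measure.smul_apply, smul_eq_mul]
  rw [Finset.sum_eq_single m]
  · simp only [Measure.dirac_apply' _ (measurableSet_singleton m)]
    simp only [Set.mem_singleton_iff, Set.indicator_of_mem, Pi.one_apply, mul_one]
    exact ENNReal.toReal_ofReal (jumpProb_nonneg hε m)
  · intro m' _ h
    simp [Measure.dirac_apply' _ (measurableSet_singleton m), h]
  · simp

/-- Under a product measure on sequences in a finite set, the `n`-th term is independent of the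
previous ones. -/
theorem integral_eval_restrict {α : Type*} [Finite α] [MeasurableSpace α]
    [MeasurableSingletonClass α] [Fintype α] (μ : Measure α) [IsProbabilityMeasure μ] (n : ℕ)
    (G : α → (Finset.range n → α) → ℝ) :
    ∫ m, G (m n) (fun k => m k) ∂Measure.infinitePi (fun _ : ℕ => μ)
      = ∑ j, μ.real {j} * ∫ m, G j (fun k => m k) ∂Measure.infinitePi (fun _ : ℕ => μ) := by
  classical
  set κ := Measure.infinitePi (fun _ : ℕ => μ) with hκ
  -- Decompose by the value `j` of the `n`-th term: its indicator is independent of the earlier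
  -- terms. Finiteness of `α` makes every function bounded and measurable.
  have hind : ∀ j, IndepFun (fun m : ℕ → α => if m n = j then (1 : ℝ) else 0)
      (fun m => G j (fun k => m k)) κ := by
    intro j
    have h1 := (iIndepFun_infinitePi (P := fun _ : ℕ => μ)
      (X := fun _ x => x) (fun _ => measurable_id)).indepFun_finset {n} (Finset.range n)
      (by simp) (fun k => measurable_pi_apply k)
    exact h1.comp
      (φ := fun x : ({n} : Finset ℕ) → α => if x ⟨n, by simp⟩ = j then (1 : ℝ) else 0)
      (ψ := G j) (measurable_of_countable _) (measurable_of_countable _)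
  have hmeas : ∀ j, Measurable fun m : ℕ → α => G j (fun k => m k) := fun j =>
    (measurable_of_countable (G j)).comp (measurable_pi_lambda _ fun k => measurable_pi_apply _)
  have hmeas' : ∀ j, Measurable fun m : ℕ → α => if m n = j then (1 : ℝ) else 0 := fun j =>
    (measurable_of_countable fun x : α => if x = j then (1 : ℝ) else 0).comp
      (measurable_pi_apply n)
  have hbdd : ∀ j, ∃ C, ∀ x, ‖G j x‖ ≤ C := by
    intro j
    obtain ⟨C, hC⟩ := (Set.finite_range fun x => ‖G j x‖).bddAbove
    exact ⟨C, fun x => hC ⟨x, rfl⟩⟩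
  have hint : ∀ j, Integrable (fun m : ℕ → α => (if m n = j then (1 : ℝ) else 0)
      * G j (fun k => m k)) κ := by
    intro j
    obtain ⟨C, hC⟩ := hbdd j
    refine Integrable.of_bound ((hmeas' j).mul (hmeas j)).aestronglyMeasurable C
      (Filter.Eventually.of_forall fun m => ?_)
    split_ifs
    · simpa using hC _
    · simpa using (norm_nonneg _).trans (hC fun k => m k)
  have hprob : ∀ j, ∫ m, (if m n = j then (1 : ℝ) else 0) ∂κ = μ.real {j} := by
    intro j
    have h1 := (measurePreserving_eval_infinitePi (fun _ : ℕ => μ) n)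
    have h2 : ∫ m, (if m n = j then (1 : ℝ) else 0) ∂κ
        = ∫ x, (if x = j then (1 : ℝ) else 0) ∂μ := by
      rw [← h1.map_eq, integral_map h1.measurable.aemeasurable
        (measurable_of_countable _).aestronglyMeasurable]
    have h3 : (fun x => if x = j then (1 : ℝ) else 0) = Set.indicator {j} fun _ => (1 : ℝ) := by
      funext x; simp [Set.indicator_apply]
    rw [h2, h3, integral_indicator_const _ (measurableSet_singleton j)]
    simp
  calc ∫ m, G (m n) (fun k => m k) ∂κ
      = ∫ m, ∑ j, (if m n = j then (1 : ℝ) else 0) * G j (fun k => m k) ∂κ := by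
        congr 1; funext m; simp
    _ = ∑ j, ∫ m, (if m n = j then (1 : ℝ) else 0) * G j (fun k => m k) ∂κ :=
        integral_finsetSum _ fun j _ => hint j
    _ = _ := by
        refine Finset.sum_congr rfl fun j _ => ?_
        rw [← hprob j]
        exact (hind j).integral_fun_mul_eq_mul_integral (hmeas' j).aestronglyMeasurable
          (hmeas j).aestronglyMeasurable

/-- A sequence of jumps with the given initial terms. -/
def extendJumps (n : ℕ) (x : Finset.range n → Jump 2) (k : ℕ) : Jump 2 :=
  if hk : k ∈ Finset.range n then x ⟨k, hk⟩ else (none, false, false)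

theorem chainState_extendJumps (z : Env 2 × Site 2) (m : ℕ → Jump 2) (n : ℕ) :
    chainState z (extendJumps n fun k => m k) n = chainState z m n :=
  chainState_congr z fun k hk => by simp [extendJumps, hk]

/-- Conditioning on the first `n` jumps. For a fixed start they lead to finitely many states, so `F`
need not be measurable. -/
theorem integral_chainState_succ (hε : 0 < ε) (z : Env 2 × Site 2) (F : Env 2 × Site 2 → ℝ)
    (n : ℕ) :
    ∫ m, F (chainState z m (n + 1)) ∂Measure.infinitePi (fun _ : ℕ => jumpLaw (d := 2) M ε)
      = ∫ m, transition M ε F (chainState z m n)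
        ∂Measure.infinitePi (fun _ : ℕ => jumpLaw (d := 2) M ε) := by
  have := isProbabilityMeasure_jumpLaw (d := 2) two_ne_zero M hε
  have h := integral_eval_restrict (jumpLaw (d := 2) M ε) n
    fun j x => F (stepState j (chainState z (extendJumps n x) n))
  have h' := integral_eval_restrict (jumpLaw (d := 2) M ε) n
    fun _ x => transition M ε F (chainState z (extendJumps n x) n)
  have hint : ∀ j, Integrable (fun m => F (stepState j (chainState z m n)))
      (Measure.infinitePi (fun _ : ℕ => jumpLaw (d := 2) M ε)) := by
    intro j
    obtain ⟨C, hC⟩ := (Set.finite_range fun x =>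
      ‖F (stepState j (chainState z (extendJumps n x) n))‖).bddAbove
    rw [show (fun m => F (stepState j (chainState z m n)))
      = fun m => F (stepState j (chainState z (extendJumps n fun k => m k) n)) from
        funext fun m => by rw [chainState_extendJumps]]
    refine Integrable.of_bound (Measurable.aestronglyMeasurable ?_) C
      (Filter.Eventually.of_forall fun m => hC ⟨fun k => m k, rfl⟩)
    exact (measurable_of_countable
      fun x => F (stepState j (chainState z (extendJumps n x) n))).comp
      (measurable_pi_lambda _ fun k => measurable_pi_apply _)
  simp only [chainState_extendJumps] at h
  rw [show (fun m => F (chainState z m (n + 1)))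
    = fun m => F (stepState (m n) (chainState z m n)) from rfl, h]
  unfold transition
  rw [integral_finsetSum _ fun j _ => (hint j).const_mul _]
  simp only [integral_const_mul, jumpLaw_real_singleton hε]

theorem integral_chainState (hε : 0 < ε) (z : Env 2 × Site 2) (F : Env 2 × Site 2 → ℝ) (n : ℕ) :
    ∫ m, F (chainState z m n) ∂Measure.infinitePi (fun _ : ℕ => jumpLaw (d := 2) M ε)
      = (transition M ε)^[n] F z := by
  have := isProbabilityMeasure_jumpLaw (d := 2) two_ne_zero M hε
  induction n generalizing F with
  | zero => simp [chainState]
  | succ n ih => rw [integral_chainState_succ hε, ih, Function.iterate_succ_apply]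

/-! ### The mean square of a coordinate -/

/-- The mean of the square of the `i`-th coordinate of the walker after `n` jumps. -/
noncomputable def meanSqStep (M : Model) (ε : ℝ) (p : Fin 2 → ℝ) (i : Fin 2) (n : ℕ) : ℝ :=
  ∫ ω, (transition M ε)^[n] (fun z => (z.2 i : ℝ) ^ 2) (ω, 0) ∂envLaw p

/-- The transition operator on functions of the environment. -/
noncomputable def envTransition (M : Model) (ε : ℝ) (f : Env 2 → ℝ) (ω : Env 2) : ℝ :=
  ∑ m, jumpProb M ε m * f (jumpEnv m ω)

/-- The mean of a function of the environment after the next jump, weighted by the step. -/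
noncomputable def stepTransition (M : Model) (ε : ℝ) (i : Fin 2) (f : Env 2 → ℝ) (ω : Env 2) : ℝ :=
  ∑ m, jumpProb M ε m * (((stepDir m ω).vec i : ℤ) * f (jumpEnv m ω))

/-- The mean of the next step. -/
noncomputable def meanStep (M : Model) (ε : ℝ) (i : Fin 2) (ω : Env 2) : ℝ :=
  ∑ m, jumpProb M ε m * ((stepDir m ω).vec i : ℤ)

/-- The mean of the square of the next step. -/
noncomputable def meanStepSq (M : Model) (ε : ℝ) (i : Fin 2) (ω : Env 2) : ℝ :=
  ∑ m, jumpProb M ε m * (((stepDir m ω).vec i : ℤ) : ℝ) ^ 2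

/-- The direction of the last step, if the jump was `m`, in terms of the resulting environment. -/
def lastDir (m : Jump 2) (ω : Env 2) : Dir 2 :=
  match m.1 with
  | none => swapIf m.2.2 ω none
  | some e => e

/-- The mean of the last step, given the current environment. -/
noncomputable def meanLastStep (M : Model) (ε : ℝ) (i : Fin 2) (ω : Env 2) : ℝ :=
  ∑ m, jumpProb M ε m * ((lastDir m ω).vec i : ℤ)

/-- A shift leaves the arrow just used in the hand, so undoing the final swap recovers the step from
the new environment. This permits time reversal. -/
theorem lastDir_jumpEnv (m : Jump 2) (ω : Env 2) : lastDir m (jumpEnv m ω) = stepDir m ω := by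
  obtain ⟨_ | e, b, b'⟩ := m
  · cases b'
    · rfl
    · simp only [lastDir, jumpEnv, swapIf, if_true, swap_swap]
      rfl
  · rfl

/-- The coefficients of the quadratic polynomials `x² + g x + h` to which the iterates of the
transition operator map `x²`. -/
noncomputable def sqCoeff (M : Model) (ε : ℝ) (i : Fin 2) : ℕ → (Env 2 → ℝ) × (Env 2 → ℝ)
  | 0 => (0, 0)
  | n + 1 =>
    (fun ω => 2 * meanStep M ε i ω + envTransition M ε (sqCoeff M ε i n).1 ω,
      fun ω => meanStepSq M ε i ω + stepTransition M ε i (sqCoeff M ε i n).1 ω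
        + envTransition M ε (sqCoeff M ε i n).2 ω)

/-- Jumps do not depend on the position, so this class of polynomials is stable: the cross term `2 x
· step` feeds `g`, while `step²` and `step · g` feed `h`. -/
theorem transition_iterate_sq (hε : 0 < ε) (i : Fin 2) (n : ℕ) (z : Env 2 × Site 2) :
    (transition M ε)^[n] (fun z => (z.2 i : ℝ) ^ 2) z
      = (z.2 i : ℝ) ^ 2 + (z.2 i : ℝ) * (sqCoeff M ε i n).1 z.1 + (sqCoeff M ε i n).2 z.1 := by
  induction n generalizing z with
  | zero => simp [sqCoeff]
  | succ n ih =>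
    rw [Function.iterate_succ_apply', transition]
    simp only [ih, sqCoeff, meanStep, envTransition, meanStepSq, stepTransition, stepState,
      Pi.add_apply]
    have h1 : (z.2 i : ℝ) ^ 2 = ∑ m, jumpProb M ε m * (z.2 i : ℝ) ^ 2 := by
      rw [← Finset.sum_mul, sum_jumpProb hε, one_mul]
    rw [h1]
    simp only [Finset.mul_sum, mul_add, ← Finset.sum_add_distrib]
    refine Finset.sum_congr rfl fun m _ => ?_
    push_cast
    ring

/-- Bounded measurable functions of the environment. -/
def IsBddMeas (f : Env 2 → ℝ) : Prop := Measurable f ∧ ∃ C, ∀ ω, |f ω| ≤ C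

namespace IsBddMeas

variable {f g : Env 2 → ℝ}

theorem zero : IsBddMeas (0 : Env 2 → ℝ) := ⟨measurable_const, 0, fun _ => by simp⟩

theorem add (hf : IsBddMeas f) (hg : IsBddMeas g) : IsBddMeas fun ω => f ω + g ω := by
  obtain ⟨C, hC⟩ := hf.2
  obtain ⟨D, hD⟩ := hg.2
  exact ⟨hf.1.add hg.1, C + D, fun ω => (abs_add_le _ _).trans (add_le_add (hC ω) (hD ω))⟩

theorem mul (hf : IsBddMeas f) (hg : IsBddMeas g) : IsBddMeas fun ω => f ω * g ω := by
  obtain ⟨C, hC⟩ := hf.2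
  obtain ⟨D, hD⟩ := hg.2
  refine ⟨hf.1.mul hg.1, C * D, fun ω => ?_⟩
  rw [abs_mul]
  exact mul_le_mul (hC ω) (hD ω) (abs_nonneg _) ((abs_nonneg _).trans (hC ω))

theorem const_mul (c : ℝ) (hf : IsBddMeas f) : IsBddMeas fun ω => c * f ω :=
  mul ⟨measurable_const, |c|, fun _ => le_rfl⟩ hf

theorem sum {ι : Type*} {s : Finset ι} {f : ι → Env 2 → ℝ} (hf : ∀ i, IsBddMeas (f i)) :
    IsBddMeas fun ω => ∑ i ∈ s, f i ω := by
  classical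
  induction s using Finset.induction_on with
  | empty =>
    simp only [Finset.sum_empty]
    exact zero
  | insert i s hi ih => simpa only [Finset.sum_insert hi] using (hf i).add ih

theorem comp (hf : IsBddMeas f) {T : Env 2 → Env 2} (hT : Measurable T) :
    IsBddMeas fun ω => f (T ω) :=
  ⟨hf.1.comp hT, hf.2.imp fun _ hC ω => hC (T ω)⟩

variable {p : Fin 2 → ℝ} [IsProbabilityMeasure (arrowLaw p)]

theorem memLp (hf : IsBddMeas f) : MemLp f 2 (envLaw p) :=
  memLp_of_bounded hf.1 hf.2.choose_spec

theorem integrable (hf : IsBddMeas f) : Integrable f (envLaw p) := by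
  obtain ⟨C, hC⟩ := hf.2
  exact Integrable.of_bound hf.1.aestronglyMeasurable C (Filter.Eventually.of_forall hC)

end IsBddMeas

theorem isBddMeas_stepDir (m : Jump 2) (i : Fin 2) :
    IsBddMeas fun ω => (((stepDir m ω).vec i : ℤ) : ℝ) :=
  ⟨(measurable_of_countable fun a : Dir 2 => ((a.vec i : ℤ) : ℝ)).comp (measurable_stepDir m), 1,
    fun _ => abs_vec_le_one _ _⟩

theorem measurable_lastDir (m : Jump 2) : Measurable (lastDir m) := by
  obtain ⟨_ | e, b, b'⟩ := m
  · cases b'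
    · exact measurable_pi_apply none
    · exact (measurable_pi_apply none).comp measurable_swap
  · exact measurable_const

theorem isBddMeas_lastDir (m : Jump 2) (i : Fin 2) :
    IsBddMeas fun ω => (((lastDir m ω).vec i : ℤ) : ℝ) :=
  ⟨(measurable_of_countable fun a : Dir 2 => ((a.vec i : ℤ) : ℝ)).comp (measurable_lastDir m), 1,
    fun _ => abs_vec_le_one _ _⟩

theorem IsBddMeas.envTransition {f : Env 2 → ℝ} (hf : IsBddMeas f) :
    IsBddMeas (envTransition M ε f) :=
  IsBddMeas.sum fun m => (hf.comp (measurable_jumpEnv m)).const_mul _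

theorem IsBddMeas.stepTransition {f : Env 2 → ℝ} (hf : IsBddMeas f) (i : Fin 2) :
    IsBddMeas (stepTransition M ε i f) :=
  IsBddMeas.sum fun m => ((isBddMeas_stepDir m i).mul (hf.comp (measurable_jumpEnv m))).const_mul _

theorem isBddMeas_meanStep (i : Fin 2) : IsBddMeas (meanStep M ε i) :=
  IsBddMeas.sum fun m => (isBddMeas_stepDir m i).const_mul _

theorem isBddMeas_meanLastStep (i : Fin 2) : IsBddMeas (meanLastStep M ε i) :=
  IsBddMeas.sum fun m => (isBddMeas_lastDir m i).const_mul _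

theorem isBddMeas_meanStepSq (i : Fin 2) : IsBddMeas (meanStepSq M ε i) := by
  unfold meanStepSq
  simp only [sq]
  exact IsBddMeas.sum fun m => ((isBddMeas_stepDir m i).mul (isBddMeas_stepDir m i)).const_mul _

theorem isBddMeas_sqCoeff (i : Fin 2) (n : ℕ) :
    IsBddMeas (sqCoeff M ε i n).1 ∧ IsBddMeas (sqCoeff M ε i n).2 := by
  induction n with
  | zero => exact ⟨IsBddMeas.zero, IsBddMeas.zero⟩
  | succ n ih =>
    exact ⟨((isBddMeas_meanStep i).const_mul 2).add ih.1.envTransition,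
      ((isBddMeas_meanStepSq i).add (ih.1.stepTransition i)).add ih.2.envTransition⟩

variable {p : Fin 2 → ℝ}

/-- The walk starts at the origin, where only the constant coefficient is left. -/
theorem meanSqStep_eq (hε : 0 < ε) (i : Fin 2) (n : ℕ) :
    meanSqStep M ε p i n = ∫ ω, (sqCoeff M ε i n).2 ω ∂envLaw p := by
  unfold meanSqStep
  simp [transition_iterate_sq hε]

variable [IsProbabilityMeasure (arrowLaw p)]

theorem integral_comp_jumpEnv (m : Jump 2) {f : Env 2 → ℝ} (hf : IsBddMeas f) :
    ∫ ω, f (jumpEnv m ω) ∂envLaw p = ∫ ω, f ω ∂envLaw p := by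
  have hp := measurePreserving_jumpEnv (p := p) m
  rw [← integral_map hp.measurable.aemeasurable hf.1.aestronglyMeasurable, hp.map_eq]

/-- Stationarity of `π_p` for the embedded chain. -/
theorem integral_envTransition (hε : 0 < ε) {f : Env 2 → ℝ} (hf : IsBddMeas f) :
    ∫ ω, envTransition M ε f ω ∂envLaw p = ∫ ω, f ω ∂envLaw p := by
  unfold envTransition
  rw [integral_finsetSum _ fun m _ => ((hf.comp (measurable_jumpEnv m)).const_mul _).integrable]
  simp only [integral_const_mul, integral_comp_jumpEnv _ hf]
  rw [← Finset.sum_mul, sum_jumpProb hε, one_mul]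

/-- Change of variables along each jump map: the step becomes a function of the environment after
the jump, and the average over jumps produces the reversed drift. -/
theorem integral_stepTransition (i : Fin 2) {f : Env 2 → ℝ} (hf : IsBddMeas f) :
    ∫ ω, stepTransition M ε i f ω ∂envLaw p
      = inner ℝ (toL2 p (meanLastStep M ε i)) (toL2 p f) := by
  have h1 : ∀ m, ∫ ω, (((stepDir m ω).vec i : ℤ) : ℝ) * f (jumpEnv m ω) ∂envLaw p
      = ∫ ω, (((lastDir m ω).vec i : ℤ) : ℝ) * f ω ∂envLaw p := by
    intro m
    rw [← integral_comp_jumpEnv m ((isBddMeas_lastDir m i).mul hf)]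
    simp only [lastDir_jumpEnv]
  rw [inner_toL2 (isBddMeas_meanLastStep i).memLp hf.memLp]
  unfold stepTransition meanLastStep
  rw [integral_finsetSum _ fun m _ =>
    (((isBddMeas_stepDir m i).mul (hf.comp (measurable_jumpEnv m))).const_mul _).integrable]
  simp only [Finset.sum_mul, mul_assoc]
  rw [integral_finsetSum _ fun m _ => (((isBddMeas_lastDir m i).mul hf).const_mul _).integrable]
  simp only [integral_const_mul, h1]

variable (M ε p) in
/-- The transition operator on the Hilbert space. -/
noncomputable def transitionOp : L2 p →L[ℝ] L2 p :=
  ∑ m : Jump 2, jumpProb M ε m •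
    (pull (jumpEnv m) (measurePreserving_jumpEnv m)).toContinuousLinearMap

theorem transitionOp_apply (u : L2 p) : transitionOp M ε p u
    = ∑ m : Jump 2, jumpProb M ε m • pull (jumpEnv m) (measurePreserving_jumpEnv m) u := by
  simp [transitionOp]

theorem norm_transitionOp_apply_le (hε : 0 < ε) (u : L2 p) : ‖transitionOp M ε p u‖ ≤ ‖u‖ := by
  rw [transitionOp_apply]
  refine (norm_sum_le _ _).trans ?_
  simp only [norm_smul, LinearIsometry.norm_map, Real.norm_eq_abs,
    abs_of_nonneg (jumpProb_nonneg hε _)]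
  rw [← Finset.sum_mul, sum_jumpProb hε, one_mul]

theorem toL2_envTransition {f : Env 2 → ℝ} (hf : IsBddMeas f) :
    toL2 p (envTransition M ε f) = transitionOp M ε p (toL2 p f) := by
  unfold envTransition
  rw [toL2_sum _ fun m => ((hf.comp (measurable_jumpEnv m)).const_mul _).memLp, transitionOp_apply]
  refine Finset.sum_congr rfl fun m _ => ?_
  rw [toL2_smul _ (hf.comp (measurable_jumpEnv m)).memLp, pull_toL2 _ hf.memLp]

theorem sum_vec (i : Fin 2) : ∑ e : Dir 2, ((e.vec i : ℤ) : ℝ) = 0 := by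
  rw [Fintype.sum_prod_type]
  simp [Dir.vec]

/-- Elliptic jumps in opposite directions cancel, so only the hand step contributes; `(1 + ε)⁻¹`
normalises the rates. -/
theorem toL2_meanStep (i : Fin 2) :
    toL2 p (meanStep M ε i) = (1 + ε)⁻¹ • (envOps p).drift M (toL2 p (arrowFn i none)) := by
  have h : meanStep M ε i = fun ω => (1 + ε)⁻¹ * match M with
      | .M1 => arrowFn i none ω
      | .M2 => 1 / 2 * (arrowFn i none ω + arrowFn i none (swap ω)) := by
    funext ω
    have hs := sum_vec i
    simp only [meanStep, jumpProb, Fintype.sum_prod_type (α₁ := Option (Dir 2)),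
      Fintype.sum_option, stepDir, rate, div_mul_eq_mul_div, ← Finset.sum_div, ← Finset.mul_sum]
    simp only [Finset.sum_const, ← Finset.smul_sum, hs]
    cases M
    · simp [swapIf, arrowFn, div_eq_inv_mul]
    · simp [Fintype.sum_prod_type, swapIf, arrowFn]
      ring
  have m1 := memLp_arrowFn (p := p) i none
  have m2 : MemLp (fun ω => arrowFn i none (swap ω)) 2 (envLaw p) :=
    m1.comp_measurePreserving measurePreserving_swap
  rw [h]
  cases M
  · exact toL2_smul _ m1
  · change toL2 p (fun ω => (1 + ε)⁻¹ * (1 / 2 * (arrowFn i none ω + arrowFn i none (swap ω)))) = _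
    have m3 : MemLp (fun ω => arrowFn i none ω + arrowFn i none (swap ω)) 2 (envLaw p) := m1.add m2
    rw [toL2_smul _ (m3.const_mul _), toL2_smul _ m3, toL2_add m1 m2,
      ← pull_toL2 measurePreserving_swap m1]
    rfl

/-- In `M1` the swap follows the step, so the arrow just used lies at the origin. -/
theorem toL2_meanLastStep (i : Fin 2) :
    toL2 p (meanLastStep M ε i)
      = (1 + ε)⁻¹ • (envOps p).revDrift M (toL2 p (arrowFn i none)) := by
  have h : meanLastStep M ε i = fun ω => (1 + ε)⁻¹ * match M with
      | .M1 => arrowFn i none (swap ω)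
      | .M2 => 1 / 2 * (arrowFn i none ω + arrowFn i none (swap ω)) := by
    funext ω
    have hs := sum_vec i
    simp only [meanLastStep, jumpProb, Fintype.sum_prod_type (α₁ := Option (Dir 2)),
      Fintype.sum_option, lastDir, rate, div_mul_eq_mul_div, ← Finset.sum_div, ← Finset.mul_sum]
    simp only [Finset.sum_const, ← Finset.smul_sum, hs]
    cases M
    · simp [swapIf, arrowFn, div_eq_inv_mul]
    · simp [Fintype.sum_prod_type, swapIf, arrowFn]
      ring
  have m1 := memLp_arrowFn (p := p) i none
  have m2 : MemLp (fun ω => arrowFn i none (swap ω)) 2 (envLaw p) :=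
    m1.comp_measurePreserving measurePreserving_swap
  rw [h]
  cases M
  · rw [toL2_smul _ m2, ← pull_toL2 measurePreserving_swap m1]
    rfl
  · change toL2 p (fun ω => (1 + ε)⁻¹ * (1 / 2 * (arrowFn i none ω + arrowFn i none (swap ω)))) = _
    have m3 : MemLp (fun ω => arrowFn i none ω + arrowFn i none (swap ω)) 2 (envLaw p) := m1.add m2
    rw [toL2_smul _ (m3.const_mul _), toL2_smul _ m3, toL2_add m1 m2,
      ← pull_toL2 measurePreserving_swap m1]
    rfl

/-! ### Generating functions -/

/-- The generating function of the mean squares, in terms of the resolvent. -/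
theorem exists_hasSum_of_recurrence {H : Type*} [NormedAddCommGroup H] [InnerProductSpace ℝ H]
    [CompleteSpace H] (A : H →L[ℝ] H) (hA : ∀ x, ‖A x‖ ≤ ‖x‖) (a b : H) (w : ℝ) (g : ℕ → H)
    (e : ℕ → ℝ) (hg0 : g 0 = 0) (hg : ∀ n, g (n + 1) = (2 : ℝ) • a + A (g n)) (he0 : e 0 = 0)
    (he : ∀ n, e (n + 1) = e n + w + inner ℝ b (g n)) {r : ℝ} (hr0 : 0 < r) (hr1 : r < 1) :
    ∃ v : H, v - r • A v = a ∧
      HasSum (fun n => r ^ n * e n) (r * (w + 2 * r * inner ℝ b v) / (1 - r) ^ 2) := by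
  have hr1' : 0 < 1 - r := by linarith
  -- Crude linear growth of `g`, and below quadratic growth of `e`, make the generating functions
  -- converge for `r < 1`.
  have hgn : ∀ n, ‖g n‖ ≤ n * (2 * ‖a‖) := by
    intro n
    induction n with
    | zero => simp [hg0]
    | succ n ih =>
      rw [hg]
      refine (norm_add_le _ _).trans ?_
      rw [norm_smul]
      have := hA (g n)
      push_cast
      norm_num
      linarith
  have hen : ∀ n, |e n| ≤ n ^ 2 * (|w| + 2 * ‖b‖ * ‖a‖) := by
    intro n
    induction n with
    | zero => simp [he0]
    | succ n ih =>
      rw [he]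
      have h1 := abs_real_inner_le_norm b (g n)
      have h2 : ‖b‖ * ‖g n‖ ≤ ‖b‖ * (n * (2 * ‖a‖)) := by gcongr; exact hgn n
      have h3 := abs_add_le (e n + w) (inner ℝ b (g n))
      have h4 := abs_add_le (e n) w
      have h5 : 0 ≤ |w| := abs_nonneg w
      have h6 : 0 ≤ ‖b‖ * ‖a‖ := by positivity
      have h7 : (0 : ℝ) ≤ n := by positivity
      push_cast
      nlinarith [mul_nonneg h7 h5, mul_nonneg h7 h6]
  have hrn : ‖r‖ < 1 := by rw [Real.norm_eq_abs, abs_of_pos hr0]; exact hr1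
  have hsg : Summable fun n => r ^ n • g n := by
    refine Summable.of_norm_bounded
      ((summable_pow_mul_geometric_of_norm_lt_one 1 hrn).mul_right (2 * ‖a‖)) fun n => ?_
    rw [norm_smul, norm_pow, Real.norm_eq_abs, abs_of_pos hr0]
    calc r ^ n * ‖g n‖ ≤ r ^ n * (n * (2 * ‖a‖)) := by gcongr; exact hgn n
      _ = _ := by ring
  have hse : Summable fun n => r ^ n * e n := by
    refine Summable.of_norm_bounded
      ((summable_pow_mul_geometric_of_norm_lt_one 2 hrn).mul_right (|w| + 2 * ‖b‖ * ‖a‖))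
      fun n => ?_
    rw [norm_mul, norm_pow, Real.norm_eq_abs, Real.norm_eq_abs, abs_of_pos hr0]
    calc r ^ n * |e n| ≤ r ^ n * (n ^ 2 * (|w| + 2 * ‖b‖ * ‖a‖)) := by gcongr; exact hen n
      _ = _ := by ring
  have hgeo := hasSum_geometric_of_lt_one hr0.le hr1
  set G := ∑' n, r ^ n • g n with hG
  have hGsum : HasSum (fun n => r ^ n • g n) G := hsg.hasSum
  have hG1 : G = r • ((2 * (1 - r)⁻¹) • a + A G) := by
    have h1 : HasSum (fun n => r ^ (n + 1) • g (n + 1)) (r • ((2 * (1 - r)⁻¹) • a + A G)) := by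
      have h2 := (((hgeo.mul_left 2).smul_const a).add (hGsum.mapL A)).const_smul r
      refine h2.congr_fun ?_
      intro n
      rw [hg, map_smul]
      module
    have h3 := (hasSum_nat_add_iff (f := fun n => r ^ n • g n) 1).1 h1
    simp only [Finset.range_one, Finset.sum_singleton, hg0, smul_zero, add_zero] at h3
    exact hGsum.unique h3
  set E := ∑' n, r ^ n * e n with hE
  have hEsum : HasSum (fun n => r ^ n * e n) E := hse.hasSum
  have hE1 : E = r * (E + w * (1 - r)⁻¹ + inner ℝ b G) := by
    have h1 : HasSum (fun n => r ^ (n + 1) * e (n + 1))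
        (r * (E + w * (1 - r)⁻¹ + inner ℝ b G)) := by
      have h2 := ((hEsum.add (hgeo.mul_left w)).add
        (hGsum.mapL (innerSL ℝ b))).mul_left r
      refine h2.congr_fun ?_
      intro n
      rw [he]
      simp only [innerSL_apply_apply, real_inner_smul_right]
      ring
    have h3 := (hasSum_nat_add_iff (f := fun n => r ^ n * e n) 1).1 h1
    simp only [Finset.range_one, Finset.sum_singleton, he0, mul_zero, add_zero] at h3
    exact hEsum.unique h3
  -- The recurrence gives `(1 - r A) G = (2 r / (1 - r)) a`; `v` rescales the generating function
  -- `G` accordingly.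
  refine ⟨((1 - r) / (2 * r)) • G, ?_, ?_⟩
  · rw [map_smul]
    have h1 : G - r • A G = (r * (2 * (1 - r)⁻¹)) • a := by
      nth_rw 1 [hG1]
      module
    calc ((1 - r) / (2 * r)) • G - r • ((1 - r) / (2 * r)) • A G
        = ((1 - r) / (2 * r)) • (G - r • A G) := by module
      _ = a := by
        rw [h1, smul_smul]
        have : (1 - r) / (2 * r) * (r * (2 * (1 - r)⁻¹)) = 1 := by field_simp
        rw [this, one_smul]
  · convert hEsum using 1
    rw [real_inner_smul_right]
    have : E * (1 - r) = r * (w * (1 - r)⁻¹ + inner ℝ b G) := by linarith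
    rw [div_eq_iff (by positivity)]
    rw [show E * (1 - r) ^ 2 = (E * (1 - r)) * (1 - r) by ring, this]
    field_simp

theorem resolventOp_eq_transitionOp (hε : 0 < ε) (l : ℝ) (u : L2 p) :
    (envOps p).resolventOp M ε l u = (l + (1 + ε)) • u - (1 + ε) • transitionOp M ε p u := by
  rw [resolventOp_eq, transitionOp_apply, Finset.smul_sum]
  congr 1
  refine Finset.sum_congr rfl fun m _ => ?_
  rw [smul_smul, jumpProb, mul_div_cancel₀ _ (by positivity)]

theorem integral_meanStepSq_mem (hε : 0 < ε) (i : Fin 2) :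
    0 ≤ ∫ ω, meanStepSq M ε i ω ∂envLaw p ∧ ∫ ω, meanStepSq M ε i ω ∂envLaw p ≤ 1 := by
  have h0 : ∀ ω, 0 ≤ meanStepSq M ε i ω := fun ω =>
    Finset.sum_nonneg fun m _ => mul_nonneg (jumpProb_nonneg hε m) (sq_nonneg _)
  refine ⟨integral_nonneg h0, ?_⟩
  have h1 : ∀ ω, meanStepSq M ε i ω ≤ 1 := by
    intro ω
    rw [← sum_jumpProb (M := M) hε]
    refine Finset.sum_le_sum fun m _ => mul_le_of_le_one_right (jumpProb_nonneg hε m) ?_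
    rw [sq_le_one_iff_abs_le_one]
    exact abs_vec_le_one _ _
  calc ∫ ω, meanStepSq M ε i ω ∂envLaw p ≤ ∫ _, (1 : ℝ) ∂envLaw p :=
        integral_mono (isBddMeas_meanStepSq i).integrable (integrable_const _) h1
    _ = 1 := by simp

theorem meanSqStep_succ (hε : 0 < ε) (i : Fin 2) (n : ℕ) :
    meanSqStep M ε p i (n + 1) = meanSqStep M ε p i n + ∫ ω, meanStepSq M ε i ω ∂envLaw p
      + inner ℝ (toL2 p (meanLastStep M ε i)) (toL2 p (sqCoeff M ε i n).1) := by
  obtain ⟨h1, h2⟩ := isBddMeas_sqCoeff (M := M) (ε := ε) i n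
  rw [meanSqStep_eq hε, meanSqStep_eq hε, ← integral_stepTransition i h1,
    ← integral_envTransition (M := M) hε h2]
  simp only [sqCoeff]
  rw [integral_add ((isBddMeas_meanStepSq i).add (h1.stepTransition i)).integrable
    h2.envTransition.integrable,
    integral_add (isBddMeas_meanStepSq i).integrable (h1.stepTransition i).integrable]
  ring

/-- The generating function of the mean squares of a coordinate of the walker after `n` jumps, in
terms of the resolvent of the generator. -/
theorem exists_hasSum_meanSqStep (hε : 0 < ε) (M : Model) (i : Fin 2) {l : ℝ} (hl : 0 < l) :
    ∃ u : L2 p, (envOps p).resolventOp M ε l u = (envOps p).drift M (toL2 p (arrowFn i none)) ∧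
      HasSum (fun n => ((1 + ε) / (1 + ε + l)) ^ n * meanSqStep M ε p i n)
        ((1 + ε + l) * ((1 + ε) * ∫ ω, meanStepSq M ε i ω ∂envLaw p
          + 2 * inner ℝ ((envOps p).revDrift M (toL2 p (arrowFn i none))) u) / l ^ 2) := by
  have hΛ : 0 < 1 + ε := by linarith
  have hΛl : 0 < 1 + ε + l := by linarith
  have hg0 : toL2 p (sqCoeff M ε i 0).1 = 0 := by
    change toL2 p (0 : Env 2 → ℝ) = 0
    rw [toL2_eq IsBddMeas.zero.memLp]
    rfl
  have hg : ∀ n, toL2 p (sqCoeff M ε i (n + 1)).1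
      = (2 : ℝ) • toL2 p (meanStep M ε i) + transitionOp M ε p (toL2 p (sqCoeff M ε i n).1) := by
    intro n
    obtain ⟨h1, -⟩ := isBddMeas_sqCoeff (M := M) (ε := ε) i n
    simp only [sqCoeff]
    rw [toL2_add ((isBddMeas_meanStep i).const_mul 2).memLp h1.envTransition.memLp,
      toL2_smul _ (isBddMeas_meanStep i).memLp, toL2_envTransition h1]
  have he0 : meanSqStep M ε p i 0 = 0 := by
    rw [meanSqStep_eq hε]
    simp [sqCoeff]
  obtain ⟨v, hv, hsum⟩ := exists_hasSum_of_recurrence (transitionOp M ε p)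
    (norm_transitionOp_apply_le hε) (toL2 p (meanStep M ε i)) (toL2 p (meanLastStep M ε i))
    (∫ ω, meanStepSq M ε i ω ∂envLaw p) (fun n => toL2 p (sqCoeff M ε i n).1)
    (meanSqStep M ε p i) hg0 hg he0 (meanSqStep_succ hε i)
    -- This `r` is the Laplace transform at `l` of one waiting time. The resolvent solution is then
    -- `r • v`.
    (r := (1 + ε) / (1 + ε + l)) (by positivity) (by rw [div_lt_one hΛl]; linarith)
  refine ⟨((1 + ε) / (1 + ε + l)) • v, ?_, ?_⟩
  · have h1 : (envOps p).drift M (toL2 p (arrowFn i none)) = (1 + ε) • toL2 p (meanStep M ε i) := by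
      rw [toL2_meanStep, smul_smul, mul_inv_cancel₀ hΛ.ne', one_smul]
    rw [resolventOp_eq_transitionOp hε, h1, ← hv, map_smul, smul_sub, smul_smul, smul_smul]
    congr 2
    field_simp
    ring
  · convert hsum using 1
    rw [toL2_meanLastStep, real_inner_smul_left, real_inner_smul_right]
    have h1 : 1 - (1 + ε) / (1 + ε + l) = l / (1 + ε + l) := by field_simp; ring
    rw [h1]
    field_simp

end StoredMomentum

namespace StoredMomentum

open MeasureTheory ProbabilityTheory

/-! ### The Laplace transform of the exponential clock -/

/-- The time of the `n`-th jump, counting from `n = 1`, as a function of the waiting times. -/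
def clockTime (w : ℕ → ℝ) (n : ℕ) : ℝ := ∑ k ∈ Finset.range n, w k

theorem measurable_clockTime (n : ℕ) : Measurable fun w : ℕ → ℝ => clockTime w n :=
  Finset.measurable_sum _ fun k _ => measurable_pi_apply k

/-- Tilting the exponential density of rate `a` gives `a / (a + l)` times the density of rate `a +
l`. -/
theorem lintegral_exp_neg_expMeasure {a l : ℝ} (ha : 0 < a) (hl : 0 < l) :
    ∫⁻ x, ENNReal.ofReal (Real.exp (-(l * x))) ∂expMeasure a = ENNReal.ofReal (a / (a + l)) := by
  have hm : Measurable (exponentialPDF a) := (measurable_exponentialPDFReal a).ennreal_ofReal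
  have h1 : expMeasure a = volume.withDensity (exponentialPDF a) := rfl
  rw [h1, lintegral_withDensity_eq_lintegral_mul _ hm (by fun_prop)]
  have h2 : ∀ x, (exponentialPDF a * fun x => ENNReal.ofReal (Real.exp (-(l * x)))) x
      = ENNReal.ofReal (a / (a + l)) * exponentialPDF (a + l) x := by
    intro x
    rw [Pi.mul_apply, exponentialPDF_eq, exponentialPDF_eq]
    split_ifs with hx
    · rw [← ENNReal.ofReal_mul (by positivity), ← ENNReal.ofReal_mul (by positivity)]
      congr 1
      rw [mul_assoc, ← Real.exp_add, ← mul_assoc, div_mul_cancel₀ _ (by positivity)]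
      congr 2
      ring
    · simp
  have hm' : Measurable (exponentialPDF (a + l)) :=
    (measurable_exponentialPDFReal (a + l)).ennreal_ofReal
  rw [lintegral_congr h2, lintegral_const_mul _ hm', lintegral_exponentialPDF_eq_one (by linarith),
    mul_one]

theorem ae_nonneg_expMeasure (a : ℝ) : ∀ᵐ x ∂expMeasure a, 0 ≤ x := by
  have h1 : expMeasure a = volume.withDensity (exponentialPDF a) := rfl
  have hm : Measurable (exponentialPDF a) := (measurable_exponentialPDFReal a).ennreal_ofReal
  rw [h1, ae_withDensity_iff hm]
  refine Filter.Eventually.of_forall fun x hx => ?_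
  by_contra h
  exact hx (exponentialPDF_of_neg (not_le.1 h))

/-- The law of the waiting times. -/
noncomputable def clockLaw (a : ℝ) : Measure (ℕ → ℝ) := Measure.infinitePi fun _ => expMeasure a

theorem isProbabilityMeasure_clockLaw {a : ℝ} (ha : 0 < a) : IsProbabilityMeasure (clockLaw a) := by
  have := isProbabilityMeasure_expMeasure ha
  unfold clockLaw
  infer_instance

theorem ae_nonneg_clockLaw {a : ℝ} (ha : 0 < a) : ∀ᵐ w ∂clockLaw a, ∀ k, 0 ≤ w k := by
  have := isProbabilityMeasure_expMeasure ha
  rw [ae_all_iff]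
  intro k
  exact (measurePreserving_eval_infinitePi (fun _ : ℕ => expMeasure a) k).quasiMeasurePreserving.ae
    (ae_nonneg_expMeasure a)

theorem lintegral_exp_neg_clockTime {a l : ℝ} (ha : 0 < a) (hl : 0 < l) (n : ℕ) :
    ∫⁻ w, ENNReal.ofReal (Real.exp (-(l * clockTime w n))) ∂clockLaw a
      = ENNReal.ofReal ((a / (a + l)) ^ n) := by
  have := isProbabilityMeasure_expMeasure ha
  have := isProbabilityMeasure_clockLaw ha
  induction n with
  | zero => simp [clockTime]
  | succ n ih =>
    have h1 := (iIndepFun_infinitePi (P := fun _ : ℕ => expMeasure a)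
      (X := fun _ x => x) (fun _ => measurable_id)).indepFun_finset (Finset.range n) {n}
      (by simp) (fun k => measurable_pi_apply k)
    have h2 := h1.comp
      (φ := fun x : Finset.range n → ℝ => ENNReal.ofReal (Real.exp (-(l * ∑ k, x k))))
      (ψ := fun x : ({n} : Finset ℕ) → ℝ => ENNReal.ofReal (Real.exp (-(l * x ⟨n, by simp⟩))))
      (by fun_prop) (by fun_prop)
    have h3 := lintegral_mul_eq_lintegral_mul_lintegral_of_indepFun (by fun_prop) (by fun_prop) h2
    have e1 : ∀ w : ℕ → ℝ, ∑ k : Finset.range n, w k = clockTime w n := fun w =>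
      Finset.sum_coe_sort (Finset.range n) w
    have h4 : ∫⁻ w, ENNReal.ofReal (Real.exp (-(l * w n))) ∂clockLaw a
        = ENNReal.ofReal (a / (a + l)) := by
      have h5 := measurePreserving_eval_infinitePi (fun _ : ℕ => expMeasure a) n
      rw [← lintegral_exp_neg_expMeasure ha hl]
      exact h5.lintegral_comp (f := fun x => ENNReal.ofReal (Real.exp (-(l * x)))) (by fun_prop)
    calc ∫⁻ w, ENNReal.ofReal (Real.exp (-(l * clockTime w (n + 1)))) ∂clockLaw a
        = ∫⁻ w, ENNReal.ofReal (Real.exp (-(l * clockTime w n)))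
            * ENNReal.ofReal (Real.exp (-(l * w n))) ∂clockLaw a := by
          refine lintegral_congr fun w => ?_
          rw [← ENNReal.ofReal_mul (Real.exp_pos _).le, ← Real.exp_add, clockTime,
            Finset.sum_range_succ, ← clockTime]
          congr 2
          ring
      _ = (∫⁻ w, ENNReal.ofReal (Real.exp (-(l * clockTime w n))) ∂clockLaw a)
            * ∫⁻ w, ENNReal.ofReal (Real.exp (-(l * w n))) ∂clockLaw a := by
          simp only [← e1]
          exact h3
      _ = _ := by
          rw [ih, h4, ← ENNReal.ofReal_mul (by positivity), pow_succ]

/-- Non-explosion, by Markov's inequality for `exp (-clockTime)`. It makes the set of jumps up to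
`t` finite, so that `Set.ncard` in `jumpCount` is a true count and not the default 0. -/
theorem ae_exists_lt_clockTime {a : ℝ} (ha : 0 < a) (t : ℝ) :
    ∀ᵐ w ∂clockLaw a, ∃ n, t < clockTime w n := by
  have := isProbabilityMeasure_clockLaw ha
  rw [ae_iff]
  set c := ENNReal.ofReal (Real.exp (-(1 * t))) with hc
  have hc0 : c ≠ 0 := by simp [hc, Real.exp_pos]
  have hbound : ∀ n, clockLaw a {w | ¬ ∃ n, t < clockTime w n}
      ≤ ENNReal.ofReal ((a / (a + 1)) ^ n) / c := by
    intro n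
    rw [← lintegral_exp_neg_clockTime ha one_pos n]
    refine le_trans (measure_mono fun w hw => ?_) (meas_ge_le_lintegral_div (ε := c)
      (Measurable.aemeasurable ?_) hc0 ENNReal.ofReal_ne_top)
    · simp only [Set.mem_ofPred_eq, not_exists, not_lt] at hw ⊢
      refine ENNReal.ofReal_le_ofReal (Real.exp_le_exp.2 ?_)
      linarith [hw n]
    · have := measurable_clockTime n
      fun_prop
  have hlim : Filter.Tendsto (fun n : ℕ => ENNReal.ofReal ((a / (a + 1)) ^ n) / c) Filter.atTop
      (𝓝 0) := by
    have h1 : Filter.Tendsto (fun n : ℕ => (a / (a + 1)) ^ n) Filter.atTop (𝓝 0) :=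
      tendsto_pow_atTop_nhds_zero_of_lt_one (by positivity) (by
        rw [div_lt_one (by positivity)]; linarith)
    have h2 := ENNReal.Tendsto.div_const (ENNReal.tendsto_ofReal h1) (Or.inr hc0)
    simpa using h2
  exact le_antisymm (ge_of_tendsto' hlim hbound) (zero_le)

theorem clockTime_mono {w : ℕ → ℝ} (hw : ∀ k, 0 ≤ w k) : Monotone (clockTime w) :=
  monotone_nat_of_le_succ fun n => by
    rw [clockTime, clockTime, Finset.sum_range_succ]
    linarith [hw n]

/-- A function of the number of jumps, decomposed according to that number. -/
theorem apply_jumpCount_eq_tsum (s : Sample 2) {t : ℝ} (ht : 0 ≤ t) (hw : ∀ k, 0 ≤ s.2.2 k)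
    (ht' : ∃ n, t < clockTime s.2.2 n) (f : ℕ → ℝ≥0∞) :
    f (jumpCount s t) = ∑' n, f n
      * (Set.Ico (clockTime s.2.2 n) (clockTime s.2.2 (n + 1))).indicator 1 t := by
  classical
  have hmono := clockTime_mono hw
  -- The first clock time beyond `t` is not the zeroth, which is `0 ≤ t`; its predecessor `K` is the
  -- number of jumps.
  obtain ⟨K, hK⟩ : ∃ K, Nat.find ht' = K + 1 := by
    refine Nat.exists_eq_succ_of_ne_zero fun h => ?_
    have := Nat.find_spec ht'
    rw [h] at this
    simp only [clockTime, Finset.range_zero, Finset.sum_empty] at this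
    linarith
  have hspec : t < clockTime s.2.2 (K + 1) := hK ▸ Nat.find_spec ht'
  have hmin : ∀ n, n ≤ K → clockTime s.2.2 n ≤ t := fun n hn =>
    not_lt.1 (Nat.find_min ht' (by omega))
  have hiff : ∀ n, t < clockTime s.2.2 n ↔ K + 1 ≤ n := fun n =>
    ⟨fun h => by
      by_contra hn
      exact absurd (hmin n (by omega)) (not_le.2 h), fun h => hspec.trans_le (hmono h)⟩
  have hcount : jumpCount s t = K := by
    have : {n : ℕ | jumpTime s n ≤ t} = ↑(Finset.range K) := by
      ext n
      have e : jumpTime s n = clockTime s.2.2 (n + 1) := rfl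
      rw [Set.mem_ofPred_eq, e, ← not_lt, hiff, Finset.coe_range, Set.mem_Iio]
      omega
    rw [jumpCount, this, Set.ncard_coe_finset, Finset.card_range]
  rw [hcount, tsum_eq_single K]
  · rw [Set.indicator_of_mem (Set.mem_Ico.2 ⟨hmin K le_rfl, hspec⟩), Pi.one_apply, mul_one]
  · intro n hn
    rw [Set.indicator_of_notMem, mul_zero]
    rintro ⟨h1, h2⟩
    rw [hiff] at h2
    rw [← not_lt, hiff] at h1
    omega

theorem lintegral_Ico_exp_neg {l : ℝ} (hl : 0 < l) {a b : ℝ} (ha : 0 ≤ a) (hab : a ≤ b) :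
    ∫⁻ t in Set.Ioi (0 : ℝ), (Set.Ico a b).indicator 1 t * ENNReal.ofReal (Real.exp (-(l * t)))
      = ENNReal.ofReal (l⁻¹) * (ENNReal.ofReal (Real.exp (-(l * a)))
        - ENNReal.ofReal (Real.exp (-(l * b)))) := by
  have h1 : ∀ t : ℝ, (Set.Ico a b).indicator 1 t * ENNReal.ofReal (Real.exp (-(l * t)))
      = (Set.Ico a b).indicator (fun t => ENNReal.ofReal (Real.exp (-(l * t)))) t := by
    intro t
    by_cases h : t ∈ Set.Ico a b <;> simp [h]
  have h2 : ∫ t in a..b, Real.exp (-(l * t))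
      = l⁻¹ * (Real.exp (-(l * a)) - Real.exp (-(l * b))) := by
    have hd : ∀ x ∈ Set.uIcc a b,
        HasDerivAt (fun t => -l⁻¹ * Real.exp (-(l * t))) (Real.exp (-(l * x))) x := by
      intro x _
      have h3 : HasDerivAt (fun t : ℝ => -(l * t)) (-l) x := by
        simpa using (hasDerivAt_mul_const (x := x) l).fun_neg.congr_of_eventuallyEq
          (Filter.Eventually.of_forall fun t => by simp [mul_comm])
      have h4 := (h3.exp).const_mul (-l⁻¹)
      rwa [mul_left_comm, neg_mul_neg, inv_mul_cancel₀ hl.ne', mul_one] at h4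
    rw [intervalIntegral.integral_eq_sub_of_hasDerivAt hd
      (by apply Continuous.intervalIntegrable; fun_prop)]
    ring
  simp only [h1]
  rw [lintegral_indicator measurableSet_Ico, Measure.restrict_restrict measurableSet_Ico]
  have h5 : (Set.Ico a b ∩ Set.Ioi 0 : Set ℝ) =ᵐ[volume] Set.Ioc a b := by
    have h6 : Set.Ico a b ∩ Set.Ici 0 = Set.Ico a b :=
      Set.inter_eq_left.2 fun x hx => ha.trans hx.1
    have h7 : (Set.Ico a b ∩ Set.Ioi 0 : Set ℝ) =ᵐ[volume] (Set.Ico a b ∩ Set.Ici 0 : Set ℝ) :=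
      ae_eq_set_inter (Filter.EventuallyEq.refl _ _) Ioi_ae_eq_Ici
    rw [h6] at h7
    exact h7.trans Ico_ae_eq_Ioc
  rw [Measure.restrict_congr_set h5, ← ofReal_integral_eq_lintegral_ofReal
    (Continuous.integrableOn_Ioc (by fun_prop))
    (Filter.Eventually.of_forall fun _ => (Real.exp_pos _).le),
    ← intervalIntegral.integral_of_le hab, h2, ENNReal.ofReal_mul (by positivity),
    ENNReal.ofReal_sub _ (Real.exp_pos _).le]

/-- The mean of the Laplace transform of the time spent between two successive jumps. -/
theorem lintegral_clock {a l : ℝ} (ha : 0 < a) (hl : 0 < l) (n : ℕ) :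
    ∫⁻ w, (∫⁻ t in Set.Ioi (0 : ℝ), (Set.Ico (clockTime w n) (clockTime w (n + 1))).indicator 1 t
        * ENNReal.ofReal (Real.exp (-(l * t)))) ∂clockLaw a
      = ENNReal.ofReal ((a / (a + l)) ^ n / (a + l)) := by
  have := isProbabilityMeasure_clockLaw ha
  have hle : ∀ᵐ w ∂clockLaw a, ENNReal.ofReal (Real.exp (-(l * clockTime w (n + 1))))
      ≤ ENNReal.ofReal (Real.exp (-(l * clockTime w n))) := by
    filter_upwards [ae_nonneg_clockLaw ha] with w hw
    refine ENNReal.ofReal_le_ofReal (Real.exp_le_exp.2 (neg_le_neg ?_))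
    gcongr
    exact clockTime_mono hw (Nat.le_succ n)
  have h1 : ∀ᵐ w ∂clockLaw a, ∫⁻ t in Set.Ioi (0 : ℝ),
      (Set.Ico (clockTime w n) (clockTime w (n + 1))).indicator 1 t
        * ENNReal.ofReal (Real.exp (-(l * t)))
      = ENNReal.ofReal (l⁻¹) * (ENNReal.ofReal (Real.exp (-(l * clockTime w n)))
        - ENNReal.ofReal (Real.exp (-(l * clockTime w (n + 1))))) := by
    filter_upwards [ae_nonneg_clockLaw ha] with w hw
    exact lintegral_Ico_exp_neg hl (Finset.sum_nonneg fun k _ => hw k)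
      (clockTime_mono hw (Nat.le_succ n))
  have m1 := measurable_clockTime n
  have m2 := measurable_clockTime (n + 1)
  rw [lintegral_congr_ae h1, lintegral_const_mul _ (by fun_prop),
    lintegral_sub (by fun_prop)
      (by rw [lintegral_exp_neg_clockTime ha hl]; exact ENNReal.ofReal_ne_top) hle,
    lintegral_exp_neg_clockTime ha hl, lintegral_exp_neg_clockTime ha hl,
    ← ENNReal.ofReal_sub _ (by positivity), ← ENNReal.ofReal_mul (by positivity)]
  congr 1
  rw [pow_succ]
  field_simp
  ring

/-! ### The Laplace transform of the mean square displacement -/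

variable {M : Model} {ε : ℝ} {p : Fin 2 → ℝ}

/-- The mean square displacement after `n` jumps. -/
noncomputable def meanSqJump (M : Model) (ε : ℝ) (p : Fin 2 → ℝ) (n : ℕ) : ℝ≥0∞ :=
  ∫⁻ ω, ∫⁻ m, ENNReal.ofReal (sqNorm (chainState (ω, 0) m n).2)
    ∂Measure.infinitePi (fun _ : ℕ => jumpLaw (d := 2) M ε) ∂envLaw p

theorem measurable_sqNorm : Measurable (sqNorm (d := 2)) := measurable_of_countable _

theorem measurable_sqNorm_chainState (n : ℕ) : Measurable fun q : Env 2 × (ℕ → Jump 2) =>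
    ENNReal.ofReal (sqNorm (chainState (q.1, 0) q.2 n).2) := by
  have h : Measurable fun q : Env 2 × (ℕ → Jump 2) => chainState (q.1, 0) q.2 n :=
    (measurable_chainState n).comp ((measurable_fst.prodMk measurable_const).prodMk measurable_snd)
  exact (measurable_sqNorm.comp (measurable_snd.comp h)).ennreal_ofReal

/-- Decompose by the number of jumps; the chain and the clock are independent, so each term
factorises. -/
theorem meanSq_eq_tsum (hε : 0 < ε) {t : ℝ} (ht : 0 ≤ t) :
    meanSq M ε p t = ∑' n, meanSqJump M ε p n * ∫⁻ w,
      (Set.Ico (clockTime w n) (clockTime w (n + 1))).indicator 1 t ∂clockLaw (1 + ε) := by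
  have hΛ : 0 < 1 + ε := by linarith
  have := isProbabilityMeasure_jumpLaw (d := 2) two_ne_zero M hε
  have := isProbabilityMeasure_clockLaw hΛ
  set κ := Measure.infinitePi (fun _ : ℕ => jumpLaw (d := 2) M ε) with hκ
  have hlaw : sampleLaw M ε p = (envLaw p).prod (κ.prod (clockLaw (1 + ε))) := rfl
  have hq : Measure.QuasiMeasurePreserving (fun s : Sample 2 => s.2.2) (sampleLaw M ε p)
      (clockLaw (1 + ε)) := by
    rw [hlaw]
    exact Measure.quasiMeasurePreserving_snd.comp Measure.quasiMeasurePreserving_snd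
  have hind : ∀ n, Measurable fun w : ℕ → ℝ =>
      (Set.Ico (clockTime w n) (clockTime w (n + 1))).indicator (1 : ℝ → ℝ≥0∞) t := by
    intro n
    have : (fun w : ℕ → ℝ => (Set.Ico (clockTime w n) (clockTime w (n + 1))).indicator
        (1 : ℝ → ℝ≥0∞) t)
        = {w : ℕ → ℝ | clockTime w n ≤ t ∧ t < clockTime w (n + 1)}.indicator 1 := by
      funext w
      simp [Set.indicator_apply]
    rw [this]
    exact measurable_one.indicator ((measurableSet_le (measurable_clockTime n)
      measurable_const).inter (measurableSet_lt measurable_const (measurable_clockTime (n + 1))))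
  have hF := measurable_sqNorm_chainState
  have h1 : meanSq M ε p t = ∫⁻ s : Sample 2, ∑' n,
      ENNReal.ofReal (sqNorm (chainState (s.1, 0) s.2.1 n).2)
        * (Set.Ico (clockTime s.2.2 n) (clockTime s.2.2 (n + 1))).indicator 1 t
      ∂sampleLaw M ε p := by
    refine lintegral_congr_ae ?_
    filter_upwards [hq.ae (ae_nonneg_clockLaw hΛ), hq.ae (ae_exists_lt_clockTime hΛ t)]
      with s hs1 hs2
    have := apply_jumpCount_eq_tsum s ht hs1 hs2 fun n => ENNReal.ofReal (sqNorm (chainPos s n))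
    simp only [chainState_eq]
    exact this
  rw [h1, hlaw, lintegral_tsum]
  · refine tsum_congr fun n => ?_
    have hFn := hF n
    have hIn := hind n
    have hG : Measurable fun s : Sample 2 =>
        ENNReal.ofReal (sqNorm (chainState (s.1, 0) s.2.1 n).2)
          * (Set.Ico (clockTime s.2.2 n) (clockTime s.2.2 (n + 1))).indicator (1 : ℝ → ℝ≥0∞) t :=
      (hFn.comp (measurable_fst.prodMk (measurable_fst.comp measurable_snd))).mul
        (hIn.comp (measurable_snd.comp measurable_snd))
    rw [lintegral_prod _ hG.aemeasurable]
    have h2 : ∀ ω : Env 2, ∫⁻ q : (ℕ → Jump 2) × (ℕ → ℝ),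
        ENNReal.ofReal (sqNorm (chainState (ω, 0) q.1 n).2)
          * (Set.Ico (clockTime q.2 n) (clockTime q.2 (n + 1))).indicator 1 t
          ∂κ.prod (clockLaw (1 + ε))
        = (∫⁻ m, ENNReal.ofReal (sqNorm (chainState (ω, 0) m n).2) ∂κ)
          * ∫⁻ w, (Set.Ico (clockTime w n) (clockTime w (n + 1))).indicator 1 t
            ∂clockLaw (1 + ε) := fun ω =>
      lintegral_prod_mul (hFn.comp (measurable_const.prodMk measurable_id)).aemeasurable
        hIn.aemeasurable
    simp only [h2]
    rw [lintegral_mul_const _ hFn.lintegral_prod_right']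
    rfl
  · intro n
    exact ((hF n).comp (measurable_fst.prodMk (measurable_fst.comp measurable_snd))).mul
        ((hind n).comp (measurable_snd.comp measurable_snd)) |>.aemeasurable

/-- By Tonelli the clock contributes geometric weights, so the Laplace transform is a generating
function of the embedded chain. -/
theorem laplaceMeanSq_eq_tsum (hε : 0 < ε) {l : ℝ} (hl : 0 < l) :
    laplaceMeanSq M ε p l = ∑' n, meanSqJump M ε p n
      * ENNReal.ofReal (((1 + ε) / (1 + ε + l)) ^ n / (1 + ε + l)) := by
  have hΛ : 0 < 1 + ε := by linarith
  have := isProbabilityMeasure_clockLaw hΛ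
  have hind : ∀ n, Measurable fun q : ℝ × (ℕ → ℝ) =>
      (Set.Ico (clockTime q.2 n) (clockTime q.2 (n + 1))).indicator (1 : ℝ → ℝ≥0∞) q.1 := by
    intro n
    have : (fun q : ℝ × (ℕ → ℝ) => (Set.Ico (clockTime q.2 n) (clockTime q.2 (n + 1))).indicator
        (1 : ℝ → ℝ≥0∞) q.1)
        = {q : ℝ × (ℕ → ℝ) | clockTime q.2 n ≤ q.1 ∧ q.1 < clockTime q.2 (n + 1)}.indicator 1 := by
      funext q
      simp [Set.indicator_apply]
    rw [this]
    exact measurable_one.indicator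
      ((measurableSet_le ((measurable_clockTime n).comp measurable_snd) measurable_fst).inter
        (measurableSet_lt measurable_fst ((measurable_clockTime (n + 1)).comp measurable_snd)))
  have hexp : Measurable fun t : ℝ => ENNReal.ofReal (Real.exp (-(l * t))) := by fun_prop
  have h1 : laplaceMeanSq M ε p l = ∫⁻ t in Set.Ioi (0 : ℝ), ∑' n, meanSqJump M ε p n *
      ((∫⁻ w, (Set.Ico (clockTime w n) (clockTime w (n + 1))).indicator 1 t ∂clockLaw (1 + ε))
        * ENNReal.ofReal (Real.exp (-(l * t)))) := by
    refine setLIntegral_congr_fun measurableSet_Ioi fun t ht => ?_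
    rw [meanSq_eq_tsum hε (le_of_lt ht), ← ENNReal.tsum_mul_right]
    simp only [mul_assoc]
  have hm : ∀ n, Measurable fun t : ℝ =>
      (∫⁻ w, (Set.Ico (clockTime w n) (clockTime w (n + 1))).indicator 1 t ∂clockLaw (1 + ε))
        * ENNReal.ofReal (Real.exp (-(l * t))) := fun n =>
    (hind n).lintegral_prod_right'.mul hexp
  rw [h1, lintegral_tsum fun n => ((hm n).const_mul _).aemeasurable]
  refine tsum_congr fun n => ?_
  rw [lintegral_const_mul _ (hm n), ← lintegral_clock hΛ hl n]
  congr 1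
  have h2 : ∀ t : ℝ,
      (∫⁻ w, (Set.Ico (clockTime w n) (clockTime w (n + 1))).indicator 1 t ∂clockLaw (1 + ε))
        * ENNReal.ofReal (Real.exp (-(l * t)))
      = ∫⁻ w, (Set.Ico (clockTime w n) (clockTime w (n + 1))).indicator 1 t
        * ENNReal.ofReal (Real.exp (-(l * t))) ∂clockLaw (1 + ε) := fun t =>
    (lintegral_mul_const _ ((hind n).comp (measurable_const.prodMk measurable_id))).symm
  simp only [h2]
  rw [lintegral_lintegral_swap]
  exact ((hind n).mul (hexp.comp measurable_fst)).aemeasurable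

variable [IsProbabilityMeasure (arrowLaw p)]

theorem meanSqJump_eq (hε : 0 < ε) (n : ℕ) :
    meanSqJump M ε p n = ENNReal.ofReal (∑ i, meanSqStep M ε p i n) := by
  have := isProbabilityMeasure_jumpLaw (d := 2) two_ne_zero M hε
  have hnn : ∀ z : Site 2, 0 ≤ sqNorm z := fun z => Finset.sum_nonneg fun _ _ => sq_nonneg _
  have hm : ∀ ω, Measurable fun m : ℕ → Jump 2 => chainState (ω, 0) m n := fun ω =>
    (measurable_chainState n).comp (measurable_const.prodMk measurable_id)
  have hint : ∀ ω i, Integrable (fun m => ((chainState (ω, 0) m n).2 i : ℝ) ^ 2)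
      (Measure.infinitePi (fun _ : ℕ => jumpLaw (d := 2) M ε)) := by
    intro ω i
    refine Integrable.of_bound (C := (n : ℝ) ^ 2) (Measurable.aestronglyMeasurable ?_)
      (Filter.Eventually.of_forall fun m => ?_)
    · exact (measurable_of_countable fun x : Site 2 => (x i : ℝ) ^ 2).comp
        (measurable_snd.comp (hm ω))
    · have := abs_chainState_le (ω, 0) m i n
      simp only [Pi.zero_apply, Int.cast_zero, abs_zero, zero_add] at this
      rw [norm_pow, Real.norm_eq_abs]
      gcongr
  have h1 : ∀ ω, ∫⁻ m, ENNReal.ofReal (sqNorm (chainState (ω, 0) m n).2)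
      ∂Measure.infinitePi (fun _ : ℕ => jumpLaw (d := 2) M ε)
      = ENNReal.ofReal (∑ i, (transition M ε)^[n] (fun z => (z.2 i : ℝ) ^ 2) (ω, 0)) := by
    intro ω
    have hs := integrable_finsetSum Finset.univ fun i _ => hint ω i
    rw [← ofReal_integral_eq_lintegral_ofReal (f := fun m => sqNorm (chainState (ω, 0) m n).2) hs
      (Filter.Eventually.of_forall fun _ => hnn _)]
    congr 1
    simp only [sqNorm]
    rw [integral_finsetSum _ fun i _ => hint ω i]
    refine Finset.sum_congr rfl fun i _ => ?_
    exact integral_chainState hε (ω, 0) (fun z => (z.2 i : ℝ) ^ 2) n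
  have h2 : ∀ i ω, (transition M ε)^[n] (fun z => (z.2 i : ℝ) ^ 2) (ω, 0)
      = (sqCoeff M ε i n).2 ω := fun i ω => by simp [transition_iterate_sq hε]
  have h3 : ∀ i ω, 0 ≤ (sqCoeff M ε i n).2 ω := fun i ω => by
    rw [← h2, ← integral_chainState hε]
    exact integral_nonneg fun _ => sq_nonneg _
  have h4 : ∀ i, Integrable (sqCoeff M ε i n).2 (envLaw p) := fun i =>
    (isBddMeas_sqCoeff i n).2.integrable
  simp only [meanSqJump, h1, h2, meanSqStep_eq hε]
  rw [← integral_finsetSum _ fun i _ => h4 i, ofReal_integral_eq_lintegral_ofReal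
    (integrable_finsetSum _ fun i _ => h4 i)
    (Filter.Eventually.of_forall fun ω => Finset.sum_nonneg fun i _ => h3 i ω)]

/-- The Laplace transform of the mean square displacement, in terms of the resolvent of the
generator. -/
theorem exists_laplaceMeanSq_eq (hε : 0 < ε) (M : Model) {l : ℝ} (hl : 0 < l) :
    ∃ u : Fin 2 → L2 p,
      (∀ i, (envOps p).resolventOp M ε l (u i) = (envOps p).drift M (toL2 p (arrowFn i none))) ∧
      (∀ i, 0 ≤ ((1 + ε) * ∫ ω, meanStepSq M ε i ω ∂envLaw p
        + 2 * inner ℝ ((envOps p).revDrift M (toL2 p (arrowFn i none))) (u i)) / l ^ 2) ∧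
      laplaceMeanSq M ε p l = ENNReal.ofReal (∑ i,
        ((1 + ε) * ∫ ω, meanStepSq M ε i ω ∂envLaw p
          + 2 * inner ℝ ((envOps p).revDrift M (toL2 p (arrowFn i none))) (u i)) / l ^ 2) := by
  have hΛl : 0 < 1 + ε + l := by linarith
  choose u hu hsum using fun i => exists_hasSum_meanSqStep (p := p) hε M i hl
  have hnn : ∀ i n, 0 ≤ meanSqStep M ε p i n := fun i n => by
    unfold meanSqStep
    refine integral_nonneg fun ω => ?_
    rw [← integral_chainState hε]
    exact integral_nonneg fun _ => sq_nonneg _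
  have hterm : ∀ i n, 0 ≤ ((1 + ε) / (1 + ε + l)) ^ n * meanSqStep M ε p i n := fun i n =>
    mul_nonneg (pow_nonneg (by positivity) _) (hnn i n)
  refine ⟨u, hu, fun i => ?_, ?_⟩
  -- Each coordinate is a sum of nonnegative terms; the lower bound uses this to discard the other
  -- coordinate.
  · refine (div_nonneg ((hsum i).nonneg (hterm i)) hΛl.le).trans (le_of_eq ?_)
    field_simp
  have h1 := (hasSum_sum fun i (_ : i ∈ Finset.univ) => hsum i).div_const (1 + ε + l)
  rw [laplaceMeanSq_eq_tsum hε hl]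
  have h2 : ∀ n, meanSqJump M ε p n
      * ENNReal.ofReal (((1 + ε) / (1 + ε + l)) ^ n / (1 + ε + l))
      = ENNReal.ofReal
        ((∑ i, ((1 + ε) / (1 + ε + l)) ^ n * meanSqStep M ε p i n) / (1 + ε + l)) := by
    intro n
    rw [meanSqJump_eq hε, ← ENNReal.ofReal_mul (Finset.sum_nonneg fun i _ => hnn i n),
      ← Finset.mul_sum]
    congr 1
    ring
  simp only [h2]
  rw [← ENNReal.ofReal_tsum_of_nonneg _ h1.summable, h1.tsum_eq, Finset.sum_div]
  · congr 1
    refine Finset.sum_congr rfl fun i _ => ?_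
    field_simp
  · intro n
    exact div_nonneg (Finset.sum_nonneg fun i _ => hterm i n) hΛl.le

end StoredMomentum

/-! ### The two bounds for the Laplace transform. -/

namespace StoredMomentum

open MeasureTheory

theorem exists_laplaceMeanSq_le {ε : ℝ} (hε : 0 < ε) {p : Fin 2 → ℝ}
    (hp : p ∈ stdSimplex ℝ (Fin 2)) :
    ∃ D : ℝ, 0 < D ∧ ∀ M : Model, ∀ᶠ l : ℝ in 𝓝[>] 0,
      laplaceMeanSq M ε p l ≤ ENNReal.ofReal (D * (l ^ 2)⁻¹ * Real.log l⁻¹) := by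
  have := isProbabilityMeasure_arrowLaw hp
  have hc : 0 < min 1 (ε / 4) := lt_min one_pos (by positivity)
  -- Two coordinates, each contributing `1 + ε` from the step variance (as `log l⁻¹ ≥ 1`) and twice
  -- the resolvent bound.
  refine ⟨2 * (1 + ε) + 4 * (16 / min 1 (ε / 4)), by positivity, fun M => ?_⟩
  have hsmall : ∀ᶠ l : ℝ in 𝓝[>] 0, l ≤ 1 / 16 :=
    Filter.Eventually.filter_mono nhdsWithin_le_nhds (eventually_le_nhds (by norm_num))
  filter_upwards [self_mem_nhdsWithin, hsmall] with l hl hl1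
  have hl0 : (0 : ℝ) < l := hl
  obtain ⟨u, hu, -, heq⟩ := exists_laplaceMeanSq_eq (p := p) hε M hl0
  have hL1 : 1 ≤ Real.log l⁻¹ := by
    rw [Real.le_log_iff_exp_le (by positivity), le_inv_comm₀ (Real.exp_pos _) hl0]
    refine hl1.trans ?_
    rw [one_div]
    exact inv_anti₀ (Real.exp_pos _) (Real.exp_one_lt_d9.le.trans (by norm_num))
  rw [heq]
  refine ENNReal.ofReal_le_ofReal ?_
  have h1 : ∀ i, ((1 + ε) * ∫ ω, meanStepSq M ε i ω ∂envLaw p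
      + 2 * inner ℝ ((envOps p).revDrift M (toL2 p (arrowFn i none))) (u i)) / l ^ 2
      ≤ ((1 + ε) * Real.log l⁻¹ + 2 * (16 / min 1 (ε / 4) * Real.log l⁻¹)) / l ^ 2 := by
    intro i
    have h2 := (isArrowFamily (p := p) i).inner_revDrift_le hε hl0 hl1 M (hu i)
    have h3 := (integral_meanStepSq_mem (p := p) (M := M) hε i).2
    gcongr
    exact h3.trans hL1
  refine (Finset.sum_le_sum fun i _ => h1 i).trans (le_of_eq ?_)
  rw [Finset.sum_const, Finset.card_univ, Fintype.card_fin, nsmul_eq_mul]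
  push_cast
  ring

theorem exists_le_laplaceMeanSq {ε : ℝ} (hε : 0 < ε) {p : Fin 2 → ℝ}
    (hp : p ∈ stdSimplex ℝ (Fin 2)) {i : Fin 2} (hi : ∀ k, k ≠ i → p k = 0) :
    ∃ C : ℝ, 0 < C ∧ ∀ M : Model, ∀ᶠ l : ℝ in 𝓝[>] 0,
      ENNReal.ofReal (C * (l ^ 2)⁻¹ * √(Real.log l⁻¹)) ≤ laplaceMeanSq M ε p l := by
  have := isProbabilityMeasure_arrowLaw hp
  obtain ⟨C, hC, L₀, hL₀, key⟩ := WalkOps.IsPairFamily.exists_le_inner_revDrift hε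
  -- Only the resolvent term of coordinate `i` is kept; the 2 is its factor in the formula for the
  -- Laplace transform.
  refine ⟨2 * C, by positivity, fun M => ?_⟩
  have hlog : ∀ᶠ l : ℝ in 𝓝[>] 0, L₀ ≤ Real.log l⁻¹ :=
    (Real.tendsto_log_atTop.comp tendsto_inv_nhdsGT_zero).eventually_ge_atTop L₀
  filter_upwards [self_mem_nhdsWithin, hlog] with l hl hL
  have hl0 : (0 : ℝ) < l := hl
  obtain ⟨u, hu, hnn, heq⟩ := exists_laplaceMeanSq_eq (p := p) hε M hl0
  rw [heq]
  refine ENNReal.ofReal_le_ofReal ?_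
  have h1 := key (isArrowFamily i) (isPairFamily hi) l hl0 hL M (u i) (hu i)
  have h2 := (integral_meanStepSq_mem (p := p) (M := M) hε i).1
  refine le_trans ?_ (Finset.single_le_sum (fun k _ => hnn k) (Finset.mem_univ i))
  rw [mul_right_comm, ← div_eq_mul_inv]
  gcongr
  nlinarith

end StoredMomentum

open StoredMomentum in
theorem theorem1p4 (ε : ℝ) (hε : 0 < ε) :
    (∀ p ∈ stdSimplex ℝ (Fin 2), ∃ D : ℝ, 0 < D ∧ ∀ M : Model, ∀ᶠ l : ℝ in 𝓝[>] 0,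
      laplaceMeanSq M ε p l ≤ ENNReal.ofReal (D * (l ^ 2)⁻¹ * Real.log l⁻¹)) ∧
    (∀ p : Fin 2 → ℝ, p = ![1, 0] ∨ p = ![0, 1] →
      ∃ C : ℝ, 0 < C ∧ ∀ M : Model, ∀ᶠ l : ℝ in 𝓝[>] 0,
        ENNReal.ofReal (C * (l ^ 2)⁻¹ * √(Real.log l⁻¹)) ≤ laplaceMeanSq M ε p l) := by
  refine ⟨fun p hp => exists_laplaceMeanSq_le hε hp, ?_⟩
  rintro p (rfl | rfl)
  · refine exists_le_laplaceMeanSq hε (i := 0) ?_ ?_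
    · simp [stdSimplex, Fin.forall_fin_two]
    · simp [Fin.forall_fin_two]
  · refine exists_le_laplaceMeanSq hε (i := 1) ?_ ?_
    · simp [stdSimplex, Fin.forall_fin_two]
    · simp [Fin.forall_fin_two]
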